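/- **Setting.** Let $1\le N\le 3$, let $D\subset\mathbb R^N$ be open and bounded with Lipschitz boundary, $T>0$, $M\in\mathbb R$. Let $f:\mathbb R\to\mathbb R$ be bounded and Lipschitz with $f(0)=f(1)=0$ and $f\ge 0$ on $(0,1)$. Norms of $W^{1,p}(D)$ are $\|v\|_{L^p}+\|\nabla v\|_{L^p}$, and $H^1(D)=W^{1,2}(D)$. *Problem 1.* Data are $\xi=(\alpha,\beta,V,u^0)\in L^\infty((0,T)\times D)^2\times L^\infty((0,T);W^{1,\infty}(D))\times L^2(D)$, with metric $$d(\xi,\xi')=\|\alpha-\alpha'\|_{L^\infty}+\|\beta-\beta'\|_{L^\infty}+\|V-V'\|_{L^\infty((0,T);W^{1,\infty}(D))}+\|u^0-u'^0\|_{L^2(D)}.$$ They are *admissible* if $\alpha\ge\alpha_0$, $\beta\ge\beta_0$ a.e. for some $\alpha_0,\beta_0>0$, $0\le u^0\le 1$ a.e., and the norms of $\alpha,\beta,V$ are at most $M$. $\mathcal S(\xi)=u\in L^2((0,T);H^1(D))$ is the weak solution: $\partial_tu\in L^2((0,T);H^1(D)^*)$, $u(0)=u^0$ (for the representative of $u$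 in $C([0,T];L^2(D))$), and for all $\varphi\in H^1(D)$ and a.e. $t$ $$\langle\partial_tu,\varphi\rangle-\int_D(-\nabla u+f(u)\nabla V)\cdot\nabla\varphi\,dx+\int_D\beta u\varphi\,dx-\int_D\alpha f(u)\varphi\,dx=0 .$$ *Problem 2.* Let $\Gamma_{in},\Gamma_{out}\subset\partial D$ be disjoint and relatively open, $\Gamma_{out}\neq\emptyset$, and let $g:\mathbb R\to\mathbb R$ be bounded, Lipschitz and decreasing (in the weak sense) with $g(0)=1$, $g(1)=0$. Data are $\xi=(a,b,V,u^0)\in L^\infty((0,T)\times\Gamma_{in})\times L^\infty((0,T)\times\Gamma_{out})\times L^2((0,T);W^{1,\infty}(D))\times L^2(D)$ with surface measure $\sigma$ on $\partial D$, and $d$ is again the sum of the norms of the differences of the components. They are *admissible* if $a_0\le a\le1$, $b_0\le b\le 1$ a.e. for some $a_0,b_0>0$, $\Delta V=0$ weakly in $D$ at a.e. time, $0\le u^0\le1$ a.e., and $\|V\|_{L^2((0,T);W^{1,\infty}(D))}\le M$. $\mathcal S(\xi)=u$ is the weak solution in the same sense, with equation (boundary values are traces) $$\langle\partial_tu,\varphi\rangle-\int_D(-\nabla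 u+f(u)\nabla V)\cdot\nabla\varphi\,dx+\int_{\Gamma_{out}}b\,u\,\varphi\,d\sigma=\int_{\Gamma_{in}}a\,g(u)\,\varphi\,d\sigma .$$ In either problem let $\Xi$ be the space of all data with its Borel $\sigma$-algebra. For $t\in[0,T]$ let $\mathcal F_t$ be the $\sigma$-algebra on $\Xi$ generated by the values up to time $t$ of $\alpha,\beta,V$ (resp. $a,b,V$), i.e. by their integrals over the sets $(0,s)\times A$, $s\le t$, $A$ Borel. For a probability measure $P$ on $\Xi$, $P^{|\mathcal F_t}$ denotes a version of the regular conditional distribution of $P$ given $\mathcal F_t$, with values $P^{|\mathcal F_t}_\xi$, $\xi\in\Xi$. For probability measures $\mu,\nu$ on $\Xi$, the *nested distance* is $$\mathrm{nd}_2(\mu,\nu)=\Big(\inf_\pi\int d(\xi,\tilde\xi)^2\,\pi(d\xi,d\tilde\xi)\Big)^{1/2},$$ over all couplings $\pi$ of $\mu,\nu$ such that, for all $s\in[0,T]$ and Borel $A,B\subset\Xi$, $\pi$-a.s., $\pi(A\times\Xi\mid\mathcal F_s\otimes\mathcal F_s)=\mu(A\mid\mathcal F_s)$ and $\pi(\Xi\times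 B\mid\mathcal F_s\otimes\mathcal F_s)=\nu(B\mid\mathcal F_s)$. For $t\in[0,T]$ let $\mu_t$ be the restriction of $\mu$ to $\mathcal F_t$, and let $d_r(\mu_t,\nu_t)$ be the Wasserstein distance of order $r$ on $(\Xi,\mathcal F_t)$: $d_r(\mu_t,\nu_t)^r$ is the infimum of $\int d^{(t)}(\xi,\tilde\xi)^r\,d\pi$ over the couplings $\pi$ of $\mu_t,\nu_t$ on $\mathcal F_t\otimes\mathcal F_t$, where $d^{(t)}$ is the sum of the norms of the differences of $\alpha,\beta,V$ (resp. $a,b,V$) on the time interval $(0,t)$. **Statement.** In Problem 1 there are constants $C,\tilde C>0$, depending only on $N,D,T,f,M$, and in Problem 2 there are such constants depending only on $N,D,T,f,M,\Gamma_{in},\Gamma_{out},g$, with the following two properties. (i) $\|\mathcal S(\xi)-\mathcal S(\xi')\|_{L^2((0,T);H^1(D))}\le C\,e^{\tilde CT/2}\,d(\xi,\xi')$ for all admissible $\xi,\xi'$. (ii) Let $\Phi:L^2((0,T);H^1(D))\to\mathbb R$ be Lipschitz with constant $L_\Phi\ge0$, let $P,\tilde P$ be Borel probability measures on $\Xi$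 under which the data are a.s. admissible, and let $P^{|\mathcal F_t},\tilde P^{|\mathcal F_t}$, $t\in[0,T]$, be regular conditional distributions. Suppose that for some $r\ge1$, $C_H>0$ and all $0\le t'<t\le T$, $$d_r\big(P_t^{|\mathcal F_{t'}},\tilde P_t^{|\mathcal F_{t'}}\big)^r\le C_H\,|t'-t|\quad\text{a.s.},$$ i.e. for all $\xi$ in the intersection of a set of full $P$-measure and a set of full $\tilde P$-measure, both conditional distributions being taken at $\xi$. Then for every $t\in[0,T]$ there are sets $\Omega_t$ with $P(\Omega_t)=1$ and $\tilde\Omega_t$ with $\tilde P(\tilde\Omega_t)=1$ such that for all $\xi\in\Omega_t$, $\tilde\xi\in\tilde\Omega_t$ (in particular for $\xi=\tilde\xi\in\Omega_t\cap\tilde\Omega_t$) the function $\Phi\circ\mathcal S$ is integrable for $P^{|\mathcal F_t}_\xi$ and for $\tilde P^{|\mathcal F_t}_{\tilde\xi}$, and $$\Big|\mathbb E_{P^{|\mathcal F_t}_\xi}\Phi(\mathcal S)-\mathbb E_{\tilde P^{|\mathcal F_t}_{\tilde\xi}}\Phi(\mathcal S)\Big|\le L_\Phi\,C\,\max\big(1,\sqrt{C_H(T-t)}\big)\,e^{\tilde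 C(T-t)/2}\ \mathrm{nd}_2\big(P^{|\mathcal F_t}_\xi,\tilde P^{|\mathcal F_t}_{\tilde\xi}\big).$$ -/

import Mathlib

open MeasureTheory ProbabilityTheory Set Filter Topology
open scoped ENNReal NNReal ContDiff

noncomputable section

/-! ## Probability: conditional distributions, Wasserstein distance, nested distance -/

section Prob

variable {X : Type*}

/-- `κ` is a (version of the) regular conditional distribution `P(· | m)` of the probability
measure `P` given the σ-algebra `m`. -/
structure IsRegularCondProb {m₀ : MeasurableSpace X} (P : @Measure X m₀) (κ : X → @Measure X m₀)
    (m : MeasurableSpace X) : Prop where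
  isProb : ∀ ξ, IsProbabilityMeasure (κ ξ)
  meas : ∀ A, MeasurableSet[m₀] A → Measurable[m] fun ξ => κ ξ A
  setLIntegral_eq : ∀ A, MeasurableSet[m₀] A → ∀ B, MeasurableSet[m] B →
    ∫⁻ ξ in B, κ ξ A ∂P = P (A ∩ B)

/-- The Wasserstein distance of order `r`, for the cost `d`, of the restrictions of `μ` and `ν` to
the σ-algebra `m`: the infimum is over all measures on the product whose marginals agree
with `μ` and `ν` on `m`. -/
def wassersteinDist (m : MeasurableSpace X) (d : X → X → ℝ≥0∞) (r : ℝ)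
    {m₀ : MeasurableSpace X} (μ ν : @Measure X m₀) : ℝ≥0∞ :=
  (⨅ (π : @Measure (X × X) (m.prod m))
    (_ : (∀ A, MeasurableSet[m] A → π (A ×ˢ univ) = μ A) ∧
      ∀ B, MeasurableSet[m] B → π (univ ×ˢ B) = ν B),
    ∫⁻ z, d z.1 z.2 ^ r ∂π) ^ (1 / r)

/-- `π` is a coupling of `μ` and `ν` with conditional marginals `μ(· | F t)` and `ν(· | G t)`
for all times `t ∈ [0, T]`. -/
structure IsNestedCoupling [MeasurableSpace X] (T : ℝ) (F G : ℝ → MeasurableSpace X)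
    (μ ν : Measure X) (π : Measure (X × X)) : Prop where
  isProb : IsProbabilityMeasure π
  marginal_fst : ∀ A, MeasurableSet A → π (A ×ˢ univ) = μ A
  marginal_snd : ∀ B, MeasurableSet B → π (univ ×ˢ B) = ν B
  cond_fst : ∀ t ∈ Icc 0 T, ∀ A, MeasurableSet A →
    π⟦A ×ˢ univ | (F t).prod (G t)⟧ =ᵐ[π] fun z => (μ⟦A | F t⟧) z.1
  cond_snd : ∀ t ∈ Icc 0 T, ∀ B, MeasurableSet B →
    π⟦univ ×ˢ B | (F t).prod (G t)⟧ =ᵐ[π] fun z => (ν⟦B | G t⟧) z.2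

/-- The nested distance (process distance) of order `r` of `(μ, F)` and `(ν, G)`. -/
def nestedDist [MeasurableSpace X] (T : ℝ) (F G : ℝ → MeasurableSpace X) (d : X → X → ℝ≥0∞)
    (r : ℝ) (μ ν : Measure X) : ℝ≥0∞ :=
  (⨅ (π : Measure (X × X)) (_ : IsNestedCoupling T F G μ ν π),
    ∫⁻ z, d z.1 z.2 ^ r ∂π) ^ (1 / r)

/-- Hölder continuity in time of the conditional Wasserstein distances:
`d_r(P_t^{|F_s}, Q_t^{|F_s})^r ≤ C_H |s - t|` almost surely, for all `s < t ≤ T`. Here `P_t` is the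
restriction of `P` to `F t`, `dt t` is the distance of the data up to time `t`, and `κ s`, `κ' s`
are the conditional distributions of `P`, `Q` given `F s`. -/
def ConditionalHolder [MeasurableSpace X] (T : ℝ) (F : ℝ → MeasurableSpace X)
    (dt : ℝ → X → X → ℝ≥0∞) (r CH : ℝ) (P Q : Measure X) (κ κ' : ℝ → X → Measure X) : Prop :=
  ∀ s t : ℝ, 0 ≤ s → s < t → t ≤ T → ∀ᶠ ξ in ae P ⊓ ae Q,
    wassersteinDist (F t) (dt t) r (κ s ξ) (κ' s ξ) ^ r ≤ ENNReal.ofReal (CH * |s - t|)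

end Prob

/-! ## Domains and function spaces -/

section Spaces

variable {N : ℕ}

/-- The bounded open set `D` has a Lipschitz boundary: near every boundary point, in some
direction `e`, it is the strict epigraph of a Lipschitz function of the component
orthogonal to `e`. -/
def HasLipschitzBoundary (D : Set (EuclideanSpace ℝ (Fin N))) : Prop :=
  ∀ x₀ ∈ frontier D, ∃ (e : EuclideanSpace ℝ (Fin N)) (ζ : EuclideanSpace ℝ (Fin N) → ℝ)
    (K : ℝ≥0), ‖e‖ = 1 ∧ LipschitzWith K ζ ∧
    ∀ᶠ x in 𝓝 x₀, (x ∈ D ↔ ζ (x - inner ℝ e x • e) < inner ℝ e x)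

/-- Lebesgue measure on `D`. -/
abbrev spaceMeasure (D : Set (EuclideanSpace ℝ (Fin N))) : Measure (EuclideanSpace ℝ (Fin N)) :=
  volume.restrict D

/-- Lebesgue measure on `(0, t)`. -/
abbrev timeMeasure (t : ℝ) : Measure ℝ := volume.restrict (Ioo 0 t)

/-- The surface measure on a subset `Γ` of the boundary of a domain. -/
abbrev surfaceMeasure (Γ : Set (EuclideanSpace ℝ (Fin N))) : Measure (EuclideanSpace ℝ (Fin N)) :=
  (μHE[N - 1] : Measure (EuclideanSpace ℝ (Fin N))).restrict Γ

/-- Smooth test functions with compact support in `D`. -/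
def IsTestFunction (D : Set (EuclideanSpace ℝ (Fin N))) (φ : EuclideanSpace ℝ (Fin N) → ℝ) :
    Prop :=
  ContDiff ℝ ∞ φ ∧ HasCompactSupport φ ∧ tsupport φ ⊆ D

/-- `G` is the weak gradient of `v` on `D`. -/
def IsWeakGradient (D : Set (EuclideanSpace ℝ (Fin N))) (v : EuclideanSpace ℝ (Fin N) → ℝ)
    (G : EuclideanSpace ℝ (Fin N) → EuclideanSpace ℝ (Fin N)) : Prop :=
  ∀ φ, IsTestFunction D φ → ∀ e : EuclideanSpace ℝ (Fin N),
    ∫ x in D, v x * fderiv ℝ φ x e = - ∫ x in D, inner ℝ (G x) e * φ x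

lemma integrable_mul_of_test {D : Set (EuclideanSpace ℝ (Fin N))} {p : ℝ≥0∞} [Fact (1 ≤ p)]
    {v ψ : EuclideanSpace ℝ (Fin N) → ℝ} (hv : MemLp v p (spaceMeasure D))
    (hc : Continuous ψ) (hs : HasCompactSupport ψ) :
    Integrable (fun x => v x * ψ x) (spaceMeasure D) := by
  have h := (hv.locallyIntegrable Fact.out).integrable_smul_right_of_hasCompactSupport hc hs
  simpa [smul_eq_mul] using h

/-- The Sobolev space `W^{1,p}(D)`: pairs `(v, ∇v)` with the norm `‖v‖_{L^p} + ‖∇v‖_{L^p}`. -/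
def sobolev (D : Set (EuclideanSpace ℝ (Fin N))) (p : ℝ≥0∞) [Fact (1 ≤ p)] :
    Submodule ℝ (WithLp 1 (Lp ℝ p (spaceMeasure D) ×
      Lp (EuclideanSpace ℝ (Fin N)) p (spaceMeasure D))) where
  carrier := {q | IsWeakGradient D q.fst q.snd}
  zero_mem' := by
    intro φ hφ e
    have h1 : ∫ x in D, (0 : Lp ℝ p (spaceMeasure D)) x * fderiv ℝ φ x e = 0 := by
      refine integral_eq_zero_of_ae ?_
      filter_upwards [Lp.coeFn_zero ℝ p (spaceMeasure D)] with x hx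
      rw [hx]; simp
    have h2 : ∫ x in D, inner ℝ
        ((0 : Lp (EuclideanSpace ℝ (Fin N)) p (spaceMeasure D)) x) e * φ x = 0 := by
      refine integral_eq_zero_of_ae ?_
      filter_upwards [Lp.coeFn_zero (EuclideanSpace ℝ (Fin N)) p (spaceMeasure D)] with x hx
      rw [hx]; simp
    simp only [WithLp.zero_fst, WithLp.zero_snd]
    rw [h1, h2, neg_zero]
  add_mem' := by
    intro a b ha hb φ hφ e
    have hd : Continuous fun x => fderiv ℝ φ x e :=
      (hφ.1.continuous_fderiv (by simp)).clm_apply continuous_const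
    have hds : HasCompactSupport fun x => fderiv ℝ φ x e := hφ.2.1.fderiv_apply ℝ e
    have h1 : ∫ x in D, (a + b).fst x * fderiv ℝ φ x e
        = ∫ x in D, a.fst x * fderiv ℝ φ x e + b.fst x * fderiv ℝ φ x e := by
      refine integral_congr_ae ?_
      filter_upwards [Lp.coeFn_add a.fst b.fst] with x hx
      simp only [WithLp.add_fst, hx, Pi.add_apply]; ring
    have h2 : ∫ x in D, inner ℝ ((a + b).snd x) e * φ x
        = ∫ x in D, inner ℝ (a.snd x) e * φ x + inner ℝ (b.snd x) e * φ x := by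
      refine integral_congr_ae ?_
      filter_upwards [Lp.coeFn_add a.snd b.snd] with x hx
      simp only [WithLp.add_snd, hx, Pi.add_apply, inner_add_left]; ring
    rw [h1, h2, integral_add, integral_add, ha φ hφ e, hb φ hφ e]
    · ring
    · exact integrable_mul_of_test ((Lp.memLp a.snd).inner_const e) hφ.1.continuous hφ.2.1
    · exact integrable_mul_of_test ((Lp.memLp b.snd).inner_const e) hφ.1.continuous hφ.2.1
    · exact integrable_mul_of_test (Lp.memLp a.fst) hd hds
    · exact integrable_mul_of_test (Lp.memLp b.fst) hd hds
  smul_mem' := by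
    intro c a ha φ hφ e
    have h1 : ∫ x in D, (c • a).fst x * fderiv ℝ φ x e
        = ∫ x in D, c * (a.fst x * fderiv ℝ φ x e) := by
      refine integral_congr_ae ?_
      filter_upwards [Lp.coeFn_smul c a.fst] with x hx
      simp only [WithLp.smul_fst, hx, Pi.smul_apply, smul_eq_mul]; ring
    have h2 : ∫ x in D, inner ℝ ((c • a).snd x) e * φ x
        = ∫ x in D, c * (inner ℝ (a.snd x) e * φ x) := by
      refine integral_congr_ae ?_
      filter_upwards [Lp.coeFn_smul c a.snd] with x hx
      simp only [WithLp.smul_snd, hx, Pi.smul_apply, real_inner_smul_left]; ring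
    rw [h1, h2, integral_const_mul, integral_const_mul, ha φ hφ e]
    ring

/-- `H¹(D) = W^{1,2}(D)`. -/
abbrev H1 (D : Set (EuclideanSpace ℝ (Fin N))) : Type := sobolev D 2

/-- `W^{1,∞}(D)`. -/
abbrev W1inf (D : Set (EuclideanSpace ℝ (Fin N))) : Type := sobolev D ∞

/-- The function underlying an element of `W^{1,p}(D)`. -/
abbrev sobolevFun {D : Set (EuclideanSpace ℝ (Fin N))} {p : ℝ≥0∞} [Fact (1 ≤ p)]
    (v : sobolev D p) : Lp ℝ p (spaceMeasure D) := v.1.fst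

/-- The weak gradient of an element of `W^{1,p}(D)`. -/
abbrev sobolevGrad {D : Set (EuclideanSpace ℝ (Fin N))} {p : ℝ≥0∞} [Fact (1 ≤ p)]
    (v : sobolev D p) : Lp (EuclideanSpace ℝ (Fin N)) p (spaceMeasure D) := v.1.snd

/-- The Bochner space `L²((0,T); H¹(D))`, in which solutions are compared. -/
abbrev SolSpace (D : Set (EuclideanSpace ℝ (Fin N))) (T : ℝ) : Type :=
  Lp (H1 D) 2 (timeMeasure T)

/-- `w ∈ L²((0,T); H¹(D)*)` is the weak time derivative of `u ∈ L²((0,T); H¹(D))`, where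
`L²(D)` is embedded in `H¹(D)*` through the inner product of `L²(D)`. -/
def IsTimeDerivative {D : Set (EuclideanSpace ℝ (Fin N))} {T : ℝ} (u : SolSpace D T)
    (w : Lp (StrongDual ℝ (H1 D)) 2 (timeMeasure T)) : Prop :=
  ∀ η : ℝ → ℝ, ContDiff ℝ ∞ η → HasCompactSupport η → tsupport η ⊆ Ioo 0 T → ∀ φ : H1 D,
    ∫ t in Ioo 0 T, deriv η t * (∫ x in D, sobolevFun (u t) x * sobolevFun φ x)
      = - ∫ t in Ioo 0 T, η t * w t φ

/-- The continuous representative of `u` in `C([0,T]; L²(D))` exists and starts from `u₀`. -/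
def HasInitialValue {D : Set (EuclideanSpace ℝ (Fin N))} {T : ℝ} (u : SolSpace D T)
    (u₀ : Lp ℝ 2 (spaceMeasure D)) : Prop :=
  ∃ U : ℝ → Lp ℝ 2 (spaceMeasure D), ContinuousOn U (Icc 0 T) ∧
    (∀ᵐ t ∂(timeMeasure T), U t = sobolevFun (u t)) ∧ U 0 = u₀

/-- `γ` is the trace map: the continuous linear map `H¹(D) → L²(∂D)` that restricts functions
continuous on the closure of `D` to the boundary. -/
def IsTraceMap (D : Set (EuclideanSpace ℝ (Fin N)))
    (γ : H1 D →L[ℝ] Lp ℝ 2 (surfaceMeasure (frontier D))) : Prop :=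
  ∀ (v : H1 D) (w : EuclideanSpace ℝ (Fin N) → ℝ), ContinuousOn w (closure D) →
    sobolevFun v =ᵐ[spaceMeasure D] w → γ v =ᵐ[surfaceMeasure (frontier D)] w

open Classical in
/-- The trace map of `D`. -/
def trace (D : Set (EuclideanSpace ℝ (Fin N))) :
    H1 D →L[ℝ] Lp ℝ 2 (surfaceMeasure (frontier D)) :=
  if h : ∃ γ, IsTraceMap D γ then h.choose else 0

/-- The nonlinearity `f ∈ W^{1,∞}(ℝ)`, with `f(0) = f(1) = 0` and `f ≥ 0` on `(0,1)`. -/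
structure IsFluxFunction (f : ℝ → ℝ) : Prop where
  bounded : ∃ K : ℝ, ∀ s, |f s| ≤ K
  lipschitz : ∃ L : ℝ≥0, LipschitzWith L f
  zero : f 0 = 0
  one : f 1 = 0
  nonneg : ∀ s, 0 < s → s < 1 → 0 ≤ f s

/-- The inflow nonlinearity `g ∈ W^{1,∞}(ℝ)`, decreasing with `g(0) = 1` and `g(1) = 0`. -/
structure IsInflowFunction (g : ℝ → ℝ) : Prop where
  bounded : ∃ K : ℝ, ∀ s, |g s| ≤ K
  lipschitz : ∃ L : ℝ≥0, LipschitzWith L g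
  antitone : Antitone g
  zero : g 0 = 1
  one : g 1 = 0

end Spaces

/-! ## The first problem: reaction terms -/

section Problem1

variable {N : ℕ}

/-- Data `(α, β, V, u⁰)` of the first problem. -/
@[ext] structure Data1 (D : Set (EuclideanSpace ℝ (Fin N))) (T : ℝ) where
  α : Lp ℝ ∞ ((timeMeasure T).prod (spaceMeasure D))
  β : Lp ℝ ∞ ((timeMeasure T).prod (spaceMeasure D))
  V : Lp (W1inf D) ∞ (timeMeasure T)
  u₀ : Lp ℝ 2 (spaceMeasure D)

namespace Data1

variable {D : Set (EuclideanSpace ℝ (Fin N))} {T : ℝ}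

/-- The metric on the data of the first problem. -/
def distance (ξ η : Data1 D T) : ℝ :=
  ‖ξ.α - η.α‖ + ‖ξ.β - η.β‖ + ‖ξ.V - η.V‖ + ‖ξ.u₀ - η.u₀‖

/-- The distance of the time-dependent data up to time `t`. -/
def distanceUpTo (t : ℝ) (ξ η : Data1 D T) : ℝ≥0∞ :=
  eLpNorm (fun z => ξ.α z - η.α z) ∞ ((timeMeasure t).prod (spaceMeasure D))
    + eLpNorm (fun z => ξ.β z - η.β z) ∞ ((timeMeasure t).prod (spaceMeasure D))
    + eLpNorm (fun s => ξ.V s - η.V s) ∞ (timeMeasure t)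

/-- The space of data as a product of Banach spaces; the product norm induces the same topology as
`distance`. -/
def toProd (ξ : Data1 D T) : Lp ℝ ∞ ((timeMeasure T).prod (spaceMeasure D)) ×
    Lp ℝ ∞ ((timeMeasure T).prod (spaceMeasure D)) × Lp (W1inf D) ∞ (timeMeasure T) ×
    Lp ℝ 2 (spaceMeasure D) :=
  (ξ.α, ξ.β, ξ.V, ξ.u₀)

/-- The Borel σ-algebra. -/
instance : MeasurableSpace (Data1 D T) := (borel _).comap toProd

/-- The σ-algebra of the events observable up to time `t`: it is generated by
`α(s, x)`, `β(s, x)`, `V(s, x)`, `s ≤ t`, `x ∈ D`, that is (these being classes of functions), by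
their integrals over the sets `(0, s) × A`, `s ≤ t`. -/
@[reducible] def filtration (t : ℝ) : MeasurableSpace (Data1 D T) :=
  ⨆ (s : ℝ) (_ : s ≤ t) (A : Set (EuclideanSpace ℝ (Fin N))) (_ : MeasurableSet A),
    MeasurableSpace.comap (fun ξ : Data1 D T =>
        ∫ z in Ioo 0 s ×ˢ A, ξ.α z ∂((timeMeasure T).prod (spaceMeasure D))) (borel ℝ)
    ⊔ MeasurableSpace.comap (fun ξ : Data1 D T =>
        ∫ z in Ioo 0 s ×ˢ A, ξ.β z ∂((timeMeasure T).prod (spaceMeasure D))) (borel ℝ)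
    ⊔ MeasurableSpace.comap (fun ξ : Data1 D T =>
        ∫ τ in Ioo 0 s, ∫ x in A, sobolevFun (ξ.V τ) x ∂(spaceMeasure D) ∂(timeMeasure T))
        (borel ℝ)

/-- The standing assumptions on the data, with a bound `M` on their norms. -/
structure Admissible (M : ℝ) (ξ : Data1 D T) : Prop where
  α_pos : ∃ α₀ > 0, ∀ᵐ z ∂((timeMeasure T).prod (spaceMeasure D)), α₀ ≤ ξ.α z
  β_pos : ∃ β₀ > 0, ∀ᵐ z ∂((timeMeasure T).prod (spaceMeasure D)), β₀ ≤ ξ.β z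
  u₀_mem : ∀ᵐ x ∂(spaceMeasure D), 0 ≤ ξ.u₀ x ∧ ξ.u₀ x ≤ 1
  α_le : ‖ξ.α‖ ≤ M
  β_le : ‖ξ.β‖ ≤ M
  V_le : ‖ξ.V‖ ≤ M

/-- `u` is a weak solution of the first problem (with no-flux boundary condition) for the
data `ξ`. -/
def IsWeakSolution (f : ℝ → ℝ) (ξ : Data1 D T) (u : SolSpace D T) : Prop :=
  ∃ w : Lp (StrongDual ℝ (H1 D)) 2 (timeMeasure T), IsTimeDerivative u w ∧
    HasInitialValue u ξ.u₀ ∧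
    ∀ φ : H1 D, ∀ᵐ t ∂(timeMeasure T),
      w t φ
        - (∫ x in D, inner ℝ (-sobolevGrad (u t) x + f (sobolevFun (u t) x) •
            sobolevGrad (ξ.V t) x) (sobolevGrad φ x))
        + (∫ x in D, ξ.β (t, x) * sobolevFun (u t) x * sobolevFun φ x)
        - (∫ x in D, ξ.α (t, x) * f (sobolevFun (u t) x) * sobolevFun φ x) = 0

open Classical in
/-- The solution operator of the first problem: data are mapped to the weak solution. -/
def solution (f : ℝ → ℝ) (ξ : Data1 D T) : SolSpace D T :=
  if h : ∃ u, IsWeakSolution f ξ u then h.choose else 0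

end Data1

end Problem1

/-! ## The second problem: in- and outflow through the boundary -/

section Problem2

variable {N : ℕ}

/-- Data `(a, b, V, u⁰)` of the second problem. -/
@[ext] structure Data2 (D Γin Γout : Set (EuclideanSpace ℝ (Fin N))) (T : ℝ) where
  a : Lp ℝ ∞ ((timeMeasure T).prod (surfaceMeasure Γin))
  b : Lp ℝ ∞ ((timeMeasure T).prod (surfaceMeasure Γout))
  V : Lp (W1inf D) 2 (timeMeasure T)
  u₀ : Lp ℝ 2 (spaceMeasure D)

namespace Data2

variable {D Γin Γout : Set (EuclideanSpace ℝ (Fin N))} {T : ℝ}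

/-- The metric on the data of the second problem. -/
def distance (ξ η : Data2 D Γin Γout T) : ℝ :=
  ‖ξ.a - η.a‖ + ‖ξ.b - η.b‖ + ‖ξ.V - η.V‖ + ‖ξ.u₀ - η.u₀‖

/-- The distance of the time-dependent data up to time `t`. -/
def distanceUpTo (t : ℝ) (ξ η : Data2 D Γin Γout T) : ℝ≥0∞ :=
  eLpNorm (fun z => ξ.a z - η.a z) ∞ ((timeMeasure t).prod (surfaceMeasure Γin))
    + eLpNorm (fun z => ξ.b z - η.b z) ∞ ((timeMeasure t).prod (surfaceMeasure Γout))
    + eLpNorm (fun s => ξ.V s - η.V s) 2 (timeMeasure t)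

/-- The space of data as a product of Banach spaces; the product norm induces the same topology as
`distance`. -/
def toProd (ξ : Data2 D Γin Γout T) : Lp ℝ ∞ ((timeMeasure T).prod (surfaceMeasure Γin)) ×
    Lp ℝ ∞ ((timeMeasure T).prod (surfaceMeasure Γout)) × Lp (W1inf D) 2 (timeMeasure T) ×
    Lp ℝ 2 (spaceMeasure D) :=
  (ξ.a, ξ.b, ξ.V, ξ.u₀)

/-- The Borel σ-algebra. -/
instance : MeasurableSpace (Data2 D Γin Γout T) := (borel _).comap toProd

/-- The σ-algebra of the events observable up to time `t`: it is generated by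
`a(s, x)`, `b(s, x)`, `V(s, x)`, `s ≤ t`, that is (these being classes of functions), by
their integrals over the sets `(0, s) × A`, `s ≤ t`. -/
@[reducible] def filtration (t : ℝ) : MeasurableSpace (Data2 D Γin Γout T) :=
  ⨆ (s : ℝ) (_ : s ≤ t) (A : Set (EuclideanSpace ℝ (Fin N))) (_ : MeasurableSet A),
    MeasurableSpace.comap (fun ξ : Data2 D Γin Γout T =>
        ∫ z in Ioo 0 s ×ˢ A, ξ.a z ∂((timeMeasure T).prod (surfaceMeasure Γin))) (borel ℝ)
    ⊔ MeasurableSpace.comap (fun ξ : Data2 D Γin Γout T =>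
        ∫ z in Ioo 0 s ×ˢ A, ξ.b z ∂((timeMeasure T).prod (surfaceMeasure Γout))) (borel ℝ)
    ⊔ MeasurableSpace.comap (fun ξ : Data2 D Γin Γout T =>
        ∫ τ in Ioo 0 s, ∫ x in A, sobolevFun (ξ.V τ) x ∂(spaceMeasure D) ∂(timeMeasure T))
        (borel ℝ)

/-- The standing assumptions on the data, with a bound `M` on the norm of the potential, which is
harmonic at almost every time. -/
structure Admissible (M : ℝ) (ξ : Data2 D Γin Γout T) : Prop where
  a_mem : ∃ a₀ > 0, ∀ᵐ z ∂((timeMeasure T).prod (surfaceMeasure Γin)), a₀ ≤ ξ.a z ∧ ξ.a z ≤ 1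
  b_mem : ∃ b₀ > 0, ∀ᵐ z ∂((timeMeasure T).prod (surfaceMeasure Γout)), b₀ ≤ ξ.b z ∧ ξ.b z ≤ 1
  harmonic : ∀ᵐ t ∂(timeMeasure T), ∀ φ, IsTestFunction D φ →
    ∫ x in D, fderiv ℝ φ x (sobolevGrad (ξ.V t) x) = 0
  u₀_mem : ∀ᵐ x ∂(spaceMeasure D), 0 ≤ ξ.u₀ x ∧ ξ.u₀ x ≤ 1
  V_le : ‖ξ.V‖ ≤ M

/-- `u` is a weak solution of the second problem for the data `ξ`. -/
def IsWeakSolution (f g : ℝ → ℝ) (ξ : Data2 D Γin Γout T) (u : SolSpace D T) : Prop :=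
  ∃ w : Lp (StrongDual ℝ (H1 D)) 2 (timeMeasure T), IsTimeDerivative u w ∧
    HasInitialValue u ξ.u₀ ∧
    ∀ φ : H1 D, ∀ᵐ t ∂(timeMeasure T),
      w t φ
        - (∫ x in D, inner ℝ (-sobolevGrad (u t) x + f (sobolevFun (u t) x) •
            sobolevGrad (ξ.V t) x) (sobolevGrad φ x))
        + (∫ x, ξ.b (t, x) * trace D (u t) x * trace D φ x ∂(surfaceMeasure Γout))
      = ∫ x, ξ.a (t, x) * g (trace D (u t) x) * trace D φ x ∂(surfaceMeasure Γin)

open Classical in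
/-- The solution operator of the second problem: data are mapped to the weak solution. -/
def solution (f g : ℝ → ℝ) (ξ : Data2 D Γin Γout T) : SolSpace D T :=
  if h : ∃ u, IsWeakSolution f g ξ u then h.choose else 0

end Data2

end Problem2

end

noncomputable section

/-! ## Absolutely continuous functions -/

/-! Everything rests on one fact: on admissible data the solution map is Lipschitz into
L²((0,T);H¹(D)). Given this with some constant, (i) follows since the exponential factor is at least
one, and (ii) is an argument about couplings.

Lipschitz dependence. Both problems have the form w + A(t,u) = 0, u(0) = u⁰, where V is H¹(D) with
its Hilbert norm, ι : V → L²(D) is the inclusion (injective, dense range), V is identified with its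
dual, and w represents the time derivative. Subtract two solutions for the same coefficients. The
terms with β and b have a good sign because β, b ≥ 0, and so has the inflow term because a ≥ 0 and g
decreases; α f(u) is Lipschitz in L²(D); the flux f(u)∇V is absorbed by half of the V-norm at the
price of a multiple of ‖∇V(t)‖²_∞ ‖ιu‖², whose coefficient is integrable in time. Since f and g are
bounded and Lipschitz on all of ℝ, no maximum principle is needed. The energy identity
`IsTrajectory.norm_sq_eq` and Gronwall (`IsTrajectory.energy_le`) then bound the difference of any
two trajectories by the differences of their initial values and of their residuals w + A(t,u)
(`IsParabolicOperator.dist_le`). If u and u' solve the equation for coefficients d and d', the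
residual of u' in the equation of d is A_d(u') - A_{d'}(u'); it is controlled by the difference of
the coefficients, because f and g are bounded and u' obeys an a priori bound (`reaction_stability`).

Existence has to be proved too, since the solution operator is defined by choosing a weak solution
if there is one. The linear equation u' + u = F is solved by a closed range argument
(`heatOp_surjective`). The operator is then deformed from the identity to A in finitely many small
steps; each is a contraction, because the bound of `IsParabolicOperator.dist_le` is uniform along
the deformation (`surjective_add_of_antilipschitz`, `IsParabolicOperator.exists_solution`).

Conditional expectations. On the bounded set of admissible data, Φ ∘ S is Lipschitz for the product
norm; its McShane extension is continuous on the whole data space, hence Borel. For almost every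
condition the conditional laws charge only admissible data, so the extension may replace Φ ∘ S and
is bounded almost surely. For every coupling π of two such laws, the expectations differ by at most
K ∫ d dπ ≤ K (∫ d² dπ)^(1/2); nested couplings are couplings, so the infimum over them gives the
claim (`condExp_sub_le_nestedDist`). The remaining factors in the statement are at least one. -/

theorem AbsolutelyContinuousOnInterval.of_dist_le {X Y : Type*} [PseudoMetricSpace X]
    [PseudoMetricSpace Y] {g : ℝ → X} {h : ℝ → Y} {a b C : ℝ}
    (hh : AbsolutelyContinuousOnInterval h a b)
    (hg : ∀ s ∈ uIcc a b, ∀ t ∈ uIcc a b, dist (g s) (g t) ≤ C * dist (h s) (h t)) :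
    AbsolutelyContinuousOnInterval g a b := by
  have key : Tendsto (fun E : ℕ × (ℕ → ℝ × ℝ) =>
      C * ∑ i ∈ Finset.range E.1, dist (h (E.2 i).1) (h (E.2 i).2))
      (totalLengthFilter ⊓ 𝓟 (disjWithin a b)) (𝓝 0) := by
    simpa using Filter.Tendsto.const_mul C hh
  refine squeeze_zero' ?_ ?_ key
  · exact Eventually.of_forall fun E => Finset.sum_nonneg fun i _ => dist_nonneg
  · filter_upwards [mem_inf_of_right (mem_principal_self (disjWithin a b))] with E hE
    rw [Finset.mul_sum]
    refine Finset.sum_le_sum fun i hi => ?_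
    have := hE.1 i hi
    exact hg _ this.1 _ this.2

/-! ### Primitives of integrable Hilbert-space valued functions -/

section Primitive

variable {E : Type*} [NormedAddCommGroup E] [InnerProductSpace ℝ E] [CompleteSpace E]

omit [CompleteSpace E] in
theorem primitive_sub {T : ℝ} {y z : ℝ → E} (hz : IntervalIntegrable z volume 0 T)
    (hy : ∀ t ∈ Icc 0 T, y t = y 0 + ∫ s in (0 : ℝ)..t, z s) {s t : ℝ} (hs : s ∈ Icc 0 T)
    (ht : t ∈ Icc 0 T) : y t - y s = ∫ r in s..t, z r := by
  have h0 : (0 : ℝ) ∈ uIcc 0 T := left_mem_uIcc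
  have hs' : s ∈ uIcc 0 T := Icc_subset_uIcc hs
  have ht' : t ∈ uIcc 0 T := Icc_subset_uIcc ht
  rw [hy t ht, hy s hs, ← intervalIntegral.integral_interval_sub_left
    (hz.mono_set (uIcc_subset_uIcc h0 ht')) (hz.mono_set (uIcc_subset_uIcc h0 hs'))]
  abel

omit [CompleteSpace E] in
-- The increments of y are dominated by those of the scalar primitive of ‖z‖, which is absolutely
-- continuous.
theorem primitive_ac {T : ℝ} (hT : 0 ≤ T) {y z : ℝ → E} (hz : IntervalIntegrable z volume 0 T)
    (hy : ∀ t ∈ Icc 0 T, y t = y 0 + ∫ s in (0 : ℝ)..t, z s) :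
    AbsolutelyContinuousOnInterval y 0 T := by
  have hK := hz.norm.absolutelyContinuousOnInterval_intervalIntegral (c := 0) left_mem_uIcc
  refine hK.of_dist_le (C := 1) ?_
  have key : ∀ s ∈ Icc 0 T, ∀ t ∈ Icc 0 T, s ≤ t → dist (y s) (y t) ≤
      1 * dist (∫ r in (0:ℝ)..s, ‖z r‖) (∫ r in (0:ℝ)..t, ‖z r‖) := by
    intro s hs t ht hst
    have h0 : (0 : ℝ) ∈ uIcc 0 T := left_mem_uIcc
    have hs' : s ∈ uIcc 0 T := Icc_subset_uIcc hs
    have ht' : t ∈ uIcc 0 T := Icc_subset_uIcc ht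
    rw [dist_comm, dist_comm (∫ r in (0:ℝ)..s, ‖z r‖), dist_eq_norm, dist_eq_norm,
      primitive_sub hz hy hs ht, intervalIntegral.integral_interval_sub_left
        (hz.norm.mono_set (uIcc_subset_uIcc h0 ht')) (hz.norm.mono_set (uIcc_subset_uIcc h0 hs')),
      one_mul]
    exact (intervalIntegral.norm_integral_le_integral_norm hst).trans (le_abs_self _)
  rw [uIcc_of_le hT]
  intro s hs t ht
  rcases le_total s t with h | h
  · exact key s hs t ht h
  · rw [dist_comm, dist_comm (∫ r in (0:ℝ)..s, ‖z r‖)]; exact key t ht s hs h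

theorem primitive_hasDerivAt {T : ℝ} {y z : ℝ → E}
    (hz : IntervalIntegrable z volume 0 T)
    (hy : ∀ t ∈ Icc 0 T, y t = y 0 + ∫ s in (0 : ℝ)..t, z s) :
    ∀ᵐ t, t ∈ Ioo 0 T → HasDerivAt y (z t) t := by
  filter_upwards [hz.ae_hasDerivAt_integral] with t ht htm
  have h1 := (ht (Icc_subset_uIcc (Ioo_subset_Icc_self htm)) 0 left_mem_uIcc).const_add (y 0)
  refine h1.congr_of_eventuallyEq ?_
  filter_upwards [Icc_mem_nhds htm.1 htm.2] with s hs using hy s hs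

theorem norm_sq_primitive {T : ℝ} (hT : 0 < T) {y z : ℝ → E}
    (hz : IntervalIntegrable z volume 0 T)
    (hy : ∀ t ∈ Icc 0 T, y t = y 0 + ∫ s in (0 : ℝ)..t, z s) :
    ‖y T‖ ^ 2 - ‖y 0‖ ^ 2 = 2 * ∫ s in (0 : ℝ)..T, inner ℝ (z s) (y s) := by
  have hac := primitive_ac hT.le hz hy
  obtain ⟨C, hC⟩ := hac.exists_bound
  have hac2 : AbsolutelyContinuousOnInterval (fun t => ‖y t‖ ^ 2) 0 T := by
    -- C bounds ‖y‖ on the interval, so the square is 2C-Lipschitz on the range of ‖y‖.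
    refine hac.of_dist_le (C := 2 * C) fun s hs t ht => ?_
    rw [Real.dist_eq, show ‖y s‖ ^ 2 - ‖y t‖ ^ 2 = (‖y s‖ + ‖y t‖) * (‖y s‖ - ‖y t‖) by ring,
      abs_mul, dist_eq_norm]
    refine mul_le_mul ?_ (abs_norm_sub_norm_le _ _) (abs_nonneg _) ?_
    · rw [abs_of_nonneg (by positivity)]; linarith [hC s hs, hC t ht]
    · linarith [hC s hs, norm_nonneg (y s)]
  rw [← hac2.integral_deriv_eq_sub, ← intervalIntegral.integral_const_mul]
  refine intervalIntegral.integral_congr_ae ?_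
  have hne : ∀ᵐ t : ℝ, t ≠ T := by
    simp [ae_iff]
  filter_upwards [primitive_hasDerivAt hz hy, hne] with t ht hne htm
  rw [uIoc_of_le hT.le] at htm
  have h := ht ⟨htm.1, lt_of_le_of_ne htm.2 hne⟩
  have := h.norm_sq
  rw [this.deriv, real_inner_comm]

end Primitive

/-- Gronwall with an integrating factor, kept as an identity: the product rule for absolutely
continuous functions. It needs k only integrable, and the exponential of a primitive is absolutely
continuous because exp is Lipschitz on the bounded range of the primitive. -/
theorem exp_weighted_primitive {T : ℝ} (hT : 0 < T) {y q k : ℝ → ℝ}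
    (hq : IntervalIntegrable q volume 0 T) (hk : IntervalIntegrable k volume 0 T)
    (hy : ∀ t ∈ Icc 0 T, y t = y 0 + ∫ s in (0 : ℝ)..t, q s) :
    Real.exp (-∫ s in (0:ℝ)..T, k s) * y T = y 0 +
      ∫ s in (0 : ℝ)..T, Real.exp (-∫ r in (0:ℝ)..s, k r) * (q s - k s * y s) := by
  have hyac := primitive_ac hT.le hq hy
  have hKac := hk.neg.absolutelyContinuousOnInterval_intervalIntegral (c := 0) left_mem_uIcc
  simp only [Pi.neg_apply, intervalIntegral.integral_neg] at hKac
  have heac : AbsolutelyContinuousOnInterval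
      (fun t => Real.exp (-∫ r in (0:ℝ)..t, k r)) 0 T := by
    obtain ⟨C, hC⟩ := hKac.exists_bound
    obtain ⟨L, hL⟩ := (Real.contDiff_exp (n := 1)).contDiffOn.exists_lipschitzOnWith (by decide)
      (convex_Icc (-C) C) isCompact_Icc
    refine hKac.of_dist_le (C := L) fun s hs t ht => hL.dist_le_mul _ ?_ _ ?_
    · exact abs_le.1 (hC s hs)
    · exact abs_le.1 (hC t ht)
  have h := heac.integral_deriv_mul_eq_sub hyac
  simp only [intervalIntegral.integral_same, neg_zero, Real.exp_zero, one_mul] at h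
  rw [← sub_eq_iff_eq_add', ← h]
  refine intervalIntegral.integral_congr_ae ?_
  have hne : ∀ᵐ t : ℝ, t ≠ T := by
    simp [ae_iff]
  filter_upwards [primitive_hasDerivAt hq hy, hk.ae_hasDerivAt_integral, hne]
    with t ht ht2 hne htm
  rw [uIoc_of_le hT.le] at htm
  have h1 := ht ⟨htm.1, lt_of_le_of_ne htm.2 hne⟩
  have h2 := (ht2 (Icc_subset_uIcc (Ioc_subset_Icc_self htm)) 0 left_mem_uIcc).neg.exp
  rw [h1.deriv]
  have h3 : deriv (fun t => Real.exp (-∫ r in (0:ℝ)..t, k r)) t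
    = Real.exp (-∫ r in (0:ℝ)..t, k r) * (-k t) := h2.deriv
  rw [h3]; ring

/-- A smooth function with integral zero and compact support in `(0, T)` is the derivative of such a
function. -/
theorem exists_test_primitive {T : ℝ} {g : ℝ → ℝ} (hg : ContDiff ℝ ∞ g)
    (hgc : HasCompactSupport g) (hgs : tsupport g ⊆ Ioo 0 T) (h0 : ∫ t, g t = 0) :
    ∃ η : ℝ → ℝ, ContDiff ℝ ∞ η ∧ HasCompactSupport η ∧ tsupport η ⊆ Ioo 0 T ∧ deriv η = g := by
  rcases eq_empty_or_nonempty (tsupport g) with he | hne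
  · have hg0 : g = 0 := by
      have := subset_tsupport g
      rw [he, subset_empty_iff, Function.support_eq_empty_iff] at this
      exact this
    refine ⟨0, contDiff_const, HasCompactSupport.zero, by simp [tsupport], ?_⟩
    rw [hg0]; ext; simp
  have hK : IsCompact (tsupport g) := hgc
  set a := sInf (tsupport g)
  set b := sSup (tsupport g)
  have ha : a ∈ tsupport g := hK.sInf_mem hne
  have hb : b ∈ tsupport g := hK.sSup_mem hne
  have hab : tsupport g ⊆ Icc a b := fun t ht =>
    ⟨csInf_le hK.bddBelow ht, le_csSup hK.bddAbove ht⟩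
  set η : ℝ → ℝ := fun t => ∫ s in (0:ℝ)..t, g s
  have hd : ∀ t, HasDerivAt η (g t) t := fun t =>
    intervalIntegral.integral_hasDerivAt_right (hg.continuous.intervalIntegrable _ _)
      (hg.continuous.stronglyMeasurableAtFilter _ _) hg.continuous.continuousAt
  have hde : deriv η = g := funext fun t => (hd t).deriv
  have hη : ∀ t, t ∉ Icc a b → η t = 0 := by
    intro t ht
    rw [mem_Icc, not_and_or, not_le, not_le] at ht
    rcases ht with ht | ht
    · have : ∫ s in (0:ℝ)..t, g s = ∫ s in (0:ℝ)..t, (0:ℝ) := by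
        refine intervalIntegral.integral_congr fun s hs => ?_
        refine image_eq_zero_of_notMem_tsupport fun hs' => ?_
        have h1 := hab hs'
        have h2 := hs.2
        have : max 0 t < a := max_lt (hgs ha).1 ht
        linarith [h1.1]
      simp only [η, this, intervalIntegral.integral_zero]
    · have : ∫ s in (0:ℝ)..t, g s = ∫ s, g s := by
        refine intervalIntegral.integral_eq_integral_of_support_subset fun s hs => ?_
        have hs' := subset_tsupport g hs
        exact ⟨(hgs hs').1, ((hab hs').2.trans ht.le)⟩
      simp only [η, this, h0]
  have hts : tsupport η ⊆ Icc a b :=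
    closure_minimal (fun t ht => by_contra fun h => ht (hη t h)) isClosed_Icc
  refine ⟨η, ?_, HasCompactSupport.of_support_subset_isCompact isCompact_Icc
    ((subset_tsupport η).trans hts), hts.trans (Icc_subset_Ioo (hgs ha).1 (hgs hb).2), hde⟩
  exact contDiff_infty_iff_deriv.2 ⟨fun t => (hd t).differentiableAt, hde ▸ hg⟩

/-- Du Bois-Reymond: a continuous function with vanishing weak derivative is constant. -/
theorem eq_of_forall_integral_deriv_mul_eq_zero {T : ℝ} (hT : 0 < T) {q : ℝ → ℝ}
    (hq : ContinuousOn q (Icc 0 T))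
    (h : ∀ η : ℝ → ℝ, ContDiff ℝ ∞ η → HasCompactSupport η → tsupport η ⊆ Ioo 0 T →
      ∫ t in Ioo 0 T, deriv η t * q t = 0) : ∀ t ∈ Icc 0 T, q t = q 0 := by
  -- The normalised bump χ is supported in [T/4, 3T/4] and has unit mass.
  let bump : ContDiffBump (T / 2) := ⟨T / 8, T / 4, by linarith, by linarith⟩
  set χ : ℝ → ℝ := bump.normed volume
  have hχ : ContDiff ℝ ∞ χ := bump.contDiff_normed
  have hχ1 : ∫ t, χ t = 1 := bump.integral_normed
  have hχc : HasCompactSupport χ := bump.hasCompactSupport_normed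
  have hχs : tsupport χ ⊆ Ioo 0 T := by
    rw [bump.tsupport_normed_eq, Real.closedBall_eq_Icc]
    exact Icc_subset_Ioo (by simp only [bump]; linarith) (by simp only [bump]; linarith)
  have hqi : IntegrableOn q (Ioo 0 T) :=
    (hq.integrableOn_compact isCompact_Icc).mono_set Ioo_subset_Icc_self
  have hmul : ∀ ψ : ℝ → ℝ, Continuous ψ → HasCompactSupport ψ →
      IntegrableOn (fun t => ψ t * q t) (Ioo 0 T) := by
    intro ψ hψ hψc
    obtain ⟨C, hC⟩ := hψ.bounded_above_of_compact_support hψc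
    exact hqi.bdd_mul hψ.aestronglyMeasurable (Eventually.of_forall hC)
  set m := ∫ t in Ioo 0 T, χ t * q t
  -- ψ - (∫ψ)χ has mean zero, hence is the derivative of a test function, and the hypothesis applies
  -- to it. So q - m is orthogonal to every ψ, where m is the χ-average of q.
  have key : ∀ ψ : ℝ → ℝ, ContDiff ℝ ∞ ψ → HasCompactSupport ψ → tsupport ψ ⊆ Ioo 0 T →
      ∫ t in Ioo 0 T, ψ t • (q t - m) = 0 := by
    intro ψ hψ hψc hψs
    have hψi := hψ.continuous.integrable_of_hasCompactSupport (μ := volume) hψc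
    have hχi := hχ.continuous.integrable_of_hasCompactSupport (μ := volume) hχc
    set c := ∫ t, ψ t
    have hψo : ∫ t in Ioo 0 T, ψ t = c :=
      setIntegral_eq_integral_of_forall_compl_eq_zero fun t ht =>
        image_eq_zero_of_notMem_tsupport fun h' => ht (hψs h')
    have hts : tsupport (fun t => ψ t - c * χ t) ⊆ tsupport ψ ∪ tsupport χ := by
      refine closure_minimal (fun t ht => ?_) ((isClosed_tsupport _).union (isClosed_tsupport _))
      by_contra hn
      rw [mem_union, not_or] at hn
      apply ht
      simp [image_eq_zero_of_notMem_tsupport hn.1, image_eq_zero_of_notMem_tsupport hn.2]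
    obtain ⟨η, h1, h2, h3, h4⟩ := exists_test_primitive (T := T)
      (g := fun t => ψ t - c * χ t) (hψ.sub (contDiff_const.mul hχ))
      (HasCompactSupport.of_support_subset_isCompact (hψc.union hχc)
        ((subset_tsupport _).trans hts)) (hts.trans (union_subset hψs hχs))
      (by rw [integral_sub hψi (hχi.const_mul c), integral_const_mul, hχ1]; simp [c])
    have h5 := h η h1 h2 h3
    rw [h4] at h5
    have h6 : ∫ t in Ioo 0 T, (ψ t - c * χ t) * q t
        = ∫ t in Ioo 0 T, (ψ t * q t - c * (χ t * q t)) := by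
      congr 1; ext t; ring
    rw [h6, integral_sub (hmul ψ hψ.continuous hψc) ((hmul χ hχ.continuous hχc).const_mul c),
      integral_const_mul] at h5
    simp only [smul_eq_mul, mul_sub]
    rw [integral_sub (hmul ψ hψ.continuous hψc) (hψi.integrableOn.mul_const m),
      integral_mul_const, hψo]
    exact h5
  have hloc : LocallyIntegrableOn (fun t => q t - m) (Ioo 0 T) :=
    (hqi.sub (integrableOn_const (by simp))).locallyIntegrableOn
  have hae := isOpen_Ioo.ae_eq_zero_of_integral_contDiff_smul_eq_zero hloc (by
    intro ψ hψ hψc hψs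
    rw [← key ψ hψ hψc hψs]
    refine (setIntegral_eq_integral_of_forall_compl_eq_zero fun t ht => ?_).symm
    rw [image_eq_zero_of_notMem_tsupport fun h' => ht (hψs h'), zero_smul])
  have hIoo : EqOn q (fun _ => m) (Ioo 0 T) := by
    refine Measure.eqOn_open_of_ae_eq (μ := volume) ?_ isOpen_Ioo
      (hq.mono Ioo_subset_Icc_self) continuousOn_const
    rw [EventuallyEq, ae_restrict_iff' measurableSet_Ioo]
    filter_upwards [hae] with t ht htm using sub_eq_zero.1 (ht htm)
  have hIcc : EqOn q (fun _ => m) (Icc 0 T) :=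
    hIoo.of_subset_closure hq continuousOn_const Ioo_subset_Icc_self
      (by rw [closure_Ioo hT.ne])
  intro t ht
  rw [hIcc ht, hIcc (left_mem_Icc.2 hT.le)]

/-! ## Resolvents of `ι† ι` -/

section Resolvent

variable {V H : Type*} [NormedAddCommGroup V] [InnerProductSpace ℝ V] [CompleteSpace V]
  [NormedAddCommGroup H] [InnerProductSpace ℝ H] [CompleteSpace H]

open ContinuousLinearMap (adjoint)

/-- Lax-Milgram for the form ε⟨v,w⟩ + ⟨ιv,ιw⟩, which is coercive with constant ε. These resolvents
regularise trajectories in the proof of the energy identity. -/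
theorem exists_resolvent (ι : V →L[ℝ] H) {ε : ℝ} (hε : 0 < ε) :
    ∃ R : V →L[ℝ] V, ∀ x, ε • R x + adjoint ι (ι (R x)) = x := by
  let B : V →L[ℝ] V →L[ℝ] ℝ := (innerSL ℝ).comp
    (ε • ContinuousLinearMap.id ℝ V + (adjoint ι).comp ι)
  have hB : ∀ v w, B v w = inner ℝ (ε • v + adjoint ι (ι v)) w := fun v w => rfl
  have hc : IsCoercive B := by
    refine ⟨ε, hε, fun v => ?_⟩
    rw [hB, inner_add_left, real_inner_smul_left, ContinuousLinearMap.adjoint_inner_left,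
      real_inner_self_eq_norm_mul_norm, real_inner_self_eq_norm_mul_norm]
    nlinarith [mul_self_nonneg ‖ι v‖]
  let e := hc.continuousLinearEquivOfBilin
  have he : ∀ v, e v = ε • v + adjoint ι (ι v) := fun v => by
    refine ext_inner_right ℝ fun w => ?_
    rw [hc.continuousLinearEquivOfBilin_apply, hB]
  refine ⟨e.symm, fun x => ?_⟩
  rw [← he]; simp

/-- The resolvent `(ε + ι† ι)⁻¹`. -/
def resolventOp (ι : V →L[ℝ] H) (n : ℕ) : V →L[ℝ] V :=
  (exists_resolvent ι (ε := 1 / ((n : ℝ) + 1)) (by positivity)).choose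

variable (ι : V →L[ℝ] H) (n : ℕ)

theorem resolventOp_eq (x : V) :
    (1 / ((n : ℝ) + 1)) • resolventOp ι n x + adjoint ι (ι (resolventOp ι n x)) = x :=
  (exists_resolvent ι (ε := 1 / ((n : ℝ) + 1)) (by positivity)).choose_spec x

theorem resolventOp_unique {x y : V} (h : (1 / ((n : ℝ) + 1)) • y + adjoint ι (ι y) = x) :
    resolventOp ι n x = y := by
  have hε : (0:ℝ) < 1 / ((n : ℝ) + 1) := by positivity
  set ε := 1 / ((n : ℝ) + 1)
  have h1 := resolventOp_eq ι n x
  set z := resolventOp ι n x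
  have h2 : ε • (z - y) + adjoint ι (ι (z - y)) = 0 := by
    rw [smul_sub, map_sub, map_sub, sub_add_sub_comm, h1, h, sub_self]
  have h3 : inner ℝ (ε • (z - y) + adjoint ι (ι (z - y))) (z - y) = (0 : ℝ) := by
    rw [h2, inner_zero_left]
  rw [inner_add_left, real_inner_smul_left, ContinuousLinearMap.adjoint_inner_left,
    real_inner_self_eq_norm_sq, real_inner_self_eq_norm_sq] at h3
  have h4 : ‖z - y‖ ^ 2 = 0 := by nlinarith [sq_nonneg ‖z - y‖, sq_nonneg ‖ι (z - y)‖]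
  exact sub_eq_zero.1 (norm_eq_zero.1 (pow_eq_zero_iff two_ne_zero |>.1 h4))

/-- Both sides solve the same resolvent equation. -/
theorem resolventOp_comm (x : V) :
    resolventOp ι n (adjoint ι (ι x)) = adjoint ι (ι (resolventOp ι n x)) := by
  refine resolventOp_unique ι n ?_
  have h := congrArg (fun y => adjoint ι (ι y)) (resolventOp_eq ι n x)
  simpa using h

/-- With z the resolvent of x, expand ‖x‖² = ‖εz + ι†ιz‖²: the cross term is 2ε‖ιz‖² ≥ 0. -/
theorem norm_adjoint_comp_resolventOp_le (x : V) :
    ‖adjoint ι (ι (resolventOp ι n x))‖ ≤ ‖x‖ := by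
  have hε : (0:ℝ) < 1 / ((n : ℝ) + 1) := by positivity
  have h1 := resolventOp_eq ι n x
  set ε := 1 / ((n : ℝ) + 1)
  set z := resolventOp ι n x
  have h2 : ‖x‖ ^ 2 = ‖ε • z‖ ^ 2 + 2 * inner ℝ (ε • z) (adjoint ι (ι z))
      + ‖adjoint ι (ι z)‖ ^ 2 := by rw [← norm_add_sq_real, h1]
  rw [real_inner_smul_left, ContinuousLinearMap.adjoint_inner_right,
    real_inner_self_eq_norm_sq] at h2
  refine le_of_sq_le_sq ?_ (norm_nonneg _)
  nlinarith [sq_nonneg ‖ε • z‖, mul_nonneg hε.le (sq_nonneg ‖ι z‖)]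

/-- Test the resolvent equation with z itself: ε‖z‖² + ‖ιz‖² = ⟨h,ιz⟩. -/
theorem norm_comp_resolventOp_adjoint_le (h : H) :
    ‖ι (resolventOp ι n (adjoint ι h))‖ ≤ ‖h‖ := by
  have hε : (0:ℝ) < 1 / ((n : ℝ) + 1) := by positivity
  have h1 := congrArg (fun v => inner ℝ v (resolventOp ι n (adjoint ι h)))
    (resolventOp_eq ι n (adjoint ι h))
  set ε := 1 / ((n : ℝ) + 1)
  set z := resolventOp ι n (adjoint ι h)
  simp only [inner_add_left, real_inner_smul_left, ContinuousLinearMap.adjoint_inner_left,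
    real_inner_self_eq_norm_sq] at h1
  have h3 := real_inner_le_norm h (ι z)
  by_contra hlt
  push Not at hlt
  nlinarith [sq_nonneg ‖z‖, mul_nonneg hε.le (sq_nonneg ‖z‖), norm_nonneg h]

theorem tendsto_of_dense_of_bound {E : Type*} [NormedAddCommGroup E] [NormedSpace ℝ E]
    {S : ℕ → E →L[ℝ] E} (hS : ∀ n x, ‖S n x‖ ≤ ‖x‖) {D : Set E} (hD : Dense D)
    (h : ∀ x ∈ D, Tendsto (fun n => S n x) atTop (𝓝 x)) (x : E) :
    Tendsto (fun n => S n x) atTop (𝓝 x) := by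
  rw [Metric.tendsto_atTop]
  intro ε hε
  obtain ⟨y, hy, hxy⟩ := Metric.dense_iff.1 hD x (ε / 3) (by positivity)
  rw [Metric.mem_ball, dist_comm, dist_eq_norm] at hy
  obtain ⟨N, hN⟩ := Metric.tendsto_atTop.1 (h y hxy) (ε / 3) (by positivity)
  refine ⟨N, fun n hn => ?_⟩
  have h1 := hN n hn
  rw [dist_eq_norm] at h1 ⊢
  have h2 : S n x - x = S n (x - y) + (S n y - y) - (x - y) := by rw [map_sub]; abel
  rw [h2]
  have := norm_sub_le (S n (x - y) + (S n y - y)) (x - y)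
  have h3 := norm_add_le (S n (x - y)) (S n y - y)
  have h4 := hS n (x - y)
  linarith

variable {ι}

/-- A vector x orthogonal to the range satisfies ‖ιx‖² = ⟨ι†ιx,x⟩ = 0, so x = 0 by injectivity. -/
theorem denseRange_adjoint_comp (hι : Function.Injective ι) :
    DenseRange fun v => adjoint ι (ι v) := by
  have h : ((adjoint ι).comp ι : V →L[ℝ] V).range.topologicalClosure = ⊤ := by
    rw [Submodule.topologicalClosure_eq_top_iff, Submodule.eq_bot_iff]
    intro x hx
    rw [Submodule.mem_orthogonal] at hx
    have h1 := hx _ ⟨x, rfl⟩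
    rw [ContinuousLinearMap.coe_coe, ContinuousLinearMap.comp_apply,
      ContinuousLinearMap.adjoint_inner_left, inner_self_eq_zero] at h1
    exact hι (by rw [h1, map_zero])
  have := Submodule.dense_iff_topologicalClosure_eq_top.2 h
  simpa [DenseRange, LinearMap.coe_range, Function.comp_def] using this

/-- On the dense range of ι†ι the error at ι†ιv is -(n+1)⁻¹ ι†ιRₙv, of norm at most ‖v‖/(n+1); the
uniform bound extends the convergence to all x. -/
theorem tendsto_adjoint_comp_resolventOp (hι : Function.Injective ι) (x : V) :
    Tendsto (fun n => adjoint ι (ι (resolventOp ι n x))) atTop (𝓝 x) := by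
  refine tendsto_of_dense_of_bound
    (S := fun n => (adjoint ι).comp (ι.comp (resolventOp ι n)))
    (fun n x => norm_adjoint_comp_resolventOp_le ι n x)
    (denseRange_adjoint_comp hι) ?_ x
  rintro _ ⟨v, rfl⟩
  have h0 : Tendsto (fun n : ℕ => 1 / ((n : ℝ) + 1) * ‖v‖) atTop (𝓝 0) := by
    simpa using tendsto_one_div_add_atTop_nhds_zero_nat.mul_const ‖v‖
  rw [tendsto_iff_norm_sub_tendsto_zero]
  refine squeeze_zero (fun n => norm_nonneg _) (fun n => ?_) h0
  simp only [ContinuousLinearMap.comp_apply]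
  rw [resolventOp_comm]
  have h1 := resolventOp_eq ι n v
  have h2 : adjoint ι (ι (adjoint ι (ι (resolventOp ι n v)))) - adjoint ι (ι v)
      = - ((1 / ((n : ℝ) + 1)) • adjoint ι (ι (resolventOp ι n v))) := by
    conv_lhs => rw [← map_sub, ← map_sub, ← sub_eq_of_eq_add' h1.symm]
    simp
  rw [h2, norm_neg, norm_smul, Real.norm_of_nonneg (by positivity)]
  gcongr
  exact norm_adjoint_comp_resolventOp_le ι n v

theorem tendsto_comp_resolventOp_adjoint (hι : Function.Injective ι) (hd : DenseRange ι) (h : H) :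
    Tendsto (fun n => ι (resolventOp ι n (adjoint ι h))) atTop (𝓝 h) := by
  refine tendsto_of_dense_of_bound
    (S := fun n => ι.comp ((resolventOp ι n).comp (adjoint ι)))
    (fun n x => norm_comp_resolventOp_adjoint_le ι n x) hd ?_ h
  rintro _ ⟨v, rfl⟩
  simp only [ContinuousLinearMap.comp_apply, resolventOp_comm]
  exact (ι.continuous.tendsto v).comp (tendsto_adjoint_comp_resolventOp hι v)

end Resolvent

/-! ## Square integrable functions of time -/

section TimeLp

variable {E : Type*} [NormedAddCommGroup E] [InnerProductSpace ℝ E] {T : ℝ}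

theorem ae_interval_of_ae {p : ℝ → Prop} (h : ∀ᵐ t ∂(timeMeasure T), p t) {s t : ℝ}
    (hs : s ∈ Icc 0 T) (ht : t ∈ Icc 0 T) : ∀ᵐ r, r ∈ uIoc s t → p r := by
  have hne : ∀ᵐ r : ℝ, r ≠ T := by simp [ae_iff]
  filter_upwards [(ae_restrict_iff' measurableSet_Ioo).1 h, hne] with r hr hne hrm
  have h1 := hrm.1
  have h2 := hrm.2
  exact hr ⟨lt_of_le_of_lt (le_min hs.1 ht.1) h1, lt_of_le_of_ne (h2.trans (max_le hs.2 ht.2)) hne⟩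

theorem integral_timeMeasure (hT : 0 ≤ T) (f : ℝ → E) :
    ∫ t, f t ∂(timeMeasure T) = ∫ t in (0:ℝ)..T, f t := by
  rw [intervalIntegral.integral_of_le hT, integral_Ioc_eq_integral_Ioo]

omit [InnerProductSpace ℝ E] in
theorem intervalIntegrable_of_timeMeasure {f : ℝ → E} (hf : Integrable f (timeMeasure T))
    {s t : ℝ} (hs : s ∈ Icc 0 T) (ht : t ∈ Icc 0 T) : IntervalIntegrable f volume s t := by
  have hT : (0 : ℝ) ≤ T := hs.1.trans hs.2
  have h : IntervalIntegrable f volume 0 T :=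
    (intervalIntegrable_iff_integrableOn_Ioo_of_le hT).2 hf
  exact h.mono_set (uIcc_subset_uIcc (Icc_subset_uIcc hs) (Icc_subset_uIcc ht))

omit [InnerProductSpace ℝ E] in
theorem Lp_integrable_time (f : Lp E 2 (timeMeasure T)) : Integrable f (timeMeasure T) :=
  (Lp.memLp f).integrable (by norm_num)

omit [InnerProductSpace ℝ E] in
theorem Lp_intervalIntegrable_time (f : Lp E 2 (timeMeasure T)) {s t : ℝ}
    (hs : s ∈ Icc 0 T) (ht : t ∈ Icc 0 T) : IntervalIntegrable f volume s t :=
  intervalIntegrable_of_timeMeasure (Lp_integrable_time f) hs ht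

theorem norm_sq_eq_integral {X : Type*} [MeasurableSpace X] {μ : Measure X} (f : Lp E 2 μ) :
    ‖f‖ ^ 2 = ∫ x, ‖f x‖ ^ 2 ∂μ := by
  rw [← real_inner_self_eq_norm_sq, L2.inner_def]
  simp

theorem integrable_norm_sq {X : Type*} [MeasurableSpace X] {μ : Measure X} (f : Lp E 2 μ) :
    Integrable (fun x => ‖f x‖ ^ 2) μ := by
  simpa using L2.integrable_inner (𝕜 := ℝ) f f

omit [InnerProductSpace ℝ E] in
theorem integral_norm_le_sqrt (hT : 0 ≤ T) (f : Lp E 2 (timeMeasure T)) :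
    ∫ t, ‖f t‖ ∂(timeMeasure T) ≤ √T * ‖f‖ := by
  have hn : MemLp (fun t => ‖f t‖) 2 (timeMeasure T) := (Lp.memLp f).norm
  have h1 : MemLp (fun _ : ℝ => (1:ℝ)) 2 (timeMeasure T) := memLp_const 1
  have h2 := real_inner_le_norm (h1.toLp _) (hn.toLp _)
  rw [L2.inner_def] at h2
  have h3 : ∫ t, inner ℝ (h1.toLp _ t) (hn.toLp _ t) ∂(timeMeasure T)
      = ∫ t, ‖f t‖ ∂(timeMeasure T) := by
    refine integral_congr_ae ?_
    filter_upwards [h1.coeFn_toLp, hn.coeFn_toLp] with t h1 h2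
    rw [h1, h2]; simp
  rw [h3] at h2
  refine h2.trans (le_of_eq ?_)
  congr 1
  · rw [← Real.sqrt_sq (norm_nonneg (h1.toLp _)), norm_sq_eq_integral]
    congr 1
    have : ∫ t, ‖h1.toLp _ t‖ ^ 2 ∂(timeMeasure T) = ∫ t, (1:ℝ) ∂(timeMeasure T) := by
      refine integral_congr_ae ?_
      filter_upwards [h1.coeFn_toLp] with t h1
      rw [h1]; simp
    rw [this]; simp [measureReal_def, hT]
  · rw [Lp.norm_toLp, Lp.norm_def, eLpNorm_norm]

theorem norm_intervalIntegral_le_sqrt (f : Lp E 2 (timeMeasure T)) {t s : ℝ}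
    (hs : s ∈ Icc 0 T) (ht : t ∈ Icc 0 T) :
    ‖∫ r in s..t, f r‖ ≤ √T * ‖f‖ := by
  have hT : (0 : ℝ) ≤ T := ht.1.trans ht.2
  refine le_trans ?_ (integral_norm_le_sqrt hT f)
  rw [integral_timeMeasure hT, intervalIntegral.integral_of_le hT]
  refine intervalIntegral.norm_integral_le_integral_norm_uIoc.trans ?_
  refine setIntegral_mono_set ?_ (Eventually.of_forall fun _ => norm_nonneg _) ?_
  · exact (intervalIntegrable_iff_integrableOn_Ioc_of_le hT).1
      (Lp_intervalIntegrable_time f (left_mem_Icc.2 hT) (right_mem_Icc.2 hT)).norm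
  · exact (Ioc_subset_Ioc (le_min hs.1 ht.1) (max_le hs.2 ht.2)).eventuallyLE

end TimeLp

/-! ## Trajectories -/

section Trajectories

variable {V H : Type*} [NormedAddCommGroup V] [InnerProductSpace ℝ V] [CompleteSpace V]
  [NormedAddCommGroup H] [InnerProductSpace ℝ H] [CompleteSpace H]

open ContinuousLinearMap (adjoint)

/-- `U ∈ C([0,T]; H)` is the continuous representative of `u ∈ L²((0,T); V)`, with weak time
derivative `w`, where `V` is identified with its dual. -/
structure IsTrajectory (ι : V →L[ℝ] H) (T : ℝ) (u w : Lp V 2 (timeMeasure T)) (U : ℝ → H) :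
    Prop where
  cont : ContinuousOn U (Icc 0 T)
  ae_eq : ∀ᵐ t ∂(timeMeasure T), U t = ι (u t)
  -- With V identified with its dual, ι† is the embedding of H into the dual of V; the evolution
  -- equation makes sense only after applying it, since w is in general not in H.
  primitive : ∀ t ∈ Icc 0 T, adjoint ι (U t) = adjoint ι (U 0) + ∫ s in (0:ℝ)..t, w s

variable {ι : V →L[ℝ] H} {T : ℝ}

namespace IsTrajectory

theorem add {u w u' w' : Lp V 2 (timeMeasure T)} {U U' : ℝ → H}
    (h : IsTrajectory ι T u w U) (h' : IsTrajectory ι T u' w' U') :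
    IsTrajectory ι T (u + u') (w + w') (fun t => U t + U' t) := by
  refine ⟨h.cont.add h'.cont, ?_, fun t ht => ?_⟩
  · filter_upwards [h.ae_eq, h'.ae_eq, Lp.coeFn_add u u'] with t h1 h2 h3
    rw [h1, h2, h3, Pi.add_apply, map_add]
  · have h0 : (0:ℝ) ∈ Icc 0 T := ⟨le_rfl, ht.1.trans ht.2⟩
    rw [intervalIntegral.integral_congr_ae (ae_interval_of_ae (Lp.coeFn_add w w') h0 ht)]
    simp only [Pi.add_apply, map_add]
    rw [intervalIntegral.integral_add (Lp_intervalIntegrable_time w h0 ht)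
      (Lp_intervalIntegrable_time w' h0 ht), h.primitive t ht, h'.primitive t ht]
    abel

theorem smul (c : ℝ) {u w : Lp V 2 (timeMeasure T)} {U : ℝ → H}
    (h : IsTrajectory ι T u w U) :
    IsTrajectory ι T (c • u) (c • w) (fun t => c • U t) := by
  refine ⟨h.cont.const_smul c, ?_, fun t ht => ?_⟩
  · filter_upwards [h.ae_eq, Lp.coeFn_smul c u] with t h1 h3
    rw [h1, h3, Pi.smul_apply, map_smul]
  · have h0 : (0:ℝ) ∈ Icc 0 T := ⟨le_rfl, ht.1.trans ht.2⟩
    rw [intervalIntegral.integral_congr_ae (ae_interval_of_ae (Lp.coeFn_smul c w) h0 ht)]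
    simp only [Pi.smul_apply, map_smul]
    rw [intervalIntegral.integral_smul, h.primitive t ht, smul_add]

theorem zero : IsTrajectory ι T 0 0 (fun _ => 0) := by
  refine ⟨continuousOn_const, ?_, fun t ht => ?_⟩
  · filter_upwards [Lp.coeFn_zero V 2 (timeMeasure T)] with t h
    rw [h]; simp
  · have h0 : (0:ℝ) ∈ Icc 0 T := ⟨le_rfl, ht.1.trans ht.2⟩
    rw [intervalIntegral.integral_congr_ae
      (ae_interval_of_ae (Lp.coeFn_zero V 2 (timeMeasure T)) h0 ht)]
    simp

theorem congr {u w : Lp V 2 (timeMeasure T)} {U U' : ℝ → H}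
    (h : IsTrajectory ι T u w U) (hU : ∀ t ∈ Icc 0 T, U' t = U t) :
    IsTrajectory ι T u w U' := by
  refine ⟨h.cont.congr hU, ?_, fun t ht => ?_⟩
  · filter_upwards [h.ae_eq, ae_restrict_mem measurableSet_Ioo] with t h1 h2
    rw [hU t (Ioo_subset_Icc_self h2), h1]
  · rw [hU t ht, hU 0 ⟨le_rfl, ht.1.trans ht.2⟩, h.primitive t ht]

/-- The energy identity d/dt ‖U‖² = 2⟨w,u⟩ in a Gelfand triple. U need not be differentiable in H,
but yₙ = ιRₙι†U is absolutely continuous in H with derivative zₙ = ιRₙw. The chain rule holds for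
yₙ, and n → ∞ is justified by yₙ → U pointwise and dominated convergence of ⟨zₙ,yₙ⟩. -/
theorem norm_sq_eq (hι : Function.Injective ι) (hd : DenseRange ι)
    {u w : Lp V 2 (timeMeasure T)} {U : ℝ → H} (h : IsTrajectory ι T u w U) :
    ∀ t ∈ Icc 0 T, ‖U t‖ ^ 2 = ‖U 0‖ ^ 2 + ∫ s in (0:ℝ)..t, 2 * inner ℝ (w s) (u s) := by
  intro t ht
  rcases ht.1.eq_or_lt with rfl | ht0
  · simp
  have h0 : (0:ℝ) ∈ Icc 0 T := ⟨le_rfl, ht.1.trans ht.2⟩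
  set y : ℕ → ℝ → H := fun n s => ι (resolventOp ι n (adjoint ι (U s)))
  set z : ℕ → ℝ → H := fun n s => ι (resolventOp ι n (w s))
  have hw := Lp_intervalIntegrable_time w h0 ht
  have hwi : ∀ s ∈ Icc 0 t, IntervalIntegrable w volume 0 s := fun s hs =>
    Lp_intervalIntegrable_time w h0 ⟨hs.1, hs.2.trans ht.2⟩
  have hy : ∀ n, ∀ s ∈ Icc 0 t, y n s = y n 0 + ∫ r in (0:ℝ)..s, z n r := by
    intro n s hs
    have h2 := (ι.comp (resolventOp ι n)).intervalIntegral_comp_comm (hwi s hs)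
    simp only [ContinuousLinearMap.comp_apply] at h2
    simp only [y, z]
    rw [h2, h.primitive s ⟨hs.1, hs.2.trans ht.2⟩, map_add, map_add]
  have hz : ∀ n, IntervalIntegrable (z n) volume 0 t := fun n =>
    ⟨(ι.comp (resolventOp ι n)).integrable_comp hw.1,
      (ι.comp (resolventOp ι n)).integrable_comp hw.2⟩
  have hid := fun n => norm_sq_primitive ht0 (hz n) (hy n)
  have hl : ∀ s, Tendsto (fun n => ‖y n s‖ ^ 2) atTop (𝓝 (‖U s‖ ^ 2)) := fun s =>
    ((tendsto_comp_resolventOp_adjoint hι hd (U s)).norm.pow 2)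
  -- Commuting Rₙ with ι†ι rewrites the pairing in H as a pairing in V of ι†ιRₙw with ι†ιRₙu. These
  -- converge to w and u and are dominated by ‖w‖ and ‖u‖.
  have hB : ∀ᵐ s, s ∈ uIoc 0 t → ∀ n, inner ℝ (z n s) (y n s)
      = inner ℝ (adjoint ι (ι (resolventOp ι n (w s))))
        (adjoint ι (ι (resolventOp ι n (u s)))) := by
    filter_upwards [ae_interval_of_ae h.ae_eq h0 ht] with s hs hsm n
    simp only [y, z]
    rw [hs hsm, resolventOp_comm, ← ContinuousLinearMap.adjoint_inner_left]
  have hint : Tendsto (fun n => ∫ s in (0:ℝ)..t, inner ℝ (z n s) (y n s)) atTop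
      (𝓝 (∫ s in (0:ℝ)..t, inner ℝ (w s) (u s))) := by
    refine intervalIntegral.tendsto_integral_filter_of_dominated_convergence
      (fun s => ‖w s‖ * ‖u s‖) ?_ ?_ ?_ ?_
    · refine Eventually.of_forall fun n => ?_
      have hUc : ContinuousOn (y n) (uIoc 0 t) := by
        refine ContinuousOn.mono ?_ (uIoc_subset_uIcc.trans (uIcc_of_le ht.1).subset)
        exact (((ι.comp ((resolventOp ι n).comp (adjoint ι))).continuous).comp_continuousOn
          (h.cont.mono (Icc_subset_Icc_right ht.2)))
      exact (intervalIntegrable_iff.1 (hz n)).aestronglyMeasurable.inner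
        (hUc.aestronglyMeasurable measurableSet_uIoc)
    · refine Eventually.of_forall fun n => ?_
      filter_upwards [hB] with s hs hsm
      rw [hs hsm n]
      refine (norm_inner_le_norm _ _).trans ?_
      gcongr <;> exact norm_adjoint_comp_resolventOp_le ι n _
    · have : Integrable (fun s => ‖w s‖ * ‖u s‖) (timeMeasure T) :=
        MemLp.integrable_mul (p := 2) (q := 2) (Lp.memLp w).norm (Lp.memLp u).norm
      exact intervalIntegrable_of_timeMeasure this h0 ht
    · filter_upwards [hB] with s hs hsm
      simp only [hs hsm]
      exact (tendsto_adjoint_comp_resolventOp hι (w s)).inner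
        (tendsto_adjoint_comp_resolventOp hι (u s))
  have h1 := tendsto_nhds_unique ((hl t).sub (hl 0)) ((hint.const_mul 2).congr
    (fun n => (hid n).symm))
  rw [intervalIntegral.integral_const_mul, ← h1]
  ring

/-- Gronwall with the weight exp(-2∫k), which cancels the term 2k‖U‖² and stays between exp(-2κ) and
1. Young's inequality 2‖F‖‖u‖ ≤ ‖F‖²/c + c‖u‖² consumes half of the dissipation 2c‖u‖²; the other
half stays on the left. -/
theorem energy_le (hι : Function.Injective ι) (hd : DenseRange ι)
    {u w F : Lp V 2 (timeMeasure T)} {U : ℝ → H} (h : IsTrajectory ι T u w U) {c κ : ℝ}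
    (hc : 0 < c) {k : ℝ → ℝ} (hk0 : ∀ t, 0 ≤ k t) (hk : Integrable k (timeMeasure T))
    (hκ : ∫ t, k t ∂(timeMeasure T) ≤ κ)
    (hF : ∀ᵐ t ∂(timeMeasure T), inner ℝ (w t) (u t) ≤
      inner ℝ (F t) (u t) - c * ‖u t‖ ^ 2 + k t * ‖ι (u t)‖ ^ 2) :
    ∀ t ∈ Icc 0 T, ‖U t‖ ^ 2 + c * ∫ s in (0:ℝ)..t, ‖u s‖ ^ 2
      ≤ Real.exp (2 * κ) * (‖U 0‖ ^ 2 + ‖F‖ ^ 2 / c) := by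
  intro t ht
  have h0 : (0:ℝ) ∈ Icc 0 T := ⟨le_rfl, ht.1.trans ht.2⟩
  have hT : (0:ℝ) ≤ T := ht.1.trans ht.2
  have hκ0 : 0 ≤ κ := le_trans (integral_nonneg hk0) hκ
  have hexp : 1 ≤ Real.exp (2 * κ) := Real.one_le_exp (by linarith)
  have hX : 0 ≤ ‖U 0‖ ^ 2 + ‖F‖ ^ 2 / c := by positivity
  rcases ht.1.eq_or_lt with rfl | ht0
  · simp only [intervalIntegral.integral_same, mul_zero, add_zero]
    have : (0:ℝ) ≤ ‖F‖ ^ 2 / c := by positivity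
    nlinarith
  have hwu : Integrable (fun s => 2 * inner ℝ (w s) (u s)) (timeMeasure T) :=
    (L2.integrable_inner (𝕜 := ℝ) w u).const_mul 2
  have h2k : Integrable (fun s => 2 * k s) (timeMeasure T) := hk.const_mul 2
  have hKle : ∀ s ∈ Icc 0 t, ∫ r in (0:ℝ)..s, 2 * k r ≤ 2 * κ := by
    intro s hs
    rw [intervalIntegral.integral_const_mul]
    have : ∫ r in (0:ℝ)..s, k r ≤ ∫ r, k r ∂(timeMeasure T) := by
      rw [integral_timeMeasure hT]
      exact intervalIntegral.integral_mono_interval le_rfl hs.1 (hs.2.trans ht.2)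
        (Eventually.of_forall fun r => hk0 r)
        (intervalIntegrable_of_timeMeasure hk h0 (right_mem_Icc.2 hT))
    linarith
  have hK0 : ∀ s ∈ Icc 0 t, 0 ≤ ∫ r in (0:ℝ)..s, 2 * k r := fun s hs =>
    intervalIntegral.integral_nonneg hs.1 fun r _ => mul_nonneg zero_le_two (hk0 r)
  have hw := exp_weighted_primitive ht0 (y := fun s => ‖U s‖ ^ 2)
    (intervalIntegrable_of_timeMeasure hwu h0 ht) (intervalIntegrable_of_timeMeasure h2k h0 ht)
    (fun s hs => h.norm_sq_eq hι hd s ⟨hs.1, hs.2.trans ht.2⟩)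
  have hu2 := intervalIntegrable_of_timeMeasure (integrable_norm_sq u) h0 ht
  have hF2 := intervalIntegrable_of_timeMeasure (integrable_norm_sq F) h0 ht
  have hUc : ContinuousOn (fun s => ‖U s‖ ^ 2) (uIcc 0 t) := by
    rw [uIcc_of_le ht.1]; exact ((h.cont.mono (Icc_subset_Icc_right ht.2)).norm.pow 2)
  have hEc : ContinuousOn (fun s => Real.exp (-∫ r in (0:ℝ)..s, 2 * k r)) (uIcc 0 t) := by
    refine Real.continuous_exp.comp_continuousOn (ContinuousOn.neg ?_)
    exact intervalIntegral.continuousOn_primitive_interval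
      (by
        rw [uIcc_of_le ht.1, integrableOn_Icc_iff_integrableOn_Ioc]
        exact (intervalIntegrable_iff_integrableOn_Ioc_of_le ht.1).1
          (intervalIntegrable_of_timeMeasure h2k h0 ht))
  have hle : ∫ s in (0:ℝ)..t, Real.exp (-∫ r in (0:ℝ)..s, 2 * k r) *
        (2 * inner ℝ (w s) (u s) - 2 * k s * ‖U s‖ ^ 2)
      ≤ ∫ s in (0:ℝ)..t, (‖F s‖ ^ 2 / c - Real.exp (-(2 * κ)) * c * ‖u s‖ ^ 2) := by
    rw [intervalIntegral.integral_of_le ht.1, intervalIntegral.integral_of_le ht.1]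
    refine integral_mono_ae ?_ ?_ ?_
    · exact (((intervalIntegrable_of_timeMeasure hwu h0 ht).sub
        ((intervalIntegrable_of_timeMeasure h2k h0 ht).mul_continuousOn hUc)).continuousOn_mul
          hEc).1
    · exact ((hF2.div_const c).sub (hu2.const_mul _)).1
    · refine (ae_restrict_iff' measurableSet_Ioc).2 ?_
      filter_upwards [ae_interval_of_ae hF h0 ht, ae_interval_of_ae h.ae_eq h0 ht]
        with s hs hs2 hsm
      have hsI : s ∈ Icc 0 t := Ioc_subset_Icc_self hsm
      rw [← uIoc_of_le ht.1] at hsm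
      have h1 := hs hsm
      rw [← hs2 hsm] at h1
      have h2 := real_inner_le_norm (F s) (u s)
      have he1 : Real.exp (-∫ r in (0:ℝ)..s, 2 * k r) ≤ 1 :=
        Real.exp_le_one_iff.2 (by linarith [hK0 s hsI])
      have he2 : Real.exp (-(2 * κ)) ≤ Real.exp (-∫ r in (0:ℝ)..s, 2 * k r) :=
        Real.exp_le_exp.2 (by linarith [hKle s hsI])
      have he0 := Real.exp_pos (-(2 * κ))
      have h3 : 2 * (‖F s‖ * ‖u s‖) ≤ ‖F s‖ ^ 2 / c + c * ‖u s‖ ^ 2 := by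
        have h4 : ‖F s‖ ^ 2 / c + c * ‖u s‖ ^ 2 - 2 * (‖F s‖ * ‖u s‖)
            = (‖F s‖ - c * ‖u s‖) ^ 2 / c := by field_simp; ring
        have : 0 ≤ (‖F s‖ - c * ‖u s‖) ^ 2 / c := by positivity
        linarith
      set e := Real.exp (-∫ r in (0:ℝ)..s, 2 * k r)
      have he : 0 < e := he0.trans_le he2
      calc e * (2 * inner ℝ (w s) (u s) - 2 * k s * ‖U s‖ ^ 2)
          ≤ e * (‖F s‖ ^ 2 / c - c * ‖u s‖ ^ 2) :=
            mul_le_mul_of_nonneg_left (by linarith) he.le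
        _ = e * (‖F s‖ ^ 2 / c) - e * (c * ‖u s‖ ^ 2) := by ring
        _ ≤ 1 * (‖F s‖ ^ 2 / c) - Real.exp (-(2 * κ)) * (c * ‖u s‖ ^ 2) := by gcongr
        _ = _ := by ring
  have hFle : ∫ s in (0:ℝ)..t, ‖F s‖ ^ 2 ≤ ‖F‖ ^ 2 := by
    rw [norm_sq_eq_integral, integral_timeMeasure hT]
    exact intervalIntegral.integral_mono_interval le_rfl ht.1 ht.2
      (Eventually.of_forall fun r => sq_nonneg _)
      (intervalIntegrable_of_timeMeasure (integrable_norm_sq F) h0 (right_mem_Icc.2 hT))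
  rw [intervalIntegral.integral_sub (hF2.div_const c) (hu2.const_mul _),
    intervalIntegral.integral_const_mul, intervalIntegral.integral_div] at hle
  have he2 : Real.exp (-(2 * κ)) ≤ Real.exp (-∫ r in (0:ℝ)..t, 2 * k r) :=
    Real.exp_le_exp.2 (by linarith [hKle t (right_mem_Icc.2 ht.1)])
  have h1 : Real.exp (-(2 * κ)) * ‖U t‖ ^ 2 ≤
      Real.exp (-∫ r in (0:ℝ)..t, 2 * k r) * ‖U t‖ ^ 2 := by gcongr
  have h2 : (∫ s in (0:ℝ)..t, ‖F s‖ ^ 2) / c ≤ ‖F‖ ^ 2 / c := by gcongr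
  have h3 : Real.exp (-(2 * κ)) * (‖U t‖ ^ 2 + c * ∫ s in (0:ℝ)..t, ‖u s‖ ^ 2)
      ≤ ‖U 0‖ ^ 2 + ‖F‖ ^ 2 / c := by
    rw [mul_add]; linarith
  have h4 : ‖U t‖ ^ 2 + c * ∫ s in (0:ℝ)..t, ‖u s‖ ^ 2 = Real.exp (2 * κ) *
      (Real.exp (-(2 * κ)) * (‖U t‖ ^ 2 + c * ∫ s in (0:ℝ)..t, ‖u s‖ ^ 2)) := by
    rw [← mul_assoc, ← Real.exp_add]; simp
  rw [h4]
  gcongr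

end IsTrajectory

end Trajectories

/-! ## The method of continuity for Lipschitz maps -/

/-- Solving G x + E x = y means finding a fixed point of x ↦ G⁻¹(y - E x). A right inverse of G is
K-Lipschitz by the lower bound on G, so this map contracts by K l < 1. -/
theorem surjective_add_of_antilipschitz {X Y : Type*} [NormedAddCommGroup X] [CompleteSpace X]
    [NormedAddCommGroup Y] {G E : X → Y} {K l : ℝ} (hK : 0 ≤ K) (hl : 0 ≤ l) (hKl : K * l < 1)
    (hG : Function.Surjective G) (hGK : ∀ x y, ‖x - y‖ ≤ K * ‖G x - G y‖)
    (hE : ∀ x y, ‖E x - E y‖ ≤ l * ‖x - y‖) :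
    Function.Surjective fun x => G x + E x := by
  intro y
  choose s hs using hG
  let S : X → X := fun x => s (y - E x)
  have hS : ContractingWith (K * l).toNNReal S := by
    refine ⟨by simpa using hKl, LipschitzWith.of_dist_le_mul fun a b => ?_⟩
    rw [dist_eq_norm, dist_eq_norm]
    refine (hGK _ _).trans ?_
    simp only [S, hs]
    rw [Real.coe_toNNReal _ (by positivity), sub_sub_sub_cancel_left, mul_assoc, norm_sub_rev]
    gcongr
    exact hE a b
  refine ⟨hS.fixedPoint, ?_⟩
  have h : s (y - E hS.fixedPoint) = hS.fixedPoint := hS.fixedPoint_isFixedPt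
  have h2 := hs (y - E hS.fixedPoint)
  rw [h] at h2
  simp only [h2, sub_add_cancel]

/-! ### The Banach space of trajectories and its a priori estimate -/

section TrajectorySpace

variable {V H : Type*} [NormedAddCommGroup V] [InnerProductSpace ℝ V] [CompleteSpace V]
  [NormedAddCommGroup H] [InnerProductSpace ℝ H] [CompleteSpace H]

open ContinuousLinearMap (adjoint)

/-- The space of trajectories. -/
def trajSpace (ι : V →L[ℝ] H) {T : ℝ} (hT : 0 < T) :
    Submodule ℝ (Lp V 2 (timeMeasure T) × Lp V 2 (timeMeasure T) × C(Icc (0:ℝ) T, H)) where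
  carrier := {x | IsTrajectory ι T x.1 x.2.1 (IccExtend hT.le x.2.2)}
  zero_mem' := IsTrajectory.zero
  add_mem' h h' := h.add h'
  smul_mem' c _ h := h.smul c

variable {ι : V →L[ℝ] H} {T : ℝ} {hT : 0 < T}

/-- The almost everywhere identity passes to the limit along a subsequence converging a.e.; the
integrated identity does so because the L² norm in time controls integrals over (0,t). Closedness
gives the completeness needed for fixed points. -/
theorem isClosed_trajSpace : IsClosed (trajSpace ι hT : Set
    (Lp V 2 (timeMeasure T) × Lp V 2 (timeMeasure T) × C(Icc (0:ℝ) T, H))) := by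
  refine IsSeqClosed.isClosed fun x y hx hxy => ?_
  have hx' : ∀ n, IsTrajectory ι T (x n).1 (x n).2.1 (IccExtend hT.le (x n).2.2) := hx
  have h1 : Tendsto (fun n => (x n).1) atTop (𝓝 y.1) := (continuous_fst.tendsto y).comp hxy
  have h2 : Tendsto (fun n => (x n).2.1) atTop (𝓝 y.2.1) :=
    ((continuous_fst.comp continuous_snd).tendsto y).comp hxy
  have h3 : Tendsto (fun n => (x n).2.2) atTop (𝓝 y.2.2) :=
    ((continuous_snd.comp continuous_snd).tendsto y).comp hxy
  have h4 : ∀ t, Tendsto (fun n => IccExtend hT.le (x n).2.2 t) atTop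
      (𝓝 (IccExtend hT.le y.2.2 t)) := fun t =>
    ((ContinuousEvalConst.continuous_eval_const (projIcc 0 T hT.le t)).tendsto y.2.2).comp h3
  refine ⟨(y.2.2.continuous.Icc_extend' : Continuous (IccExtend hT.le y.2.2)).continuousOn,
    ?_, fun t ht => ?_⟩
  · obtain ⟨ns, hns, hae⟩ := (tendstoInMeasure_of_tendsto_Lp h1).exists_seq_tendsto_ae
    filter_upwards [hae, ae_all_iff.2 fun n => (hx' n).ae_eq] with t ht1 ht2
    refine tendsto_nhds_unique ((h4 t).comp hns.tendsto_atTop) ?_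
    refine ((ι.continuous.tendsto _).comp ht1).congr fun n => ?_
    exact (ht2 (ns n)).symm
  · have h0 : (0:ℝ) ∈ Icc 0 T := left_mem_Icc.2 hT.le
    have hw : Tendsto (fun n => ∫ s in (0:ℝ)..t, (x n).2.1 s) atTop
        (𝓝 (∫ s in (0:ℝ)..t, y.2.1 s)) := by
      rw [tendsto_iff_norm_sub_tendsto_zero] at h2 ⊢
      refine squeeze_zero (fun n => norm_nonneg _) (fun n => ?_)
        (by simpa using h2.const_mul (√T))
      have e : ∫ s in (0:ℝ)..t, ((x n).2.1 - y.2.1) s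
          = (∫ s in (0:ℝ)..t, (x n).2.1 s) - ∫ s in (0:ℝ)..t, y.2.1 s := by
        rw [intervalIntegral.integral_congr_ae (ae_interval_of_ae (Lp.coeFn_sub _ _) h0 ht)]
        exact intervalIntegral.integral_sub (Lp_intervalIntegrable_time _ h0 ht)
          (Lp_intervalIntegrable_time _ h0 ht)
      rw [← e]
      exact norm_intervalIntegral_le_sqrt _ h0 ht
    refine tendsto_nhds_unique (((adjoint ι).continuous.tendsto _).comp (h4 t)) ?_
    refine ((((adjoint ι).continuous.tendsto _).comp (h4 0)).add hw).congr fun n => ?_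
    exact ((hx' n).primitive t ht).symm

instance : CompleteSpace (trajSpace ι hT) := isClosed_trajSpace.completeSpace_coe

/-- Minkowski's inequality for a pointwise bound whose terms take values in different spaces. -/
theorem norm_le_of_ae_norm_le {E E' E'' : Type*} [NormedAddCommGroup E] [NormedAddCommGroup E']
    [NormedAddCommGroup E''] {X : Type*} [MeasurableSpace X]
    {μ : Measure X} {f : Lp E 2 μ} {F : Lp E' 2 μ} {u : Lp E'' 2 μ} {m : Lp ℝ 2 μ} {A B : ℝ}
    (hA : 0 ≤ A) (hB : 0 ≤ B) (h : ∀ᵐ t ∂μ, ‖f t‖ ≤ ‖F t‖ + A * ‖u t‖ + B * m t) :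
    ‖f‖ ≤ ‖F‖ + A * ‖u‖ + B * ‖m‖ := by
  have hF : MemLp (fun t => ‖F t‖) 2 μ := (Lp.memLp F).norm
  have hu : MemLp (fun t => ‖u t‖) 2 μ := (Lp.memLp u).norm
  have hFn : ‖hF.toLp _‖ = ‖F‖ := by rw [Lp.norm_toLp, Lp.norm_def, eLpNorm_norm]
  have hun : ‖hu.toLp _‖ = ‖u‖ := by rw [Lp.norm_toLp, Lp.norm_def, eLpNorm_norm]
  have h1 : ‖f‖ ≤ ‖hF.toLp _ + A • hu.toLp _ + B • m‖ := by
    refine Lp.norm_le_norm_of_ae_le ?_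
    filter_upwards [h, Lp.coeFn_add (hF.toLp _ + A • hu.toLp _) (B • m),
      Lp.coeFn_add (hF.toLp _) (A • hu.toLp _), Lp.coeFn_smul A (hu.toLp _), Lp.coeFn_smul B m,
      hF.coeFn_toLp, hu.coeFn_toLp] with t h1 h2 h3 h4 h5 h6 h7
    rw [h2, Pi.add_apply, h3, Pi.add_apply, h4, h5, Pi.smul_apply, Pi.smul_apply, h6, h7]
    exact h1.trans (le_abs_self _)
  refine h1.trans ((norm_add₃_le).trans ?_)
  rw [norm_smul, norm_smul, hFn, hun, Real.norm_of_nonneg hA, Real.norm_of_nonneg hB]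

/-- The constant in the stability estimate for trajectories. -/
def stabConst (c L κ μ : ℝ) : ℝ := 1 + (1 + L + μ) * (Real.exp κ / c)

/-- Square roots of the energy inequality. The condition c ≤ 1 lets the one constant exp(κ)/c serve
both the L² norm of u, where a factor 1/c is lost, and the supremum of ‖U‖. -/
theorem IsTrajectory.stability (hι : Function.Injective ι) (hd : DenseRange ι)
    {u w F : Lp V 2 (timeMeasure T)} {U : ℝ → H} (h : IsTrajectory ι T u w U) (hT : 0 < T)
    {c κ : ℝ} (hc : 0 < c) (hc1 : c ≤ 1) {k : ℝ → ℝ} (hk0 : ∀ t, 0 ≤ k t)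
    (hk : Integrable k (timeMeasure T)) (hκ : ∫ t, k t ∂(timeMeasure T) ≤ κ)
    (hF : ∀ᵐ t ∂(timeMeasure T), inner ℝ (w t) (u t) ≤
      inner ℝ (F t) (u t) - c * ‖u t‖ ^ 2 + k t * ‖ι (u t)‖ ^ 2) :
    ‖u‖ ≤ Real.exp κ / c * (‖U 0‖ + ‖F‖) ∧
      ∀ t ∈ Icc 0 T, ‖U t‖ ≤ Real.exp κ / c * (‖U 0‖ + ‖F‖) := by
  have h1 := h.energy_le hι hd hc hk0 hk hκ hF
  have hX : Real.exp (2 * κ) * (‖U 0‖ ^ 2 + ‖F‖ ^ 2 / c) ≤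
      c * (Real.exp κ / c * (‖U 0‖ + ‖F‖)) ^ 2 := by
    have e1 : Real.exp (2 * κ) = Real.exp κ ^ 2 := by rw [← Real.exp_nat_mul]; norm_num
    have e2 : c * (Real.exp κ / c * (‖U 0‖ + ‖F‖)) ^ 2
        = Real.exp κ ^ 2 * ((‖U 0‖ + ‖F‖) ^ 2 / c) := by field_simp
    rw [e1, e2]
    gcongr
    rw [le_div_iff₀ hc, add_mul, div_mul_cancel₀ _ hc.ne']
    nlinarith [norm_nonneg (U 0), norm_nonneg F, mul_nonneg (norm_nonneg (U 0)) (norm_nonneg F),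
      sq_nonneg ‖U 0‖]
  set B := Real.exp κ / c * (‖U 0‖ + ‖F‖)
  have hB : 0 ≤ B := by positivity
  constructor
  · have h2 := (h1 T (right_mem_Icc.2 hT.le)).trans hX
    rw [← integral_timeMeasure hT.le, ← norm_sq_eq_integral] at h2
    refine le_of_sq_le_sq ?_ hB
    have h3 : c * ‖u‖ ^ 2 ≤ c * B ^ 2 := by nlinarith [sq_nonneg ‖U T‖]
    exact le_of_mul_le_mul_left h3 hc
  · intro t ht
    have h2 := (h1 t ht).trans hX
    refine le_of_sq_le_sq ?_ hB
    have h3 : 0 ≤ ∫ s in (0:ℝ)..t, ‖u s‖ ^ 2 :=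
      intervalIntegral.integral_nonneg ht.1 fun s _ => sq_nonneg _
    nlinarith [sq_nonneg B, mul_nonneg hc.le h3]

/-- The energy estimate controls u and U; the bound on w is read off the equation. There m is only
square integrable in time, so its factor ‖ιu‖ has to be bounded uniformly in t, which the supremum
bound on U provides. -/
theorem trajSpace_norm_le (hι : Function.Injective ι) (hd : DenseRange ι)
    (x : trajSpace ι hT) {F : Lp V 2 (timeMeasure T)}
    {c κ L μ : ℝ} (hc : 0 < c) (hc1 : c ≤ 1) {k : ℝ → ℝ} (hk0 : ∀ t, 0 ≤ k t)
    (hk : Integrable k (timeMeasure T)) (hκ : ∫ t, k t ∂(timeMeasure T) ≤ κ)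
    (hL : 0 ≤ L) {m : Lp ℝ 2 (timeMeasure T)} (hm0 : 0 ≤ᵐ[timeMeasure T] m) (hm : ‖m‖ ≤ μ)
    (hF : ∀ᵐ t ∂(timeMeasure T), inner ℝ (x.1.2.1 t) (x.1.1 t) ≤
      inner ℝ (F t) (x.1.1 t) - c * ‖x.1.1 t‖ ^ 2 + k t * ‖ι (x.1.1 t)‖ ^ 2)
    (hw : ∀ᵐ t ∂(timeMeasure T), ‖x.1.2.1 t‖ ≤
      ‖F t‖ + L * ‖x.1.1 t‖ + m t * ‖ι (x.1.1 t)‖) :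
    ‖x‖ ≤ stabConst c L κ μ * (‖IccExtend hT.le x.1.2.2 0‖ + ‖F‖) := by
  have hx : IsTrajectory ι T x.1.1 x.1.2.1 (IccExtend hT.le x.1.2.2) := x.2
  obtain ⟨h1, h2⟩ := hx.stability hι hd hT hc hc1 hk0 hk hκ hF
  set X := ‖IccExtend hT.le x.1.2.2 0‖ + ‖F‖
  have hX0 : 0 ≤ X := by positivity
  set B := Real.exp κ / c
  have hB : 0 ≤ B := by positivity
  have hμ : 0 ≤ μ := (norm_nonneg _).trans hm
  have h3 : ‖x.1.2.1‖ ≤ ‖F‖ + L * ‖x.1.1‖ + (B * X) * ‖m‖ := by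
    refine norm_le_of_ae_norm_le hL (by positivity) ?_
    filter_upwards [hw, hx.ae_eq, ae_restrict_mem measurableSet_Ioo, hm0] with t h4 h5 h6 h7
    refine h4.trans ?_
    have h8 := h2 t (Ioo_subset_Icc_self h6)
    rw [h5] at h8
    have h7' : 0 ≤ m t := h7
    nlinarith [mul_le_mul_of_nonneg_left h8 h7']
  have h4 : ‖x.1.2.2‖ ≤ B * X := by
    rw [ContinuousMap.norm_le _ (by positivity)]
    intro t
    have := h2 t t.2
    rwa [IccExtend_of_mem _ _ t.2] at this
  have hFX : ‖F‖ ≤ X := le_add_of_nonneg_left (norm_nonneg _)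
  have hBX : 0 ≤ B * X := by positivity
  have h5 : ‖x.1.2.1‖ ≤ X + L * (B * X) + (B * X) * μ := by
    refine h3.trans ?_
    gcongr
  have hs : stabConst c L κ μ * X = X + B * X + L * (B * X) + (B * X) * μ := by
    simp only [stabConst]; ring
  have hLB : 0 ≤ L * (B * X) := by positivity
  have hμB : 0 ≤ (B * X) * μ := by positivity
  change ‖x.1‖ ≤ _
  rw [Prod.norm_def, Prod.norm_def, hs]
  refine max_le ?_ (max_le ?_ ?_) <;> linarith

/-! ### The linear problem -/

/-- The operator `u ↦ (u' + u, u(0))`. -/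
def heatOp (ι : V →L[ℝ] H) {T : ℝ} (hT : 0 < T) :
    trajSpace ι hT →L[ℝ] WithLp 2 (Lp V 2 (timeMeasure T) × H) :=
  let p₁ := ContinuousLinearMap.fst ℝ (Lp V 2 (timeMeasure T))
    (Lp V 2 (timeMeasure T) × C(Icc (0:ℝ) T, H))
  let p₂ := ContinuousLinearMap.snd ℝ (Lp V 2 (timeMeasure T))
    (Lp V 2 (timeMeasure T) × C(Icc (0:ℝ) T, H))
  let q₁ := ContinuousLinearMap.fst ℝ (Lp V 2 (timeMeasure T)) C(Icc (0:ℝ) T, H)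
  let q₂ := ContinuousLinearMap.snd ℝ (Lp V 2 (timeMeasure T)) C(Icc (0:ℝ) T, H)
  let ev : C(Icc (0:ℝ) T, H) →L[ℝ] H := ContinuousMap.evalCLM ℝ ⟨0, left_mem_Icc.2 hT.le⟩
  (WithLp.prodContinuousLinearEquiv 2 ℝ (Lp V 2 (timeMeasure T)) H).symm.toContinuousLinearMap.comp
    (((q₁.comp p₂ + p₁).prod (ev.comp (q₂.comp p₂))).comp (trajSpace ι hT).subtypeL)

theorem heatOp_fst (x : trajSpace ι hT) : (heatOp ι hT x).fst = x.1.2.1 + x.1.1 := rfl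

theorem heatOp_snd (x : trajSpace ι hT) :
    (heatOp ι hT x).snd = IccExtend hT.le x.1.2.2 0 := by
  rw [IccExtend_of_mem _ _ (left_mem_Icc.2 hT.le)]; rfl

theorem heatOp_antilipschitz (hι : Function.Injective ι) (hd : DenseRange ι) :
    ∃ K, AntilipschitzWith K (heatOp ι hT) := by
  refine ⟨⟨stabConst 1 1 0 0 * 2, by simp only [stabConst]; norm_num⟩,
    (heatOp ι hT).antilipschitz_of_bound fun x => ?_⟩
  have h : ‖x‖ ≤ stabConst 1 1 0 0 * (‖IccExtend hT.le x.1.2.2 0‖ + ‖x.1.2.1 + x.1.1‖) := by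
    -- With F = w + u one has ⟨w,u⟩ = ⟨F,u⟩ - ‖u‖² exactly, so there are no lower order terms and c
    -- = L = 1.
    refine trajSpace_norm_le hι hd x (c := 1) (κ := 0) (L := 1) (μ := 0) (k := 0) (m := 0)
      one_pos le_rfl (fun t => le_rfl) (integrable_zero _ _ _) (by simp) zero_le_one
      ?_ (by simp) ?_ ?_
    · filter_upwards [Lp.coeFn_zero ℝ 2 (timeMeasure T)] with t ht
      rw [ht]
    · filter_upwards [Lp.coeFn_add x.1.2.1 x.1.1] with t ht
      rw [ht, Pi.add_apply, inner_add_left, real_inner_self_eq_norm_sq]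
      simp
    · filter_upwards [Lp.coeFn_add x.1.2.1 x.1.1, Lp.coeFn_zero ℝ 2 (timeMeasure T)] with t ht h0
      rw [ht, h0, Pi.add_apply]
      have := norm_sub_le (x.1.2.1 t + x.1.1 t) (x.1.1 t)
      simpa using this
  rw [← heatOp_snd, ← heatOp_fst] at h
  have h1 : ‖(heatOp ι hT x).fst‖ ≤ ‖heatOp ι hT x‖ := WithLp.norm_fst_le _ _
  have h2 : ‖(heatOp ι hT x).snd‖ ≤ ‖heatOp ι hT x‖ := WithLp.norm_snd_le _ _
  have h3 : 0 ≤ stabConst 1 1 0 0 := by simp only [stabConst]; norm_num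
  refine h.trans ((mul_le_mul_of_nonneg_left (add_le_add h2 h1) h3).trans (le_of_eq ?_))
  change _ = stabConst 1 1 0 0 * 2 * ‖heatOp ι hT x‖
  ring

/-- The trajectory `t ↦ ∫₀ᵗ v`. -/
theorem exists_traj_primitive (ι : V →L[ℝ] H) (hT : 0 < T) (v : Lp V 2 (timeMeasure T)) :
    ∃ x : trajSpace ι hT, (∀ᵐ t ∂(timeMeasure T), x.1.1 t = ∫ s in (0:ℝ)..t, v s) ∧
      (∀ᵐ t ∂(timeMeasure T), x.1.2.1 t = adjoint ι (ι (v t))) ∧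
      IccExtend hT.le x.1.2.2 0 = 0 := by
  have h0 : (0:ℝ) ∈ Icc 0 T := left_mem_Icc.2 hT.le
  have hTm : T ∈ Icc 0 T := right_mem_Icc.2 hT.le
  have hcont : ContinuousOn (fun t => ∫ s in (0:ℝ)..t, v s) (Icc 0 T) := by
    rw [← uIcc_of_le hT.le]
    refine intervalIntegral.continuousOn_primitive_interval ?_
    rw [uIcc_of_le hT.le, integrableOn_Icc_iff_integrableOn_Ioc]
    exact (intervalIntegrable_iff_integrableOn_Ioc_of_le hT.le).1
      (Lp_intervalIntegrable_time v h0 hTm)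
  have hmem : MemLp (fun t => ∫ s in (0:ℝ)..t, v s) 2 (timeMeasure T) := by
    refine MemLp.of_bound ((hcont.mono Ioo_subset_Icc_self).aestronglyMeasurable
      measurableSet_Ioo) (√T * ‖v‖) ?_
    filter_upwards [ae_restrict_mem measurableSet_Ioo] with t ht
    exact norm_intervalIntegral_le_sqrt v h0 (Ioo_subset_Icc_self ht)
  let U : C(Icc (0:ℝ) T, H) := ⟨fun t => ι (∫ s in (0:ℝ)..t, v s),
    ι.continuous.comp (continuousOn_iff_continuous_domRestrict.1 hcont)⟩
  have hU : ∀ t ∈ Icc 0 T, IccExtend hT.le U t = ι (∫ s in (0:ℝ)..t, v s) := fun t ht => by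
    rw [IccExtend_of_mem _ _ ht]; rfl
  have hUt : IsTrajectory ι T (hmem.toLp _) (((adjoint ι).comp ι).compLp v)
      (IccExtend hT.le U) := by
    refine ⟨(U.continuous.Icc_extend' : Continuous (IccExtend hT.le U)).continuousOn,
      ?_, fun t ht => ?_⟩
    · filter_upwards [hmem.coeFn_toLp, ae_restrict_mem measurableSet_Ioo] with t h1 h2
      rw [hU t (Ioo_subset_Icc_self h2), h1]
    · rw [hU t ht, hU 0 h0, intervalIntegral.integral_same, map_zero, map_zero, zero_add,
        intervalIntegral.integral_congr_ae
          (ae_interval_of_ae (((adjoint ι).comp ι).coeFn_compLp v) h0 ht),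
        ContinuousLinearMap.intervalIntegral_comp_comm _ (Lp_intervalIntegrable_time v h0 ht)]
      rfl
  refine ⟨⟨(hmem.toLp _, ((adjoint ι).comp ι).compLp v, U), hUt⟩, hmem.coeFn_toLp,
    ((adjoint ι).comp ι).coeFn_compLp v, ?_⟩
  rw [hU 0 h0, intervalIntegral.integral_same, map_zero]

/-- Constant trajectories. -/
theorem exists_traj_const (ι : V →L[ℝ] H) (hT : 0 < T) (φ : V) :
    ∃ x : trajSpace ι hT, (∀ᵐ t ∂(timeMeasure T), x.1.1 t = φ) ∧ x.1.2.1 = 0 ∧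
      IccExtend hT.le x.1.2.2 0 = ι φ := by
  have h0 : (0:ℝ) ∈ Icc 0 T := left_mem_Icc.2 hT.le
  have hmem : MemLp (fun _ : ℝ => φ) 2 (timeMeasure T) := memLp_const φ
  have hUt : IsTrajectory ι T (hmem.toLp _) 0
      (IccExtend hT.le (ContinuousMap.const (Icc (0:ℝ) T) (ι φ))) := by
    refine ⟨?_, ?_, fun t ht => ?_⟩
    · exact continuousOn_const
    · filter_upwards [hmem.coeFn_toLp] with t h1
      rw [h1]; rfl
    · rw [intervalIntegral.integral_congr_ae
        (ae_interval_of_ae (Lp.coeFn_zero V 2 (timeMeasure T)) h0 ht)]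
      simp [IccExtend]
  exact ⟨⟨(hmem.toLp _, 0, ContinuousMap.const _ (ι φ)), hUt⟩, hmem.coeFn_toLp, rfl, rfl⟩

/-- The range is closed, and its orthogonal complement is trivial. If (v,h) is orthogonal to it, the
trajectory ∫₀ᵗ v, with derivative ι†ιv and initial value 0, gives ∫‖ιv‖² + ½‖∫₀ᵀ v‖² = 0, hence v =
0. Constant trajectories then give ⟨ιφ,h⟩ = 0 for all φ, hence h = 0 by density. The target carries
the ℓ² product norm so that orthogonality is available. -/
theorem heatOp_surjective (hι : Function.Injective ι) (hd : DenseRange ι) :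
    Function.Surjective (heatOp ι hT) := by
  have h0 : (0:ℝ) ∈ Icc 0 T := left_mem_Icc.2 hT.le
  have hTm : T ∈ Icc 0 T := right_mem_Icc.2 hT.le
  obtain ⟨K, hK⟩ := heatOp_antilipschitz (hT := hT) hι hd
  have hcl : IsClosed ((heatOp ι hT).range : Set (WithLp 2 (Lp V 2 (timeMeasure T) × H))) := by
    rw [LinearMap.coe_range]
    exact hK.isClosed_range (heatOp ι hT).uniformContinuous
  have := hcl.completeSpace_coe
  rw [← ContinuousLinearMap.coe_coe, ← LinearMap.range_eq_top]
  rw [← (heatOp ι hT).range.orthogonal_orthogonal, Submodule.eq_top_iff']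
  intro y z hz
  have hz' : ∀ x : trajSpace ι hT, inner ℝ (x.1.2.1 + x.1.1) z.fst
      + inner ℝ (IccExtend hT.le x.1.2.2 0) z.snd = (0:ℝ) := fun x => by
    have := (Submodule.mem_orthogonal _ _).1 hz _ ⟨x, rfl⟩
    rw [ContinuousLinearMap.coe_coe, WithLp.prod_inner_apply] at this
    rw [← heatOp_snd, ← heatOp_fst]
    exact this
  set v := z.fst
  obtain ⟨x, hx1, hx2, hx3⟩ := exists_traj_primitive ι hT v
  have h1 := hz' x
  rw [hx3, inner_zero_left, add_zero, inner_add_left, L2.inner_def, L2.inner_def] at h1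
  have h2 : ∫ t, inner ℝ (x.1.2.1 t) (v t) ∂(timeMeasure T)
      = ∫ t, ‖ι (v t)‖ ^ 2 ∂(timeMeasure T) := by
    refine integral_congr_ae ?_
    filter_upwards [hx2] with t ht
    rw [ht, ContinuousLinearMap.adjoint_inner_left, real_inner_self_eq_norm_sq]
  have h3 : 0 ≤ ∫ t, inner ℝ (x.1.1 t) (v t) ∂(timeMeasure T) := by
    have h4 := norm_sq_primitive hT (Lp_intervalIntegrable_time v h0 hTm)
      (y := fun t => ∫ s in (0:ℝ)..t, v s) (by simp)
    rw [intervalIntegral.integral_same] at h4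
    have h5 : ∫ t, inner ℝ (x.1.1 t) (v t) ∂(timeMeasure T)
        = ∫ t, inner ℝ (v t) (∫ s in (0:ℝ)..t, v s) ∂(timeMeasure T) := by
      refine integral_congr_ae ?_
      filter_upwards [hx1] with t ht
      rw [ht, real_inner_comm]
    rw [h5, integral_timeMeasure hT.le]
    simp only [norm_zero] at h4
    nlinarith [sq_nonneg ‖∫ s in (0:ℝ)..T, v s‖]
  have h4 : ∫ t, ‖ι (v t)‖ ^ 2 ∂(timeMeasure T) = 0 := by
    refine le_antisymm ?_ (integral_nonneg fun t => sq_nonneg _)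
    rw [h2] at h1
    linarith
  have hi : Integrable (fun t => ‖ι (v t)‖ ^ 2) (timeMeasure T) := by
    refine (integrable_norm_sq (ι.compLp v)).congr ?_
    filter_upwards [ι.coeFn_compLp v] with t ht
    rw [ht]
  rw [integral_eq_zero_iff_of_nonneg (fun t => sq_nonneg _) hi] at h4
  have hv : v = 0 := by
    rw [Lp.eq_zero_iff_ae_eq_zero]
    filter_upwards [h4] with t ht
    have h5 : ‖ι (v t)‖ = 0 := by simpa using ht
    exact hι (by rw [norm_eq_zero.1 h5, Pi.zero_apply, map_zero])
  have hh : z.snd = 0 := by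
    refine hd.eq_zero_of_inner_right ℝ fun φ => ?_
    obtain ⟨y, hy1, hy2, hy3⟩ := exists_traj_const ι hT φ
    have h5 := hz' y
    rw [hv, inner_zero_right, zero_add, hy3] at h5
    exact h5
  have hz0 : z = 0 := by
    apply (WithLp.equiv 2 _).injective
    exact Prod.ext hv hh
  rw [hz0, inner_zero_left]

end TrajectorySpace

/-! ## Nonlinear parabolic equations -/

/-- Composition of a Carathéodory function with a measurable function. -/
theorem aestronglyMeasurable_caratheodory {X V W : Type*} [MeasurableSpace X] {μ : Measure X}
    [TopologicalSpace V] [TopologicalSpace.PseudoMetrizableSpace V] [MeasurableSpace V] [BorelSpace V]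
    [NormedAddCommGroup W]
    {a : X → V → W} (ha : ∀ v, AEStronglyMeasurable (fun t => a t v) μ)
    (hc : ∀ t, Continuous (a t)) {u : X → V} (hu : AEStronglyMeasurable u μ) :
    AEStronglyMeasurable (fun t => a t (u t)) μ := by
  obtain ⟨g, hg, hug⟩ := hu
  -- Along a simple function the composition is a finite sum of functions t ↦ a t v, cut off to
  -- measurable sets; continuity in v then passes to the limit.
  have h1 : ∀ n, AEStronglyMeasurable (fun t => a t (hg.approx n t)) μ := by
    intro n
    set s := hg.approx n
    have : (fun t => a t (s t)) =
        fun t => ∑ v ∈ s.range, (s ⁻¹' {v}).indicator (fun t => a t v) t := by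
      ext t
      rw [Finset.sum_eq_single (s t)]
      · simp
      · intro v _ hv
        rw [indicator_of_notMem]
        simpa using hv.symm
      · intro h
        exact absurd (s.mem_range_self t) h
    rw [this]
    refine Finset.aestronglyMeasurable_fun_sum _ fun v _ => ?_
    exact (ha v).indicator (s.measurableSet_fiber v)
  refine aestronglyMeasurable_of_tendsto_ae atTop h1 ?_
  filter_upwards [hug] with t ht
  rw [ht]
  exact ((hc t).tendsto _).comp (hg.tendsto_approx t)

section Nonlinear

variable {V H : Type*} [NormedAddCommGroup V] [InnerProductSpace ℝ V] [CompleteSpace V]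
  [NormedAddCommGroup H] [InnerProductSpace ℝ H] [CompleteSpace H]

/-- A time dependent operator on `V` (identified with its dual) that is strongly monotone and
Lipschitz up to lower order terms. -/
structure IsParabolicOperator (ι : V →L[ℝ] H) (T : ℝ) (a : ℝ → V → V) (c L : ℝ) (m k : ℝ → ℝ) :
    Prop where
  c_pos : 0 < c
  c_le : c ≤ 1
  le_L : 1 ≤ L
  aesm : ∀ v, AEStronglyMeasurable (fun t => a t v) (timeMeasure T)
  zero_memLp : MemLp (fun t => a t 0) 2 (timeMeasure T)
  m_nonneg : ∀ t, 0 ≤ m t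
  m_memLp : MemLp m 2 (timeMeasure T)
  k_nonneg : ∀ t, 0 ≤ k t
  k_integrable : Integrable k (timeMeasure T)
  lip : ∀ t v v', ‖a t v - a t v'‖ ≤ L * ‖v - v'‖ + m t * ‖ι (v - v')‖
  mono : ∀ t v v', c * ‖v - v'‖ ^ 2 - k t * ‖ι (v - v')‖ ^ 2 ≤ inner ℝ (a t v - a t v') (v - v')

namespace IsParabolicOperator

variable {ι : V →L[ℝ] H} {T : ℝ} {hT : 0 < T} {a : ℝ → V → V} {c L : ℝ} {m k : ℝ → ℝ}

omit [CompleteSpace V] [CompleteSpace H] in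
theorem continuous (h : IsParabolicOperator ι T a c L m k) (t : ℝ) : Continuous (a t) := by
  have : LipschitzWith (L + m t * ‖ι‖).toNNReal (a t) := by
    have h0 : 0 ≤ L + m t * ‖ι‖ := by
      have := h.le_L
      have := h.m_nonneg t
      positivity
    refine LipschitzWith.of_dist_le_mul fun v v' => ?_
    rw [dist_eq_norm, dist_eq_norm, Real.coe_toNNReal _ h0]
    refine (h.lip t v v').trans ?_
    rw [add_mul, mul_assoc]
    gcongr
    · exact h.m_nonneg t
    · exact ι.le_opNorm _
  exact this.continuous

/-- The lower order coefficient m is only square integrable, so the operator is applied to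
trajectories rather than to arbitrary u in L²((0,T);V): U is bounded in H, whence m‖ιu‖ ≤ B m. -/
theorem memLp_comp (h : IsParabolicOperator ι T a c L m k) {u w : Lp V 2 (timeMeasure T)}
    {U : ℝ → H} (hx : IsTrajectory ι T u w U) : MemLp (fun t => a t (u t)) 2 (timeMeasure T) := by
  borelize V
  obtain ⟨B, hB⟩ := isCompact_Icc.exists_bound_of_continuousOn hx.cont
  have h1 : MemLp (fun t => ‖a t 0‖ + L * ‖u t‖ + B * m t) 2 (timeMeasure T) :=
    (h.zero_memLp.norm.add ((Lp.memLp u).norm.const_mul L)).add (h.m_memLp.const_mul B)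
  refine h1.mono (aestronglyMeasurable_caratheodory h.aesm h.continuous
    (Lp.aestronglyMeasurable u)) ?_
  filter_upwards [hx.ae_eq, ae_restrict_mem measurableSet_Ioo] with t h2 h3
  have h4 := hB t (Ioo_subset_Icc_self h3)
  rw [h2] at h4
  refine le_trans ?_ (le_abs_self _)
  have h5 := h.lip t (u t) 0
  rw [sub_zero] at h5
  have h6 := norm_le_norm_add_norm_sub (a t 0) (a t (u t))
  rw [norm_sub_rev] at h6
  have h7 : ‖a t (u t)‖ ≤ ‖a t 0‖ + ‖a t (u t) - a t 0‖ := by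
    have := norm_add_le (a t 0) (a t (u t) - a t 0)
    rwa [add_sub_cancel] at this
  nlinarith [mul_le_mul_of_nonneg_left h4 (h.m_nonneg t)]

/-- The operator acting on trajectories. -/
def nemytskii (h : IsParabolicOperator ι T a c L m k) (x : trajSpace ι hT) :
    Lp V 2 (timeMeasure T) := (h.memLp_comp x.2).toLp _

theorem coeFn_nemytskii (h : IsParabolicOperator ι T a c L m k) (x : trajSpace ι hT) :
    h.nemytskii x =ᵐ[timeMeasure T] fun t => a t (x.1.1 t) := (h.memLp_comp x.2).coeFn_toLp

/-- The difference of two trajectories is a trajectory, with the difference of the residuals as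
forcing. `mono` supplies the energy inequality and `lip` the bound on the time derivative. This
single estimate yields uniqueness, stability and the uniform inverse bound of the continuity method.
-/
theorem dist_le (h : IsParabolicOperator ι T a c L m k) (hι : Function.Injective ι)
    (hd : DenseRange ι) (x y : trajSpace ι hT) {κ μ : ℝ}
    (hκ : ∫ t, k t ∂(timeMeasure T) ≤ κ) (hμ : ‖h.m_memLp.toLp m‖ ≤ μ) :
    ‖x - y‖ ≤ stabConst c L κ μ *
      (‖IccExtend hT.le x.1.2.2 0 - IccExtend hT.le y.1.2.2 0‖ +
        ‖(x.1.2.1 + h.nemytskii x) - (y.1.2.1 + h.nemytskii y)‖) := by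
  have hF : ∀ᵐ t ∂(timeMeasure T),
      ((x.1.2.1 + h.nemytskii x) - (y.1.2.1 + h.nemytskii y)) t
      = (x - y).1.2.1 t + (a t (x.1.1 t) - a t (y.1.1 t)) ∧
      (x - y).1.1 t = x.1.1 t - y.1.1 t := by
    filter_upwards [Lp.coeFn_sub (x.1.2.1 + h.nemytskii x) (y.1.2.1 + h.nemytskii y),
      Lp.coeFn_add x.1.2.1 (h.nemytskii x), Lp.coeFn_add y.1.2.1 (h.nemytskii y),
      Lp.coeFn_sub x.1.2.1 y.1.2.1, Lp.coeFn_sub x.1.1 y.1.1, h.coeFn_nemytskii x,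
      h.coeFn_nemytskii y] with t h1 h2 h3 h4 h5 h6 h7
    constructor
    · rw [h1, Pi.sub_apply, h2, h3, Pi.add_apply, Pi.add_apply, h6, h7]
      change _ = (x.1.2.1 - y.1.2.1) t + _
      rw [h4, Pi.sub_apply]
      abel
    · exact h5
  refine trajSpace_norm_le hι hd (x - y) h.c_pos h.c_le h.k_nonneg h.k_integrable hκ
    (zero_le_one.trans h.le_L) (m := h.m_memLp.toLp m) ?_ hμ ?_ ?_
  · filter_upwards [h.m_memLp.coeFn_toLp] with t ht
    rw [ht]; exact h.m_nonneg t
  · filter_upwards [hF] with t ht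
    have := h.mono t (x.1.1 t) (y.1.1 t)
    rw [ht.1, ht.2, inner_add_left]
    linarith
  · filter_upwards [hF, h.m_memLp.coeFn_toLp] with t ht hm
    have h1 := h.lip t (x.1.1 t) (y.1.1 t)
    have h2 := norm_sub_le ((x - y).1.2.1 t + (a t (x.1.1 t) - a t (y.1.1 t)))
      (a t (x.1.1 t) - a t (y.1.1 t))
    rw [add_sub_cancel_right] at h2
    rw [ht.1, ht.2, hm]
    linarith

omit [CompleteSpace V] [CompleteSpace H] in
/-- Interpolation between the identity and `a`. -/
theorem interp (h : IsParabolicOperator ι T a c L m k) {s : ℝ} (hs : s ∈ Icc (0:ℝ) 1) :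
    IsParabolicOperator ι T (fun t v => (1 - s) • v + s • a t v) c L m k where
  c_pos := h.c_pos
  c_le := h.c_le
  le_L := h.le_L
  aesm v := aestronglyMeasurable_const.add ((h.aesm v).const_smul s)
  zero_memLp := by simpa [Pi.smul_def] using h.zero_memLp.const_smul s
  m_nonneg := h.m_nonneg
  m_memLp := h.m_memLp
  k_nonneg := h.k_nonneg
  k_integrable := h.k_integrable
  lip t v v' := by
    have e : (1 - s) • v + s • a t v - ((1 - s) • v' + s • a t v')
        = (1 - s) • (v - v') + s • (a t v - a t v') := by module
    rw [e]
    have h1 := norm_add_le ((1 - s) • (v - v')) (s • (a t v - a t v'))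
    rw [norm_smul, norm_smul, Real.norm_of_nonneg (by linarith [hs.2]),
      Real.norm_of_nonneg hs.1] at h1
    have h2 := mul_le_mul_of_nonneg_left (h.lip t v v') hs.1
    -- Because 1 ≤ L, and below because c ≤ 1, the identity obeys the bounds required of a. Hence
    -- all interpolants share the same constants.
    have h3 : (1 - s) * ‖v - v'‖ ≤ (1 - s) * (L * ‖v - v'‖) := by
      have := h.le_L
      have : (0:ℝ) ≤ 1 - s := by linarith [hs.2]
      gcongr
      nlinarith [norm_nonneg (v - v')]
    have h4 : s * (m t * ‖ι (v - v')‖) ≤ 1 * (m t * ‖ι (v - v')‖) := by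
      have := h.m_nonneg t
      gcongr
      exact hs.2
    linarith
  mono t v v' := by
    have e : (1 - s) • v + s • a t v - ((1 - s) • v' + s • a t v')
        = (1 - s) • (v - v') + s • (a t v - a t v') := by module
    rw [e, inner_add_left, real_inner_smul_left, real_inner_smul_left, real_inner_self_eq_norm_sq]
    have h2 := mul_le_mul_of_nonneg_left (h.mono t v v') hs.1
    have hs' : (0:ℝ) ≤ 1 - s := by linarith [hs.2]
    have h3 : (1 - s) * (c * ‖v - v'‖ ^ 2) ≤ (1 - s) * (1 * ‖v - v'‖ ^ 2) := by
      have := h.c_le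
      gcongr
    have h4 : s * (k t * ‖ι (v - v')‖ ^ 2) ≤ 1 * (k t * ‖ι (v - v')‖ ^ 2) := by
      have := h.k_nonneg t
      gcongr
      exact hs.2
    linarith

/-- The two interpolants differ by (s' - s)(a - id), so passing from one to the other is a
perturbation with Lipschitz constant proportional to |s' - s|. The part with m is again paired with
the supremum norm of U. -/
theorem nemytskii_interp_diff_le (h : IsParabolicOperator ι T a c L m k) {s s' : ℝ}
    (hs : s ∈ Icc (0:ℝ) 1) (hs' : s' ∈ Icc (0:ℝ) 1) (x y : trajSpace ι hT) :
    ‖((h.interp hs').nemytskii x - (h.interp hs).nemytskii x) -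
      ((h.interp hs').nemytskii y - (h.interp hs).nemytskii y)‖
      ≤ |s' - s| * (1 + L + ‖h.m_memLp.toLp m‖) * ‖x - y‖ := by
  have hL : 0 ≤ 1 + L := by linarith [h.le_L]
  have h1 : ‖((h.interp hs').nemytskii x - (h.interp hs).nemytskii x) -
      ((h.interp hs').nemytskii y - (h.interp hs).nemytskii y)‖
      ≤ ‖(0 : Lp V 2 (timeMeasure T))‖ + (|s' - s| * (1 + L)) * ‖(x - y).1.1‖
        + (|s' - s| * ‖(x - y).1.2.2‖) * ‖h.m_memLp.toLp m‖ := by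
    refine norm_le_of_ae_norm_le (by positivity) (by positivity) ?_
    have hxy : IsTrajectory ι T (x - y).1.1 (x - y).1.2.1 (IccExtend hT.le (x - y).1.2.2) :=
      (x - y).2
    filter_upwards [Lp.coeFn_sub ((h.interp hs').nemytskii x - (h.interp hs).nemytskii x)
        ((h.interp hs').nemytskii y - (h.interp hs).nemytskii y),
      Lp.coeFn_sub ((h.interp hs').nemytskii x) ((h.interp hs).nemytskii x),
      Lp.coeFn_sub ((h.interp hs').nemytskii y) ((h.interp hs).nemytskii y),
      Lp.coeFn_sub x.1.1 y.1.1, (h.interp hs').coeFn_nemytskii x,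
      (h.interp hs).coeFn_nemytskii x, (h.interp hs').coeFn_nemytskii y,
      (h.interp hs).coeFn_nemytskii y, h.m_memLp.coeFn_toLp, hxy.ae_eq,
      Lp.coeFn_zero V 2 (timeMeasure T), ae_restrict_mem measurableSet_Ioo]
      with t h1 h2 h3 h4 h5 h6 h7 h8 h9 h10 h11 h12
    rw [h1, Pi.sub_apply, h2, h3, Pi.sub_apply, Pi.sub_apply, h5, h6, h7, h8, h9, h11]
    have h4' : (x - y).1.1 t = x.1.1 t - y.1.1 t := h4
    have e : (1 - s') • x.1.1 t + s' • a t (x.1.1 t) - ((1 - s) • x.1.1 t + s • a t (x.1.1 t)) -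
        ((1 - s') • y.1.1 t + s' • a t (y.1.1 t) - ((1 - s) • y.1.1 t + s • a t (y.1.1 t)))
        = (s' - s) • ((a t (x.1.1 t) - a t (y.1.1 t)) - (x.1.1 t - y.1.1 t)) := by module
    rw [e, norm_smul, Real.norm_eq_abs, h4']
    have h13 := h.lip t (x.1.1 t) (y.1.1 t)
    have h14 := norm_sub_le (a t (x.1.1 t) - a t (y.1.1 t)) (x.1.1 t - y.1.1 t)
    have h15 : ‖ι (x.1.1 t - y.1.1 t)‖ ≤ ‖(x - y).1.2.2‖ := by
      rw [← h4', ← h10, IccExtend_of_mem _ _ (Ioo_subset_Icc_self h12)]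
      exact ContinuousMap.norm_coe_le_norm _ _
    have h16 := mul_le_mul_of_nonneg_left h15 (h.m_nonneg t)
    have h17 : ‖a t (x.1.1 t) - a t (y.1.1 t) - (x.1.1 t - y.1.1 t)‖
        ≤ (1 + L) * ‖x.1.1 t - y.1.1 t‖ + ‖(x - y).1.2.2‖ * m t := by linarith
    have h18 := mul_le_mul_of_nonneg_left h17 (abs_nonneg (s' - s))
    simp only [Pi.zero_apply, norm_zero, zero_add]
    linarith
  have h2 : ‖(x - y).1.1‖ ≤ ‖x - y‖ := le_max_left _ _
  have h3 : ‖(x - y).1.2.2‖ ≤ ‖x - y‖ := (le_max_right _ _).trans (le_max_right _ _)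
  refine h1.trans ?_
  rw [norm_zero, zero_add]
  calc _ ≤ |s' - s| * (1 + L) * ‖x - y‖ + |s' - s| * ‖x - y‖ * ‖h.m_memLp.toLp m‖ := by gcongr
    _ = _ := by ring

/-- Method of continuity: the problem is solvable at s = 0 by `heatOp_surjective`, and solvability
passes from i/n to (i+1)/n by the contraction argument, with n fixed in advance because the inverse
bound does not depend on s. -/
theorem exists_solution (h : IsParabolicOperator ι T a c L m k) (hι : Function.Injective ι)
    (hd : DenseRange ι) (hT : 0 < T) (u₀ : H) :
    ∃ x : trajSpace ι hT, x.1.2.1 + h.nemytskii x = 0 ∧ IccExtend hT.le x.1.2.2 0 = u₀ := by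
  set κ := ∫ t, k t ∂(timeMeasure T)
  set μ := ‖h.m_memLp.toLp m‖
  set K := stabConst c L κ μ
  have hc := h.c_pos
  have hL := h.le_L
  have hK : 0 < K := by simp only [K, stabConst]; positivity
  set l := 1 + L + μ
  have hl : 0 < l := by positivity
  let G : ∀ s : ℝ, s ∈ Icc (0:ℝ) 1 → trajSpace ι hT → Lp V 2 (timeMeasure T) × H := fun s hs x =>
    (x.1.2.1 + (h.interp hs).nemytskii x, IccExtend hT.le x.1.2.2 0)
  -- The factor 2 arises because `dist_le` has the sum of the two components of G, while the product
  -- carries the maximum norm.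
  have hGK : ∀ s hs x y, ‖x - y‖ ≤ (2 * K) * ‖G s hs x - G s hs y‖ := by
    intro s hs x y
    have h1 := (h.interp hs).dist_le hι hd x y (κ := κ) (μ := μ) le_rfl le_rfl
    have h2 : ‖(G s hs x - G s hs y).1‖ ≤ ‖G s hs x - G s hs y‖ := le_max_left _ _
    have h3 : ‖(G s hs x - G s hs y).2‖ ≤ ‖G s hs x - G s hs y‖ := le_max_right _ _
    refine h1.trans ?_
    rw [mul_comm 2 K, mul_assoc, two_mul]
    exact mul_le_mul_of_nonneg_left (add_le_add h3 h2) hK.le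
  -- The contraction factor of one step of length 1/n is 2Kl/n.
  obtain ⟨n, hn⟩ := exists_nat_gt (2 * K * l)
  have hn0 : (0:ℝ) < n := lt_trans (by positivity) hn
  have hmem : ∀ i : ℕ, i ≤ n → (i / n : ℝ) ∈ Icc (0:ℝ) 1 := fun i hi =>
    ⟨by positivity, (div_le_one hn0).2 (by exact_mod_cast hi)⟩
  have key : ∀ i : ℕ, ∀ hi : i ≤ n, Function.Surjective (G (i / n) (hmem i hi)) := by
    intro i
    induction i with
    | zero =>
      intro hi y
      obtain ⟨x, hx⟩ := heatOp_surjective (hT := hT) hι hd (WithLp.toLp 2 y)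
      have hx1 : x.1.2.1 + x.1.1 = y.1 := by rw [← heatOp_fst, hx]; rfl
      have hx2 : IccExtend hT.le x.1.2.2 0 = y.2 := by rw [← heatOp_snd, hx]; rfl
      refine ⟨x, Prod.ext ?_ hx2⟩
      change x.1.2.1 + (h.interp (hmem 0 hi)).nemytskii x = y.1
      rw [← hx1]
      congr 1
      refine Lp.ext ?_
      filter_upwards [(h.interp (hmem 0 hi)).coeFn_nemytskii x] with t ht
      rw [ht]; simp
    | succ i ih =>
      intro hi
      have hi' : i ≤ n := by omega
      have hs := hmem i hi'
      have hs' := hmem (i + 1) hi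
      have hdiff : |((i + 1 : ℕ) / n : ℝ) - i / n| = 1 / n := by
        push_cast
        rw [← sub_div, add_sub_cancel_left, abs_of_pos (by positivity)]
      have h1 := surjective_add_of_antilipschitz (G := G (i / n) hs)
        (E := fun x => ((h.interp hs').nemytskii x - (h.interp hs).nemytskii x, 0))
        (K := 2 * K) (l := 1 / n * l) (by positivity) (by positivity)
        (by
          rw [show 2 * K * (1 / n * l) = 2 * K * l / n by ring]
          exact (div_lt_one hn0).2 hn) (ih hi') (hGK _ hs) (fun x y => by
          have := h.nemytskii_interp_diff_le hs hs' x y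
          rw [hdiff] at this
          rw [Prod.mk_sub_mk, sub_zero, Prod.norm_mk, norm_zero,
            max_eq_left (norm_nonneg _)]
          exact this)
      convert h1 using 1
      ext x : 1
      refine Prod.ext ?_ ?_
      · simp only [G, Prod.fst_add]; abel
      · simp only [G, Prod.snd_add, add_zero]
  obtain ⟨x, hx⟩ := key n le_rfl (0, u₀)
  refine ⟨x, ?_, congrArg Prod.snd hx⟩
  have h1 : x.1.2.1 + (h.interp (hmem n le_rfl)).nemytskii x = 0 := congrArg Prod.fst hx
  rw [← h1]
  congr 1
  refine Lp.ext ?_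
  filter_upwards [(h.interp (hmem n le_rfl)).coeFn_nemytskii x, h.coeFn_nemytskii x] with t ht ht'
  rw [ht, ht', div_self hn0.ne']; simp

end IsParabolicOperator

end Nonlinear

/-! ## Measurability in separable Hilbert spaces -/

/-- Pettis' theorem in a separable Hilbert space. The preimage of a closed ball is a countable
intersection of conditions on ⟨g,e⟩ with e in a dense sequence, and an open set is a countable union
of closed balls. -/
theorem stronglyMeasurable_of_inner {Ω E : Type*} [MeasurableSpace Ω] [NormedAddCommGroup E]
    [InnerProductSpace ℝ E] [SecondCountableTopology E] {g : Ω → E}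
    (hg : ∀ e, Measurable fun t => (inner ℝ (g t) e : ℝ)) : StronglyMeasurable g := by
  borelize E
  have hball : ∀ (c : E) (r : ℝ), 0 ≤ r → MeasurableSet (g ⁻¹' Metric.closedBall c r) := by
    intro c r hr
    have : g ⁻¹' Metric.closedBall c r = ⋂ n, {t | inner ℝ (g t) (TopologicalSpace.denseSeq E n)
        - inner ℝ c (TopologicalSpace.denseSeq E n) ≤ r * ‖TopologicalSpace.denseSeq E n‖} := by
      ext t
      simp only [mem_preimage, mem_closedBall_iff_norm, mem_iInter, mem_ofPred_eq,
        ← inner_sub_left]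
      constructor
      · intro h n
        exact (real_inner_le_norm _ _).trans (by gcongr)
      · intro h
        have h2 : ∀ y : E, inner ℝ (g t - c) y ≤ r * ‖y‖ := by
          intro y
          refine (TopologicalSpace.denseRange_denseSeq E).induction_on
            (p := fun y => inner ℝ (g t - c) y ≤ r * ‖y‖) y ?_ h
          exact isClosed_le (by fun_prop) (by fun_prop)
        have h3 := h2 (g t - c)
        rw [real_inner_self_eq_norm_sq] at h3
        by_contra hlt
        push Not at hlt
        nlinarith [norm_nonneg (g t - c)]
    rw [this]
    refine MeasurableSet.iInter fun n => measurableSet_le ?_ measurable_const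
    exact (hg _).sub measurable_const
  refine Measurable.stronglyMeasurable (measurable_of_isOpen fun O hO => ?_)
  have : O = ⋃ (n : ℕ) (q : ℚ) (_ : 0 < q ∧
      Metric.closedBall (TopologicalSpace.denseSeq E n) q ⊆ O),
      Metric.closedBall (TopologicalSpace.denseSeq E n) (q : ℝ) := by
    apply subset_antisymm
    · intro x hx
      obtain ⟨ε, hε, hεO⟩ := Metric.isOpen_iff.1 hO x hx
      obtain ⟨q, hq0, hq⟩ := exists_rat_btwn (show (0:ℝ) < ε / 2 by positivity)
      obtain ⟨_, hn, n, rfl⟩ := Metric.dense_iff.1 (TopologicalSpace.denseRange_denseSeq E) x q hq0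
      simp only [mem_iUnion]
      refine ⟨n, q, ⟨by exact_mod_cast hq0, fun y hy => hεO ?_⟩, ?_⟩
      · rw [Metric.mem_ball] at hn ⊢
        rw [Metric.mem_closedBall] at hy
        have := dist_triangle y (TopologicalSpace.denseSeq E n) x
        linarith
      · rw [Metric.mem_closedBall, dist_comm]
        exact (Metric.mem_ball.1 hn).le
    · simp only [iUnion_subset_iff]
      exact fun n q h => h.2
  rw [this, preimage_iUnion]
  simp only [preimage_iUnion]
  exact MeasurableSet.iUnion fun n => MeasurableSet.iUnion fun q => MeasurableSet.iUnion fun h =>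
    hball _ _ (by exact_mod_cast h.1.le)

instance fact_two_ne_top : Fact ((2 : ℝ≥0∞) ≠ ⊤) := ⟨by norm_num⟩

/-! ## Nemytskii operators on `L²` -/

section Nemytskii

variable {X : Type*} [MeasurableSpace X] {μ : Measure X}

theorem memLp_mul_comp [IsFiniteMeasure μ] {c : X → ℝ} {h : ℝ → ℝ} {C : ℝ} {K : ℝ≥0}
    (hc : Measurable c) (hC : ∀ x, |c x| ≤ C) (hh : LipschitzWith K h) (v : Lp ℝ 2 μ) :
    MemLp (fun x => c x * h (v x)) 2 μ := by
  have h1 : MemLp (fun x => |h 0| + K * ‖v x‖) 2 μ :=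
    (memLp_const |h 0|).add ((Lp.memLp v).norm.const_mul (K : ℝ))
  have h2 : MemLp (fun x => h (v x)) 2 μ := by
    refine h1.mono (hh.continuous.comp_aestronglyMeasurable (Lp.aestronglyMeasurable v))
      (Eventually.of_forall fun x => ?_)
    have := hh.dist_le_mul (v x) 0
    rw [Real.dist_eq, dist_zero_right] at this
    refine le_trans ?_ (le_abs_self _)
    have h3 := abs_sub_abs_le_abs_sub (h (v x)) (h 0)
    rw [Real.norm_eq_abs]
    linarith
  refine (h2.const_mul C).mono (hc.aestronglyMeasurable.mul h2.1) (Eventually.of_forall fun x => ?_)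
  rw [norm_mul, norm_mul, Real.norm_eq_abs, Real.norm_eq_abs C]
  exact mul_le_mul_of_nonneg_right ((hC x).trans (le_abs_self _)) (norm_nonneg _)

open Classical in
/-- The function `x ↦ c(x) h(v(x))` as an element of `L²`. -/
def mulComp (μ : Measure X) (c : X → ℝ) (h : ℝ → ℝ) (v : Lp ℝ 2 μ) : Lp ℝ 2 μ :=
  if hm : MemLp (fun x => c x * h (v x)) 2 μ then hm.toLp _ else 0

/-- `c` is a measurable function bounded by `C` in absolute value. -/
structure IsBddCoeff (c : X → ℝ) (C : ℝ) : Prop where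
  meas : Measurable c
  le : ∀ x, |c x| ≤ C

variable [IsFiniteMeasure μ] {c c' : X → ℝ} {h : ℝ → ℝ} {C : ℝ} {K : ℝ≥0}

theorem coeFn_mulComp (hc : IsBddCoeff c C) (hh : LipschitzWith K h) (v : Lp ℝ 2 μ) :
    mulComp μ c h v =ᵐ[μ] fun x => c x * h (v x) := by
  have := memLp_mul_comp hc.meas hc.le hh v
  rw [mulComp, dif_pos this]
  exact this.coeFn_toLp

theorem inner_mulComp (hc : IsBddCoeff c C) (hh : LipschitzWith K h) (v w : Lp ℝ 2 μ) :
    inner ℝ (mulComp μ c h v) w = ∫ x, c x * h (v x) * w x ∂μ := by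
  rw [L2.inner_def]
  refine integral_congr_ae ?_
  filter_upwards [coeFn_mulComp hc hh v] with x hx
  rw [hx]; simp [mul_comm]

theorem norm_mulComp_sub_le (hc : IsBddCoeff c C) (hh : LipschitzWith K h) (v v' : Lp ℝ 2 μ) :
    ‖mulComp μ c h v - mulComp μ c h v'‖ ≤ C * K * ‖v - v'‖ := by
  refine Lp.norm_le_mul_norm_of_ae_le_mul ?_
  filter_upwards [coeFn_mulComp hc hh v, coeFn_mulComp hc hh v',
    Lp.coeFn_sub (mulComp μ c h v) (mulComp μ c h v'), Lp.coeFn_sub v v'] with x h1 h2 h3 h4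
  rw [h3, h4, Pi.sub_apply, Pi.sub_apply, h1, h2, ← mul_sub, norm_mul, mul_assoc]
  have h5 := hh.dist_le_mul (v x) (v' x)
  rw [dist_eq_norm, dist_eq_norm] at h5
  have h6 : ‖c x‖ ≤ C := hc.le x
  have : 0 ≤ C := (norm_nonneg _).trans h6
  gcongr

theorem norm_le_of_ae_bound_sqrt {F : Type*} [NormedAddCommGroup F] {w : Lp F 2 μ} {B : ℝ}
    (hB : 0 ≤ B) (h : ∀ᵐ x ∂μ, ‖w x‖ ≤ B) : ‖w‖ ≤ √(μ.real univ) * B := by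
  have := Lp.norm_le_of_ae_bound (f := w) hB h
  rw [Real.sqrt_eq_rpow]
  simpa [measureReal_def, measureUnivNNReal, ENNReal.coe_toNNReal_eq_toReal] using this

theorem norm_mulComp_diff_le (hc : IsBddCoeff c C) (hc' : IsBddCoeff c' C)
    (hh : LipschitzWith K h) {B δ : ℝ} (hB : ∀ s, |h s| ≤ B) (hδ : 0 ≤ δ)
    (hcc : ∀ᵐ x ∂μ, |c x - c' x| ≤ δ) (v : Lp ℝ 2 μ) :
    ‖mulComp μ c h v - mulComp μ c' h v‖ ≤ √(μ.real univ) * (δ * B) := by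
  refine norm_le_of_ae_bound_sqrt (mul_nonneg hδ ((abs_nonneg _).trans (hB 0))) ?_
  filter_upwards [coeFn_mulComp hc hh v, coeFn_mulComp hc' hh v,
    Lp.coeFn_sub (mulComp μ c h v) (mulComp μ c' h v), hcc] with x h1 h2 h3 h4
  rw [h3, Pi.sub_apply, h1, h2, ← sub_mul, norm_mul]
  exact mul_le_mul h4 (hB _) (norm_nonneg _) hδ

/-- The identity is not bounded, so perturbing a linear coefficient costs ‖v‖. This is why the
stability estimate needs an a priori bound on one of the solutions. -/
theorem norm_mulComp_id_diff_le (hc : IsBddCoeff c C) (hc' : IsBddCoeff c' C)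
    {δ : ℝ} (hcc : ∀ᵐ x ∂μ, |c x - c' x| ≤ δ) (v : Lp ℝ 2 μ) :
    ‖mulComp μ c id v - mulComp μ c' id v‖ ≤ δ * ‖v‖ := by
  refine Lp.norm_le_mul_norm_of_ae_le_mul ?_
  filter_upwards [coeFn_mulComp hc LipschitzWith.id v, coeFn_mulComp hc' LipschitzWith.id v,
    Lp.coeFn_sub (mulComp μ c id v) (mulComp μ c' id v), hcc] with x h1 h2 h3 h4
  rw [h3, Pi.sub_apply, h1, h2, ← sub_mul, norm_mul]
  exact mul_le_mul_of_nonneg_right h4 (norm_nonneg _)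

theorem inner_mulComp_sub_nonneg (hc : IsBddCoeff c C) (hh : LipschitzWith K h)
    (hc0 : ∀ x, 0 ≤ c x) (hm : Monotone h) (v v' : Lp ℝ 2 μ) :
    0 ≤ (inner ℝ (mulComp μ c h v - mulComp μ c h v') (v - v') : ℝ) := by
  rw [L2.inner_def]
  refine integral_nonneg_of_ae ?_
  filter_upwards [coeFn_mulComp hc hh v, coeFn_mulComp hc hh v',
    Lp.coeFn_sub (mulComp μ c h v) (mulComp μ c h v'), Lp.coeFn_sub v v'] with x h1 h2 h3 h4
  rw [h3, h4, Pi.sub_apply, Pi.sub_apply, h1, h2, ← mul_sub]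
  simp only [Pi.zero_apply, RCLike.inner_apply, conj_trivial]
  rcases le_total (v x) (v' x) with hv | hv
  · have := hm hv
    exact mul_nonneg_of_nonpos_of_nonpos (by linarith)
      (mul_nonpos_of_nonneg_of_nonpos (hc0 x) (by linarith))
  · have := hm hv
    exact mul_nonneg (by linarith) (mul_nonneg (hc0 x) (by linarith))

theorem inner_mulComp_sub_nonpos (hc : IsBddCoeff c C) (hh : LipschitzWith K h)
    (hc0 : ∀ x, 0 ≤ c x) (hm : Antitone h) (v v' : Lp ℝ 2 μ) :
    (inner ℝ (mulComp μ c h v - mulComp μ c h v') (v - v') : ℝ) ≤ 0 := by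
  rw [L2.inner_def]
  refine integral_nonpos_of_ae ?_
  filter_upwards [coeFn_mulComp hc hh v, coeFn_mulComp hc hh v',
    Lp.coeFn_sub (mulComp μ c h v) (mulComp μ c h v'), Lp.coeFn_sub v v'] with x h1 h2 h3 h4
  rw [h3, h4, Pi.sub_apply, Pi.sub_apply, h1, h2, ← mul_sub]
  simp only [Pi.zero_apply, RCLike.inner_apply, conj_trivial]
  rcases le_total (v x) (v' x) with hv | hv
  · have := hm hv
    exact mul_nonpos_of_nonpos_of_nonneg (by linarith) (mul_nonneg (hc0 x) (by linarith))
  · have := hm hv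
    exact mul_nonpos_of_nonneg_of_nonpos (by linarith)
      (mul_nonpos_of_nonneg_of_nonpos (hc0 x) (by linarith))

/-- Pairings with a fixed function are measurable in t by Fubini; Pettis' theorem does the rest in
the separable space L². -/
theorem stronglyMeasurable_mulComp {Ω : Type*} [MeasurableSpace Ω] [IsSeparable μ]
    {c : Ω × X → ℝ} (hc : IsBddCoeff c C) (hh : LipschitzWith K h) (v : Lp ℝ 2 μ) :
    StronglyMeasurable fun t => mulComp μ (fun x => c (t, x)) h v := by
  refine stronglyMeasurable_of_inner fun w => ?_
  have h1 : ∀ t, IsBddCoeff (fun x => c (t, x)) C := fun t =>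
    ⟨hc.meas.comp measurable_prodMk_left, fun x => hc.le _⟩
  simp only [inner_mulComp (h1 _) hh]
  refine StronglyMeasurable.measurable (StronglyMeasurable.integral_prod_right'
    (f := fun z : Ω × X => c z * h (v z.2) * w z.2) ?_)
  refine Measurable.stronglyMeasurable ?_
  have hv := (Lp.stronglyMeasurable v).measurable
  have hw := (Lp.stronglyMeasurable w).measurable
  exact (hc.meas.mul (hh.continuous.measurable.comp (hv.comp measurable_snd))).mul
    (hw.comp measurable_snd)

variable {E : Type*} [NormedAddCommGroup E] [NormedSpace ℝ E]

/-- The function `f(v) W` for a Lipschitz function `f` vanishing at zero. -/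
def fluxTerm {f : ℝ → ℝ} (hf : LipschitzWith K f) (hf0 : f 0 = 0) (v : Lp ℝ 2 μ) (W : Lp E ∞ μ) :
    Lp E 2 μ := (hf.compLp hf0 v) • W

variable {f : ℝ → ℝ} (hf : LipschitzWith K f) (hf0 : f 0 = 0)

omit [IsFiniteMeasure μ] in
theorem coeFn_fluxTerm (v : Lp ℝ 2 μ) (W : Lp E ∞ μ) :
    fluxTerm hf hf0 v W =ᵐ[μ] fun x => f (v x) • W x := by
  filter_upwards [Lp.coeFn_lpSMul (r := 2) (hf.compLp hf0 v) W, hf.coeFn_compLp hf0 v] with x h1 h2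
  rw [fluxTerm, h1, Pi.smul_apply', h2]; rfl

omit [IsFiniteMeasure μ] in
theorem norm_fluxTerm_sub_le (v v' : Lp ℝ 2 μ) (W : Lp E ∞ μ) :
    ‖fluxTerm hf hf0 v W - fluxTerm hf hf0 v' W‖ ≤ K * ‖W‖ * ‖v - v'‖ := by
  have h : fluxTerm hf hf0 v W - fluxTerm hf hf0 v' W
      = (hf.compLp hf0 v - hf.compLp hf0 v') • W := by
    rw [fluxTerm, fluxTerm, sub_eq_add_neg (hf.compLp hf0 v), Lp.smul_add, Lp.neg_smul,
      sub_eq_add_neg]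
  rw [h]
  refine (Lp.norm_smul_le _ _).trans ?_
  have := hf.norm_compLp_sub_le hf0 v v'
  rw [mul_right_comm]
  gcongr

theorem norm_fluxTerm_diff_le {B : ℝ} (hB : ∀ s, |f s| ≤ B) (v : Lp ℝ 2 μ) (W W' : Lp E ∞ μ) :
    ‖fluxTerm hf hf0 v W - fluxTerm hf hf0 v W'‖ ≤ √(μ.real univ) * B * ‖W - W'‖ := by
  have h : fluxTerm hf hf0 v W - fluxTerm hf hf0 v W' = hf.compLp hf0 v • (W - W') := by
    rw [fluxTerm, fluxTerm, sub_eq_add_neg W, Lp.add_smul, Lp.smul_neg, sub_eq_add_neg]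
  rw [h]
  refine (Lp.norm_smul_le _ _).trans ?_
  gcongr
  refine norm_le_of_ae_bound_sqrt ((abs_nonneg _).trans (hB 0)) ?_
  filter_upwards [hf.coeFn_compLp hf0 v] with x hx
  rw [hx]; exact hB _

theorem continuous_fluxTerm {B : ℝ} (hB : ∀ s, |f s| ≤ B) (v : Lp ℝ 2 μ) :
    Continuous fun W : Lp E ∞ μ => fluxTerm hf hf0 v W := by
  have hB0 : 0 ≤ B := (abs_nonneg _).trans (hB 0)
  have : LipschitzWith (√(μ.real univ) * B).toNNReal fun W : Lp E ∞ μ => fluxTerm hf hf0 v W := by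
    refine LipschitzWith.of_dist_le_mul fun W W' => ?_
    rw [dist_eq_norm, dist_eq_norm, Real.coe_toNNReal _ (by positivity)]
    exact norm_fluxTerm_diff_le hf hf0 hB v W W'
  exact this.continuous

omit [IsFiniteMeasure μ] in
theorem fluxTerm_zero_left (W : Lp E ∞ μ) : fluxTerm hf hf0 0 W = 0 := by
  refine Lp.ext ?_
  filter_upwards [coeFn_fluxTerm hf hf0 0 W, Lp.coeFn_zero E 2 μ, Lp.coeFn_zero ℝ 2 μ]
    with x h1 h2 h3
  rw [h1, h2, h3]; simp [hf0]

end Nemytskii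

/-! ## Reaction-diffusion operators -/

section ReactionDiffusion

open ContinuousLinearMap (adjoint)

variable {X Y E V : Type*} [MeasurableSpace X] [MeasurableSpace Y]
  {μ : Measure X} {σ : Measure Y} [IsFiniteMeasure μ] [IsFiniteMeasure σ]
  [NormedAddCommGroup E] [InnerProductSpace ℝ E] [CompleteSpace E]
  [NormedAddCommGroup V] [InnerProductSpace ℝ V] [CompleteSpace V]

/-- Coefficients of a reaction-diffusion equation: reaction terms in the interior and on the
boundary, and the gradient of the potential. -/
structure CoeffData (X Y E : Type*) [MeasurableSpace X] [MeasurableSpace Y]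
    [NormedAddCommGroup E] (μ : Measure X) (T : ℝ) where
  β : ℝ × X → ℝ
  α : ℝ × X → ℝ
  b : ℝ × Y → ℝ
  a : ℝ × Y → ℝ
  W : Lp (Lp E ∞ μ) 2 (timeMeasure T)

/-- Uniform bounds and signs of the coefficients. -/
structure CoeffData.IsBounded {T : ℝ} (d : CoeffData X Y E μ T) (M M' : ℝ) : Prop where
  β_bdd : IsBddCoeff d.β M
  α_bdd : IsBddCoeff d.α M
  b_bdd : IsBddCoeff d.b M
  a_bdd : IsBddCoeff d.a M
  β_nonneg : ∀ z, 0 ≤ d.β z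
  b_nonneg : ∀ z, 0 ≤ d.b z
  a_nonneg : ∀ z, 0 ≤ d.a z
  W_le : ‖d.W‖ ≤ M'

theorem IsBddCoeff.section {c : ℝ × X → ℝ} {M : ℝ} (h : IsBddCoeff c M) (t : ℝ) :
    IsBddCoeff (fun x => c (t, x)) M :=
  ⟨h.meas.comp measurable_prodMk_left, fun _ => h.le _⟩

variable (ι : V →L[ℝ] Lp ℝ 2 μ) (G : V →L[ℝ] Lp E 2 μ) (γ : V →L[ℝ] Lp ℝ 2 σ)
  {f g : ℝ → ℝ} {Kf Kg : ℝ≥0} (hf : LipschitzWith Kf f) (hf0 : f 0 = 0) {T : ℝ}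

/-- The spatial operator of the equation, where `V` is identified with its dual. -/
def reactionOp (g : ℝ → ℝ) (d : CoeffData X Y E μ T) (t : ℝ) (v : V) : V :=
  -- When ⟨v,z⟩ = ⟨ιv,ιz⟩ + ⟨Gv,Gz⟩, the vector v - ι†ιv represents the Dirichlet form ⟨Gv,Gz⟩.
  v - adjoint ι (ι v) - adjoint G (fluxTerm hf hf0 (ι v) (d.W t))
    + adjoint ι (mulComp μ (fun x => d.β (t, x)) id (ι v))
    - adjoint ι (mulComp μ (fun x => d.α (t, x)) f (ι v))
    + adjoint γ (mulComp σ (fun x => d.b (t, x)) id (γ v))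
    - adjoint γ (mulComp σ (fun x => d.a (t, x)) g (γ v))

theorem norm_adjoint_apply_le {H : Type*} [NormedAddCommGroup H] [InnerProductSpace ℝ H]
    [CompleteSpace H] (A : V →L[ℝ] H) (x : H) : ‖adjoint A x‖ ≤ ‖A‖ * ‖x‖ := by
  have := (adjoint A).le_opNorm x
  rwa [LinearIsometryEquiv.norm_map] at this

theorem norm_adjoint_apply_le_of_le_one {H : Type*} [NormedAddCommGroup H] [InnerProductSpace ℝ H]
    [CompleteSpace H] {A : V →L[ℝ] H} (hA : ∀ v, ‖A v‖ ≤ ‖v‖) (x : H) : ‖adjoint A x‖ ≤ ‖x‖ := by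
  have h1 : ‖A‖ ≤ 1 := A.opNorm_le_bound zero_le_one (by simpa using hA)
  refine (norm_adjoint_apply_le A x).trans ?_
  nlinarith [norm_nonneg x]

omit [IsFiniteMeasure μ] [IsFiniteMeasure σ] in
theorem reactionOp_sub (g : ℝ → ℝ) (d : CoeffData X Y E μ T) (t : ℝ) (v v' : V) :
    reactionOp ι G γ hf hf0 g d t v - reactionOp ι G γ hf hf0 g d t v' =
      (v - v') - adjoint ι (ι (v - v'))
      - adjoint G (fluxTerm hf hf0 (ι v) (d.W t) - fluxTerm hf hf0 (ι v') (d.W t))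
      + adjoint ι (mulComp μ (fun x => d.β (t, x)) id (ι v)
          - mulComp μ (fun x => d.β (t, x)) id (ι v'))
      - adjoint ι (mulComp μ (fun x => d.α (t, x)) f (ι v)
          - mulComp μ (fun x => d.α (t, x)) f (ι v'))
      + adjoint γ (mulComp σ (fun x => d.b (t, x)) id (γ v)
          - mulComp σ (fun x => d.b (t, x)) id (γ v'))
      - adjoint γ (mulComp σ (fun x => d.a (t, x)) g (γ v)
          - mulComp σ (fun x => d.a (t, x)) g (γ v')) := by
  simp only [reactionOp, map_sub]
  abel

theorem mulComp_zero {c : X → ℝ} {h : ℝ → ℝ} {C : ℝ} {K : ℝ≥0} (hc : IsBddCoeff c C)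
    (hh : LipschitzWith K h) (h0 : h 0 = 0) : mulComp μ c h 0 = 0 := by
  refine Lp.ext ?_
  filter_upwards [coeFn_mulComp hc hh 0, Lp.coeFn_zero ℝ 2 μ] with x h1 h2
  rw [h1, h2]; simp [h0]

theorem norm_mulComp_le {c : X → ℝ} {h : ℝ → ℝ} {C B : ℝ} {K : ℝ≥0} (hc : IsBddCoeff c C)
    (hC : 0 ≤ C) (hh : LipschitzWith K h) (hB : ∀ s, |h s| ≤ B) (v : Lp ℝ 2 μ) :
    ‖mulComp μ c h v‖ ≤ √(μ.real univ) * (C * B) := by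
  refine norm_le_of_ae_bound_sqrt (mul_nonneg hC ((abs_nonneg _).trans (hB 0))) ?_
  filter_upwards [coeFn_mulComp hc hh v] with x h1
  rw [h1, norm_mul]
  exact mul_le_mul (hc.le x) (hB _) (norm_nonneg _) hC

/-- The Lipschitz constant of `reactionOp` with respect to the norm of `V`. -/
def reactionLip (γ : V →L[ℝ] Lp ℝ 2 σ) (M : ℝ) (Kg : ℝ≥0) : ℝ := 1 + ‖γ‖ * (M * (1 + Kg)) * ‖γ‖

/-- The Lipschitz constant of the lower order terms of `reactionOp`. -/
def reactionLow (M : ℝ) (Kf : ℝ≥0) (d : CoeffData X Y E μ T) (t : ℝ) : ℝ :=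
  (1 + M + M * Kf) + Kf * ‖d.W t‖

/-- The constant in the lower bound for `reactionOp`. -/
def reactionDef (M : ℝ) (Kf : ℝ≥0) (d : CoeffData X Y E μ T) (t : ℝ) : ℝ :=
  (1 + M * Kf) + Kf ^ 2 / 2 * ‖d.W t‖ ^ 2

variable {ι G γ} {d : CoeffData X Y E μ T} {M M' : ℝ}

/-- The boundary terms are controlled only by the full norm of V and go into `reactionLip`; apart
from v itself, the other terms depend on v through ιv alone and go into `reactionLow`. -/
theorem norm_reactionOp_sub_le (hι : ∀ v, ‖ι v‖ ≤ ‖v‖) (hG : ∀ v, ‖G v‖ ≤ ‖v‖)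
    (hg : LipschitzWith Kg g) (hM : 0 ≤ M) (hd : d.IsBounded M M') (t : ℝ) (v v' : V) :
    ‖reactionOp ι G γ hf hf0 g d t v - reactionOp ι G γ hf hf0 g d t v'‖ ≤
      reactionLip γ M Kg * ‖v - v'‖ + reactionLow M Kf d t * ‖ι (v - v')‖ := by
  rw [reactionOp_sub]
  have h1 := norm_adjoint_apply_le_of_le_one hι (ι (v - v'))
  have h2 := (norm_adjoint_apply_le_of_le_one hG _).trans
    (norm_fluxTerm_sub_le hf hf0 (ι v) (ι v') (d.W t))
  have h3 := (norm_adjoint_apply_le_of_le_one hι _).trans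
    (norm_mulComp_sub_le (hd.β_bdd.section t) LipschitzWith.id (ι v) (ι v'))
  have h4 := (norm_adjoint_apply_le_of_le_one hι _).trans
    (norm_mulComp_sub_le (hd.α_bdd.section t) hf (ι v) (ι v'))
  have h5 := (norm_adjoint_apply_le γ _).trans (mul_le_mul_of_nonneg_left
    (norm_mulComp_sub_le (hd.b_bdd.section t) LipschitzWith.id (γ v) (γ v')) (norm_nonneg γ))
  have h6 := (norm_adjoint_apply_le γ _).trans (mul_le_mul_of_nonneg_left
    (norm_mulComp_sub_le (hd.a_bdd.section t) hg (γ v) (γ v')) (norm_nonneg γ))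
  rw [← map_sub] at h2 h3 h4 h5 h6
  have h7 := γ.le_opNorm (v - v')
  have h8 : ‖γ‖ * (M * (1 + Kg) * ‖γ (v - v')‖) ≤ ‖γ‖ * (M * (1 + Kg) * (‖γ‖ * ‖v - v'‖)) := by
    gcongr
  simp only [NNReal.coe_one, mul_one] at h3 h5
  refine (norm_sub_le _ _).trans ?_
  refine (add_le_add_left (norm_add_le _ _) _).trans ?_
  refine (add_le_add_left (add_le_add_left (norm_sub_le _ _) _) _).trans ?_
  refine (add_le_add_left (add_le_add_left (add_le_add_left (norm_add_le _ _) _) _) _).trans ?_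
  refine (add_le_add_left (add_le_add_left (add_le_add_left (add_le_add_left
    (norm_sub_le _ _) _) _) _) _).trans ?_
  refine (add_le_add_left (add_le_add_left (add_le_add_left (add_le_add_left (add_le_add_left
    (norm_sub_le _ _) _) _) _) _) _).trans ?_
  simp only [reactionLip, reactionLow]
  linarith

/-- The β and b terms are monotone, and the inflow term contributes with a good sign because g is
antitone; all of these are dropped, so no trace inequality enters. What is left is -‖ι(v - v')‖²
from the Dirichlet form, the Lipschitz bound for αf, and the flux. -/
theorem reactionOp_mono (hG : ∀ v, ‖G v‖ ≤ ‖v‖)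
    (hg : LipschitzWith Kg g) (hga : Antitone g) (hd : d.IsBounded M M') (t : ℝ) (v v' : V) :
    1 / 2 * ‖v - v'‖ ^ 2 - reactionDef M Kf d t * ‖ι (v - v')‖ ^ 2 ≤
      inner ℝ (reactionOp ι G γ hf hf0 g d t v - reactionOp ι G γ hf hf0 g d t v') (v - v') := by
  rw [reactionOp_sub]
  simp only [inner_sub_left, inner_add_left, ContinuousLinearMap.adjoint_inner_left]
  simp only [← inner_sub_left]
  have h2 := (real_inner_le_norm _ (G (v - v'))).trans (mul_le_mul
    (norm_fluxTerm_sub_le hf hf0 (ι v) (ι v') (d.W t)) (hG (v - v')) (norm_nonneg _)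
    (by positivity))
  have h3 := inner_mulComp_sub_nonneg (hd.β_bdd.section t) LipschitzWith.id
    (fun x => hd.β_nonneg _) monotone_id (ι v) (ι v')
  have h4 := (real_inner_le_norm _ (ι (v - v'))).trans (mul_le_mul_of_nonneg_right
    (norm_mulComp_sub_le (hd.α_bdd.section t) hf (ι v) (ι v')) (norm_nonneg _))
  have h5 := inner_mulComp_sub_nonneg (hd.b_bdd.section t) LipschitzWith.id
    (fun x => hd.b_nonneg _) monotone_id (γ v) (γ v')
  have h6 := inner_mulComp_sub_nonpos (hd.a_bdd.section t) hg
    (fun x => hd.a_nonneg _) hga (γ v) (γ v')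
  rw [← map_sub] at h2 h3 h4 h5 h6
  rw [real_inner_self_eq_norm_sq, real_inner_self_eq_norm_sq]
  simp only [reactionDef]
  set X := ‖ι (v - v')‖
  set Z := ‖v - v'‖
  -- Young's inequality: the flux takes half of the unit coercivity, which leaves c = 1/2.
  have h7 : Kf * ‖d.W t‖ * X * Z ≤ 1 / 2 * Z ^ 2 + Kf ^ 2 / 2 * ‖d.W t‖ ^ 2 * X ^ 2 := by
    nlinarith [sq_nonneg (Kf * ‖d.W t‖ * X - Z)]
  linarith

theorem reactionOp_aestronglyMeasurable [IsSeparable μ] [IsSeparable σ] {Bf : ℝ}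
    (hBf : ∀ s, |f s| ≤ Bf) (hg : LipschitzWith Kg g) (hd : d.IsBounded M M') (v : V) :
    AEStronglyMeasurable (fun t => reactionOp ι G γ hf hf0 g d t v) (timeMeasure T) := by
  have h1 := (continuous_fluxTerm hf hf0 hBf (ι v)).comp_aestronglyMeasurable
    (Lp.aestronglyMeasurable d.W)
  have h2 := (stronglyMeasurable_mulComp hd.β_bdd LipschitzWith.id
    (ι v)).aestronglyMeasurable (μ := timeMeasure T)
  have h3 := (stronglyMeasurable_mulComp hd.α_bdd hf (ι v)).aestronglyMeasurable
    (μ := timeMeasure T)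
  have h4 := (stronglyMeasurable_mulComp hd.b_bdd LipschitzWith.id
    (γ v)).aestronglyMeasurable (μ := timeMeasure T)
  have h5 := (stronglyMeasurable_mulComp hd.a_bdd hg (γ v)).aestronglyMeasurable
    (μ := timeMeasure T)
  exact ((((aestronglyMeasurable_const.sub
    ((adjoint G).continuous.comp_aestronglyMeasurable h1)).add
    ((adjoint ι).continuous.comp_aestronglyMeasurable h2)).sub
    ((adjoint ι).continuous.comp_aestronglyMeasurable h3)).add
    ((adjoint γ).continuous.comp_aestronglyMeasurable h4)).sub
    ((adjoint γ).continuous.comp_aestronglyMeasurable h5)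

/-- At v = 0 only the inflow term survives, since f(0) = 0. -/
theorem norm_reactionOp_zero_le {Bg : ℝ} (hBg : ∀ s, |g s| ≤ Bg) (hM : 0 ≤ M)
    (hg : LipschitzWith Kg g) (hd : d.IsBounded M M') (t : ℝ) :
    ‖reactionOp ι G γ hf hf0 g d t 0‖ ≤ ‖γ‖ * (√(σ.real univ) * (M * Bg)) := by
  simp only [reactionOp, map_zero, fluxTerm_zero_left]
  rw [mulComp_zero (hd.β_bdd.section t) LipschitzWith.id rfl,
    mulComp_zero (hd.α_bdd.section t) hf hf0, mulComp_zero (hd.b_bdd.section t) LipschitzWith.id rfl]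
  simp only [map_zero, sub_zero, add_zero, zero_sub, norm_neg]
  exact (norm_adjoint_apply_le γ _).trans (mul_le_mul_of_nonneg_left
    (norm_mulComp_le (hd.a_bdd.section t) hM hg hBg 0) (norm_nonneg γ))

omit [IsFiniteMeasure μ] [InnerProductSpace ℝ E] [CompleteSpace E] in
theorem memLp_reactionLow (M : ℝ) (Kf : ℝ≥0) (d : CoeffData X Y E μ T) :
    MemLp (reactionLow M Kf d) 2 (timeMeasure T) :=
  (memLp_const (1 + M + M * (Kf : ℝ))).add ((Lp.memLp d.W).norm.const_mul (Kf : ℝ))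

theorem integrable_norm_sq_time {F : Type*} [NormedAddCommGroup F] (W : Lp F 2 (timeMeasure T)) :
    Integrable (fun t => ‖W t‖ ^ 2) (timeMeasure T) ∧
      ∫ t, ‖W t‖ ^ 2 ∂(timeMeasure T) = ‖W‖ ^ 2 := by
  have h : MemLp (fun t => ‖W t‖) 2 (timeMeasure T) := (Lp.memLp W).norm
  have hn : ‖h.toLp _‖ = ‖W‖ := by rw [Lp.norm_toLp, Lp.norm_def, eLpNorm_norm]
  have e : (fun t => ‖h.toLp _ t‖ ^ 2) =ᵐ[timeMeasure T] fun t => ‖W t‖ ^ 2 := by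
    filter_upwards [h.coeFn_toLp] with t ht
    rw [ht, norm_norm]
  exact ⟨(integrable_norm_sq (h.toLp _)).congr e, by
    rw [← hn, norm_sq_eq_integral, integral_congr_ae e]⟩

theorem reactionOp_isParabolicOperator [IsSeparable μ] [IsSeparable σ]
    (hι : ∀ v, ‖ι v‖ ≤ ‖v‖) (hG : ∀ v, ‖G v‖ ≤ ‖v‖) {Bf Bg : ℝ} (hBf : ∀ s, |f s| ≤ Bf)
    (hg : LipschitzWith Kg g) (hBg : ∀ s, |g s| ≤ Bg) (hga : Antitone g) (hM : 0 ≤ M)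
    (hd : d.IsBounded M M') :
    IsParabolicOperator ι T (reactionOp ι G γ hf hf0 g d) (1 / 2) (reactionLip γ M Kg)
      (reactionLow M Kf d) (reactionDef M Kf d) where
  c_pos := by norm_num
  c_le := by norm_num
  le_L := by simp only [reactionLip]; linarith [show 0 ≤ ‖γ‖ * (M * (1 + Kg)) * ‖γ‖ by positivity]
  aesm := reactionOp_aestronglyMeasurable hf hf0 hBf hg hd
  zero_memLp := MemLp.of_bound (reactionOp_aestronglyMeasurable hf hf0 hBf hg hd 0) _
    (Eventually.of_forall fun t => norm_reactionOp_zero_le hf hf0 hBg hM hg hd t)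
  m_nonneg t := by simp only [reactionLow]; positivity
  m_memLp := memLp_reactionLow M Kf d
  k_nonneg t := by simp only [reactionDef]; positivity
  k_integrable := (integrable_const _).add ((integrable_norm_sq_time d.W).1.const_mul _)
  lip := norm_reactionOp_sub_le hf hf0 hι hG hg hM hd
  mono := reactionOp_mono hf hf0 hG hg hga hd

omit [IsFiniteMeasure μ] [InnerProductSpace ℝ E] [CompleteSpace E] in
-- Together with `norm_reactionLow_le` this makes the constants of `dist_le` depend on the bounds
-- for the coefficients only, not on the coefficients themselves.
theorem integral_reactionDef_le (hT : 0 ≤ T) (hd : d.IsBounded M M') :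
    ∫ t, reactionDef M Kf d t ∂(timeMeasure T) ≤ (1 + M * Kf) * T + Kf ^ 2 / 2 * M' ^ 2 := by
  simp only [reactionDef]
  rw [integral_add (integrable_const _) ((integrable_norm_sq_time d.W).1.const_mul _),
    integral_const_mul, (integrable_norm_sq_time d.W).2, integral_const]
  have : (timeMeasure T).real univ = T := by simp [measureReal_def, hT]
  rw [this, smul_eq_mul, mul_comm T]
  have := hd.W_le
  gcongr

omit [IsFiniteMeasure μ] [InnerProductSpace ℝ E] [CompleteSpace E] in
theorem norm_reactionLow_le (hM : 0 ≤ M) (hd : d.IsBounded M M') :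
    ‖(memLp_reactionLow M Kf d).toLp _‖ ≤ √((timeMeasure T).real univ) * (1 + M + M * Kf)
      + Kf * M' := by
  have h1 : MemLp (fun _ : ℝ => (1 + M + M * (Kf:ℝ))) 2 (timeMeasure T) := memLp_const _
  have h2 : ‖(memLp_reactionLow M Kf d).toLp _‖ ≤ ‖h1.toLp _‖ + Kf * ‖d.W‖
      + 0 * ‖(0 : Lp ℝ 2 (timeMeasure T))‖ := by
    refine norm_le_of_ae_norm_le Kf.coe_nonneg le_rfl ?_
    filter_upwards [(memLp_reactionLow M Kf d).coeFn_toLp, h1.coeFn_toLp] with t h1 h2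
    rw [h1, h2, reactionLow, Real.norm_of_nonneg (by positivity),
      Real.norm_of_nonneg (by positivity)]
    simp
  have h3 : ‖h1.toLp _‖ ≤ √((timeMeasure T).real univ) * (1 + M + M * Kf) := by
    refine norm_le_of_ae_bound_sqrt (by positivity) ?_
    filter_upwards [h1.coeFn_toLp] with t h2
    rw [h2, Real.norm_of_nonneg (by positivity)]
  have h4 : Kf * ‖d.W‖ ≤ Kf * M' := by
    have := hd.W_le
    gcongr
  linarith

/-- Perturbations of W, α and a multiply the bounded functions f and g and cost a constant;
perturbations of β and b multiply v or its trace and cost ‖v‖. -/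
theorem norm_reactionOp_diff_le (hι : ∀ v, ‖ι v‖ ≤ ‖v‖) (hG : ∀ v, ‖G v‖ ≤ ‖v‖) {Bf Bg : ℝ}
    (hBf : ∀ s, |f s| ≤ Bf) (hg : LipschitzWith Kg g) (hBg : ∀ s, |g s| ≤ Bg)
    {d' : CoeffData X Y E μ T} (hd : d.IsBounded M M') (hd' : d'.IsBounded M M') {δ : ℝ}
    (hδ : 0 ≤ δ) {t : ℝ} (hβ : ∀ᵐ x ∂μ, |d.β (t, x) - d'.β (t, x)| ≤ δ)
    (hα : ∀ᵐ x ∂μ, |d.α (t, x) - d'.α (t, x)| ≤ δ)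
    (hb : ∀ᵐ x ∂σ, |d.b (t, x) - d'.b (t, x)| ≤ δ)
    (ha : ∀ᵐ x ∂σ, |d.a (t, x) - d'.a (t, x)| ≤ δ) (v : V) :
    ‖reactionOp ι G γ hf hf0 g d t v - reactionOp ι G γ hf hf0 g d' t v‖ ≤
      (√(μ.real univ) * Bf) * ‖d.W t - d'.W t‖ + ((1 + ‖γ‖ * ‖γ‖) * δ) * ‖v‖ +
        ((√(μ.real univ) * Bf + ‖γ‖ * (√(σ.real univ) * Bg)) * δ) := by
  have e : reactionOp ι G γ hf hf0 g d t v - reactionOp ι G γ hf hf0 g d' t v =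
      - adjoint G (fluxTerm hf hf0 (ι v) (d.W t) - fluxTerm hf hf0 (ι v) (d'.W t))
      + adjoint ι (mulComp μ (fun x => d.β (t, x)) id (ι v)
          - mulComp μ (fun x => d'.β (t, x)) id (ι v))
      - adjoint ι (mulComp μ (fun x => d.α (t, x)) f (ι v)
          - mulComp μ (fun x => d'.α (t, x)) f (ι v))
      + adjoint γ (mulComp σ (fun x => d.b (t, x)) id (γ v)
          - mulComp σ (fun x => d'.b (t, x)) id (γ v))
      - adjoint γ (mulComp σ (fun x => d.a (t, x)) g (γ v)
          - mulComp σ (fun x => d'.a (t, x)) g (γ v)) := by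
    simp only [reactionOp, map_sub]
    abel
  rw [e]
  have h2 := (norm_adjoint_apply_le_of_le_one hG _).trans
    (norm_fluxTerm_diff_le hf hf0 hBf (ι v) (d.W t) (d'.W t))
  have h3 := (norm_adjoint_apply_le_of_le_one hι _).trans
    (norm_mulComp_id_diff_le (hd.β_bdd.section t) (hd'.β_bdd.section t) hβ (ι v))
  have h4 := (norm_adjoint_apply_le_of_le_one hι _).trans
    (norm_mulComp_diff_le (hd.α_bdd.section t) (hd'.α_bdd.section t) hf hBf hδ hα (ι v))
  have h5 := (norm_adjoint_apply_le γ _).trans (mul_le_mul_of_nonneg_left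
    (norm_mulComp_id_diff_le (hd.b_bdd.section t) (hd'.b_bdd.section t) hb (γ v)) (norm_nonneg γ))
  have h6 := (norm_adjoint_apply_le γ _).trans (mul_le_mul_of_nonneg_left
    (norm_mulComp_diff_le (hd.a_bdd.section t) (hd'.a_bdd.section t) hg hBg hδ ha (γ v))
    (norm_nonneg γ))
  have h7 : ‖γ‖ * (δ * ‖γ v‖) ≤ ‖γ‖ * (δ * (‖γ‖ * ‖v‖)) := by
    gcongr
    exact γ.le_opNorm v
  have h8 : δ * ‖ι v‖ ≤ δ * ‖v‖ := mul_le_mul_of_nonneg_left (hι v) hδ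
  refine (norm_sub_le _ _).trans ?_
  refine (add_le_add_left (norm_add_le _ _) _).trans ?_
  refine (add_le_add_left (add_le_add_left (norm_sub_le _ _) _) _).trans ?_
  refine (add_le_add_left (add_le_add_left (add_le_add_left (norm_add_le _ _) _) _) _).trans ?_
  rw [norm_neg]
  linarith

theorem IsTrajectory.exists_trajSpace {V H : Type*} [NormedAddCommGroup V] [InnerProductSpace ℝ V]
    [CompleteSpace V] [NormedAddCommGroup H] [InnerProductSpace ℝ H] [CompleteSpace H]
    {ι : V →L[ℝ] H} (hT : 0 < T)
    {u w : Lp V 2 (timeMeasure T)} {U : ℝ → H} (h : IsTrajectory ι T u w U) :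
    ∃ x : trajSpace ι hT, x.1.1 = u ∧ x.1.2.1 = w ∧ IccExtend hT.le x.1.2.2 0 = U 0 := by
  let U' : C(Icc (0:ℝ) T, H) := ⟨fun t => U t, continuousOn_iff_continuous_domRestrict.1 h.cont⟩
  have hU : ∀ t ∈ Icc 0 T, IccExtend hT.le U' t = U t := fun t ht => by
    rw [IccExtend_of_mem _ _ ht]; rfl
  exact ⟨⟨(u, w, U'), h.congr hU⟩, rfl, rfl, hU 0 (left_mem_Icc.2 hT.le)⟩

set_option maxHeartbeats 800000 in
-- Two uses of `dist_le`: the solution for d' is compared with zero, which bounds its norm, and then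
-- with the solution for d inside the equation of d, where its residual is the difference of the two
-- operators.
theorem reaction_stability [IsSeparable μ] [IsSeparable σ] (hιi : Function.Injective ι)
    (hιd : DenseRange ι) (hT : 0 < T) (hι : ∀ v, ‖ι v‖ ≤ ‖v‖) (hG : ∀ v, ‖G v‖ ≤ ‖v‖)
    {Bf Bg : ℝ} (hBf : ∀ s, |f s| ≤ Bf) (hg : LipschitzWith Kg g) (hBg : ∀ s, |g s| ≤ Bg)
    (hga : Antitone g) (hM : 0 ≤ M) (hM' : 0 ≤ M') {R : ℝ} (hR : 0 ≤ R) :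
    ∃ C, 0 < C ∧ ∀ d d' : CoeffData X Y E μ T, d.IsBounded M M' → d'.IsBounded M M' →
      ∀ (u w : Lp V 2 (timeMeasure T)) (U : ℝ → Lp ℝ 2 μ) (u' w' : Lp V 2 (timeMeasure T))
        (U' : ℝ → Lp ℝ 2 μ), IsTrajectory ι T u w U → IsTrajectory ι T u' w' U' →
      (∀ᵐ t ∂(timeMeasure T), w t + reactionOp ι G γ hf hf0 g d t (u t) = 0) →
      (∀ᵐ t ∂(timeMeasure T), w' t + reactionOp ι G γ hf hf0 g d' t (u' t) = 0) →
      ‖U' 0‖ ≤ R → ∀ δ : ℝ, 0 ≤ δ →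
      (∀ᵐ t ∂(timeMeasure T), (∀ᵐ x ∂μ, |d.β (t, x) - d'.β (t, x)| ≤ δ) ∧
        (∀ᵐ x ∂μ, |d.α (t, x) - d'.α (t, x)| ≤ δ) ∧
        (∀ᵐ x ∂σ, |d.b (t, x) - d'.b (t, x)| ≤ δ) ∧
        (∀ᵐ x ∂σ, |d.a (t, x) - d'.a (t, x)| ≤ δ)) →
      ‖u - u'‖ ≤ C * (‖U 0 - U' 0‖ + ‖d.W - d'.W‖ + δ) := by
  have hBf0 : 0 ≤ Bf := (abs_nonneg _).trans (hBf 0)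
  have hBg0 : 0 ≤ Bg := (abs_nonneg _).trans (hBg 0)
  set κ := (1 + M * Kf) * T + Kf ^ 2 / 2 * M' ^ 2
  set ν := √((timeMeasure T).real univ) * (1 + M + M * Kf) + Kf * M'
  set K := stabConst (1 / 2) (reactionLip γ M Kg) κ ν
  have hL0 : 0 ≤ reactionLip γ M Kg := by simp only [reactionLip]; positivity
  have hν : 0 ≤ ν := by positivity
  have hK : 0 < K := by simp only [K, stabConst]; positivity
  set Z := ‖γ‖ * (√(σ.real univ) * (M * Bg))
  have hZ : 0 ≤ Z := by positivity
  set S := √((timeMeasure T).real univ)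
  set R' := K * (R + S * Z)
  have hR' : 0 ≤ R' := by positivity
  set A₁ := √(μ.real univ) * Bf
  set A₂ := 1 + ‖γ‖ * ‖γ‖
  set A₃ := √(μ.real univ) * Bf + ‖γ‖ * (√(σ.real univ) * Bg)
  have hA₁ : 0 ≤ A₁ := by positivity
  have hA₂ : 0 ≤ A₂ := by positivity
  have hA₃ : 0 ≤ A₃ := by positivity
  refine ⟨K * (1 + A₁ + (A₂ * R' + A₃ * S)), by positivity, ?_⟩
  intro d d' hd hd' u w U u' w' U' hx hx' heq heq' hUR δ hδ hdiff
  have hop := reactionOp_isParabolicOperator (γ := γ) hf hf0 hι hG hBf hg hBg hga hM hd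
  have hop' := reactionOp_isParabolicOperator (γ := γ) hf hf0 hι hG hBf hg hBg hga hM hd'
  obtain ⟨x, rfl, rfl, hx0⟩ := hx.exists_trajSpace hT
  obtain ⟨y, rfl, rfl, hy0⟩ := hx'.exists_trajSpace hT
  have e1 : x.1.2.1 + hop.nemytskii x = 0 := by
    refine Lp.ext ?_
    filter_upwards [Lp.coeFn_add x.1.2.1 (hop.nemytskii x), hop.coeFn_nemytskii x, heq,
      Lp.coeFn_zero V 2 (timeMeasure T)] with t h1 h2 h3 h4
    rw [h1, Pi.add_apply, h2, h3, h4]; rfl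
  have e2 : y.1.2.1 + hop'.nemytskii y = 0 := by
    refine Lp.ext ?_
    filter_upwards [Lp.coeFn_add y.1.2.1 (hop'.nemytskii y), hop'.coeFn_nemytskii y, heq',
      Lp.coeFn_zero V 2 (timeMeasure T)] with t h1 h2 h3 h4
    rw [h1, Pi.add_apply, h2, h3, h4]; rfl
  -- The zero trajectory has initial value 0 and as residual the operator at 0, whose norm is at
  -- most S * Z.
  have hy : ‖y‖ ≤ R' := by
    have h1 := hop'.dist_le hιi hιd y 0 (integral_reactionDef_le hT.le hd')
      (norm_reactionLow_le hM hd')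
    have h0 : IccExtend hT.le ((0 : trajSpace ι hT).1.2.2) 0 = 0 := rfl
    have h2 : ‖hop'.nemytskii (0 : trajSpace ι hT)‖ ≤ S * Z := by
      refine norm_le_of_ae_bound_sqrt hZ ?_
      filter_upwards [hop'.coeFn_nemytskii (0 : trajSpace ι hT),
        Lp.coeFn_zero V 2 (timeMeasure T)] with t h3 h4
      rw [h3]
      have h5 : (0 : trajSpace ι hT).1.1 t = 0 := h4
      rw [h5]
      exact norm_reactionOp_zero_le hf hf0 hBg hM hg hd' t
    have h6 : (0 : trajSpace ι hT).1.2.1 = 0 := rfl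
    rw [e2, h0, h6, sub_zero, sub_zero, zero_add, zero_sub, norm_neg, hy0] at h1
    exact h1.trans (mul_le_mul_of_nonneg_left (add_le_add hUR h2) hK.le)
  have h1 := hop.dist_le hιi hιd x y (integral_reactionDef_le hT.le hd)
    (norm_reactionLow_le hM hd)
  -- As y solves the equation of d', its derivative is minus the operator of d' at y, so this
  -- residual is the difference of the two operators at y.
  have h2 : ‖y.1.2.1 + hop.nemytskii y‖ ≤ A₁ * ‖d.W - d'.W‖ + (A₂ * R' + A₃ * S) * δ := by
    have hc : MemLp (fun _ : ℝ => (1:ℝ)) 2 (timeMeasure T) := memLp_const 1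
    have hcn : ‖hc.toLp _‖ ≤ S := by
      have := norm_le_of_ae_bound_sqrt (w := hc.toLp _) (B := 1) zero_le_one (by
        filter_upwards [hc.coeFn_toLp] with t ht
        rw [ht, norm_one])
      simpa only [mul_one] using this
    have h3 : ‖y.1.2.1 + hop.nemytskii y‖ ≤ ‖A₁ • (d.W - d'.W)‖ + (A₂ * δ) * ‖y.1.1‖
        + (A₃ * δ) * ‖hc.toLp _‖ := by
      refine norm_le_of_ae_norm_le (by positivity) (by positivity) ?_
      filter_upwards [Lp.coeFn_add y.1.2.1 (hop.nemytskii y), hop.coeFn_nemytskii y, heq',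
        Lp.coeFn_smul A₁ (d.W - d'.W), Lp.coeFn_sub d.W d'.W, hc.coeFn_toLp, hdiff]
        with t h1 h2 h3 h4 h5 h6 h7
      rw [h1, Pi.add_apply, h2, eq_neg_of_add_eq_zero_left h3, h4, Pi.smul_apply, h5,
        Pi.sub_apply, h6, norm_smul, Real.norm_of_nonneg hA₁, neg_add_eq_sub, mul_one]
      exact norm_reactionOp_diff_le hf hf0 hι hG hBf hg hBg hd hd' hδ h7.1 h7.2.1 h7.2.2.1
        h7.2.2.2 _
    rw [norm_smul, Real.norm_of_nonneg hA₁] at h3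
    have h4 : ‖y.1.1‖ ≤ R' := (le_max_left _ _ : ‖y.1.1‖ ≤ ‖y‖).trans hy
    have h5 : (A₂ * δ) * ‖y.1.1‖ ≤ (A₂ * δ) * R' := by gcongr
    have h6 : (A₃ * δ) * ‖hc.toLp _‖ ≤ (A₃ * δ) * S := by gcongr
    linarith
  rw [e1, hx0, hy0, zero_sub, norm_neg] at h1
  have h3 : ‖x.1.1 - y.1.1‖ ≤ ‖x - y‖ := le_max_left _ _
  refine h3.trans (h1.trans ?_)
  rw [mul_assoc]
  refine mul_le_mul_of_nonneg_left ?_ hK.le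
  have n1 := norm_nonneg (U 0 - U' 0)
  have n2 := norm_nonneg (d.W - d'.W)
  set A₄ := A₂ * R' + A₃ * S
  have hA₄ : 0 ≤ A₄ := by positivity
  nlinarith [mul_nonneg hA₁ n1, mul_nonneg hA₁ hδ, mul_nonneg hA₄ n1, mul_nonneg hA₄ n2]

theorem reaction_existence [IsSeparable μ] [IsSeparable σ] (hιi : Function.Injective ι)
    (hιd : DenseRange ι) (hT : 0 < T) (hι : ∀ v, ‖ι v‖ ≤ ‖v‖) (hG : ∀ v, ‖G v‖ ≤ ‖v‖)
    {Bf Bg : ℝ} (hBf : ∀ s, |f s| ≤ Bf) (hg : LipschitzWith Kg g) (hBg : ∀ s, |g s| ≤ Bg)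
    (hga : Antitone g) (hM : 0 ≤ M) (hd : d.IsBounded M M') (u₀ : Lp ℝ 2 μ) :
    ∃ (u w : Lp V 2 (timeMeasure T)) (U : ℝ → Lp ℝ 2 μ), IsTrajectory ι T u w U ∧
      (∀ᵐ t ∂(timeMeasure T), w t + reactionOp ι G γ hf hf0 g d t (u t) = 0) ∧ U 0 = u₀ := by
  have hop := reactionOp_isParabolicOperator (γ := γ) hf hf0 hι hG hBf hg hBg hga hM hd
  obtain ⟨x, hx, hx0⟩ := hop.exists_solution hιi hιd hT u₀
  refine ⟨x.1.1, x.1.2.1, IccExtend hT.le x.1.2.2, x.2, ?_, hx0⟩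
  have h0 : ∀ᵐ t ∂(timeMeasure T), (x.1.2.1 + hop.nemytskii x) t = 0 := by
    rw [hx]; exact Lp.coeFn_zero V 2 (timeMeasure T)
  filter_upwards [h0, Lp.coeFn_add x.1.2.1 (hop.nemytskii x), hop.coeFn_nemytskii x]
    with t h1 h2 h3
  rw [h2, Pi.add_apply, h3] at h1
  exact h1

end ReactionDiffusion

/-! ## The Hilbert space `H¹(D)` -/

section HilbertH1

variable {N : ℕ} {D : Set (EuclideanSpace ℝ (Fin N))}

/-- Change of the norm of a product from `ℓ¹` to `ℓ²`. -/
def withLpOneTwo (A B : Type*) [NormedAddCommGroup A] [NormedAddCommGroup B] [NormedSpace ℝ A]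
    [NormedSpace ℝ B] : WithLp 1 (A × B) ≃L[ℝ] WithLp 2 (A × B) :=
  (WithLp.prodContinuousLinearEquiv 1 ℝ A B).trans
    (WithLp.prodContinuousLinearEquiv 2 ℝ A B).symm

/-- `H¹(D)` with its Hilbert space norm. -/
def hilbertH1 (D : Set (EuclideanSpace ℝ (Fin N))) :
    Submodule ℝ (WithLp 2 (Lp ℝ 2 (spaceMeasure D) ×
      Lp (EuclideanSpace ℝ (Fin N)) 2 (spaceMeasure D))) :=
  (sobolev D 2).map (withLpOneTwo (Lp ℝ 2 (spaceMeasure D))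
    (Lp (EuclideanSpace ℝ (Fin N)) 2 (spaceMeasure D))).toLinearEquiv.toLinearMap

/-- The isomorphism of `H¹(D)` with its version carrying a Hilbert space norm. -/
def toHilbert (D : Set (EuclideanSpace ℝ (Fin N))) : H1 D ≃L[ℝ] hilbertH1 D :=
  (withLpOneTwo (Lp ℝ 2 (spaceMeasure D))
    (Lp (EuclideanSpace ℝ (Fin N)) 2 (spaceMeasure D))).submoduleMap (sobolev D 2)

theorem mem_hilbertH1 (q : WithLp 2 (Lp ℝ 2 (spaceMeasure D) ×
      Lp (EuclideanSpace ℝ (Fin N)) 2 (spaceMeasure D))) :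
    q ∈ hilbertH1 D ↔ IsWeakGradient D q.fst q.snd := by
  constructor
  · rintro ⟨p, hp, rfl⟩
    exact hp
  · intro h
    exact ⟨WithLp.toLp 1 (q.fst, q.snd), h, rfl⟩

/-- The embedding of `H¹(D)` into `L²(D)`. -/
def h1Incl (D : Set (EuclideanSpace ℝ (Fin N))) : hilbertH1 D →L[ℝ] Lp ℝ 2 (spaceMeasure D) :=
  ((ContinuousLinearMap.fst ℝ (Lp ℝ 2 (spaceMeasure D))
    (Lp (EuclideanSpace ℝ (Fin N)) 2 (spaceMeasure D))).comp
    (WithLp.prodContinuousLinearEquiv 2 ℝ (Lp ℝ 2 (spaceMeasure D))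
    (Lp (EuclideanSpace ℝ (Fin N)) 2 (spaceMeasure D))).toContinuousLinearMap).comp
    (hilbertH1 D).subtypeL

/-- The weak gradient on `H¹(D)`. -/
def h1Grad (D : Set (EuclideanSpace ℝ (Fin N))) :
    hilbertH1 D →L[ℝ] Lp (EuclideanSpace ℝ (Fin N)) 2 (spaceMeasure D) :=
  ((ContinuousLinearMap.snd ℝ (Lp ℝ 2 (spaceMeasure D))
    (Lp (EuclideanSpace ℝ (Fin N)) 2 (spaceMeasure D))).comp
    (WithLp.prodContinuousLinearEquiv 2 ℝ (Lp ℝ 2 (spaceMeasure D))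
    (Lp (EuclideanSpace ℝ (Fin N)) 2 (spaceMeasure D))).toContinuousLinearMap).comp
    (hilbertH1 D).subtypeL

theorem h1Incl_toHilbert (v : H1 D) : h1Incl D (toHilbert D v) = sobolevFun v := rfl

theorem inner_hilbertH1 (v w : hilbertH1 D) :
    inner ℝ v w = (inner ℝ (h1Incl D v) (h1Incl D w) + inner ℝ (h1Grad D v) (h1Grad D w) : ℝ) :=
  rfl

theorem norm_h1Incl_le (v : hilbertH1 D) : ‖h1Incl D v‖ ≤ ‖v‖ :=
  WithLp.norm_fst_le _ v.1

theorem norm_h1Grad_le (v : hilbertH1 D) : ‖h1Grad D v‖ ≤ ‖v‖ :=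
  WithLp.norm_snd_le _ v.1

theorem memLp_of_hasCompactSupport {F : Type*} [NormedAddCommGroup F]
    {ψ : EuclideanSpace ℝ (Fin N) → F} (hc : Continuous ψ) (hs : HasCompactSupport ψ) :
    MemLp ψ 2 (spaceMeasure D) :=
  (hc.memLp_of_hasCompactSupport hs).restrict D

theorem IsTestFunction.continuous_fderiv {φ : EuclideanSpace ℝ (Fin N) → ℝ}
    (hφ : IsTestFunction D φ) (e : EuclideanSpace ℝ (Fin N)) :
    Continuous fun x => fderiv ℝ φ x e :=
  (hφ.1.continuous_fderiv (by simp)).clm_apply continuous_const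

/-- Each test function and direction imposes an equality between L² inner products with fixed
functions, which is a closed condition. -/
theorem isClosed_hilbertH1 : IsClosed (hilbertH1 D : Set (WithLp 2 (Lp ℝ 2 (spaceMeasure D) ×
      Lp (EuclideanSpace ℝ (Fin N)) 2 (spaceMeasure D)))) := by
  have : (hilbertH1 D : Set (WithLp 2 (Lp ℝ 2 (spaceMeasure D) ×
      Lp (EuclideanSpace ℝ (Fin N)) 2 (spaceMeasure D)))) =
      ⋂ (φ) (_ : IsTestFunction D φ) (e : EuclideanSpace ℝ (Fin N)),
        {q | ∫ x in D, q.fst x * fderiv ℝ φ x e = - ∫ x in D, inner ℝ (q.snd x) e * φ x} := by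
    ext q
    simp only [mem_iInter, SetLike.mem_coe, mem_hilbertH1]
    rfl
  rw [this]
  refine isClosed_iInter fun φ => isClosed_iInter fun hφ => isClosed_iInter fun e => ?_
  have h1 : MemLp (fun x => fderiv ℝ φ x e) 2 (spaceMeasure D) :=
    memLp_of_hasCompactSupport (hφ.continuous_fderiv e) (hφ.2.1.fderiv_apply ℝ e)
  have h2 : MemLp (fun x => φ x • e) 2 (spaceMeasure D) :=
    memLp_of_hasCompactSupport (hφ.1.continuous.smul continuous_const) hφ.2.1.smul_right
  have e1 : ∀ v : Lp ℝ 2 (spaceMeasure D), ∫ x in D, v x * fderiv ℝ φ x e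
      = inner ℝ v (h1.toLp _) := fun v => by
    rw [L2.inner_def]
    refine integral_congr_ae ?_
    filter_upwards [h1.coeFn_toLp] with x hx
    rw [hx]; simp [mul_comm]
  have e2 : ∀ v : Lp (EuclideanSpace ℝ (Fin N)) 2 (spaceMeasure D),
      ∫ x in D, inner ℝ (v x) e * φ x = inner ℝ v (h2.toLp _) := fun v => by
    rw [L2.inner_def]
    refine integral_congr_ae ?_
    filter_upwards [h2.coeFn_toLp] with x hx
    rw [hx, real_inner_smul_right, mul_comm]
  simp only [e1, e2]
  have c1 : Continuous fun q : WithLp 2 (Lp ℝ 2 (spaceMeasure D) ×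
      Lp (EuclideanSpace ℝ (Fin N)) 2 (spaceMeasure D)) => q.fst :=
    continuous_fst.comp (WithLp.prodContinuousLinearEquiv 2 ℝ _ _).continuous
  have c2 : Continuous fun q : WithLp 2 (Lp ℝ 2 (spaceMeasure D) ×
      Lp (EuclideanSpace ℝ (Fin N)) 2 (spaceMeasure D)) => q.snd :=
    continuous_snd.comp (WithLp.prodContinuousLinearEquiv 2 ℝ _ _).continuous
  exact isClosed_eq (c1.inner continuous_const) (c2.inner continuous_const).neg

instance : CompleteSpace (hilbertH1 D) := isClosed_hilbertH1.completeSpace_coe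

theorem ae_eq_zero_of_integral_test {v : EuclideanSpace ℝ (Fin N) → ℝ} (hD : IsOpen D)
    (hv : LocallyIntegrable v (spaceMeasure D))
    (h : ∀ φ, IsTestFunction D φ → ∫ x in D, φ x * v x = 0) : v =ᵐ[spaceMeasure D] 0 := by
  have h1 := hD.ae_eq_zero_of_integral_contDiff_smul_eq_zero (hv.locallyIntegrableOn D)
    (fun φ h1 h2 h3 => h φ ⟨h1, h2, h3⟩)
  filter_upwards [h1, ae_restrict_mem hD.measurableSet] with x hx hxD using hx hxD

/-- If the function vanishes, the gradient integrates to zero against all test functions, so it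
vanishes too. -/
theorem h1Incl_injective (hD : IsOpen D) : Function.Injective (h1Incl D) := by
  rw [injective_iff_map_eq_zero]
  intro v hv
  have hw : IsWeakGradient D (h1Incl D v) (h1Grad D v) := (mem_hilbertH1 v.1).1 v.2
  have hg : h1Grad D v = 0 := by
    have h1 : ∀ e : EuclideanSpace ℝ (Fin N),
        (fun x => inner ℝ e (h1Grad D v x)) =ᵐ[spaceMeasure D] (0 : EuclideanSpace ℝ (Fin N) → ℝ) := by
      intro e
      have hm : MemLp (fun x => inner ℝ e (h1Grad D v x)) 2 (spaceMeasure D) :=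
        (Lp.memLp (h1Grad D v)).const_inner e
      refine ae_eq_zero_of_integral_test hD (hm.locallyIntegrable (by norm_num)) fun φ hφ => ?_
      have h2 := hw φ hφ e
      rw [hv] at h2
      have h3 : ∫ x in D, (0 : Lp ℝ 2 (spaceMeasure D)) x * fderiv ℝ φ x e = 0 := by
        refine integral_eq_zero_of_ae ?_
        filter_upwards [Lp.coeFn_zero ℝ 2 (spaceMeasure D)] with x hx
        rw [hx]; simp
      rw [h3, eq_comm, neg_eq_zero] at h2
      rw [← h2]
      congr 1
      ext x
      rw [real_inner_comm, mul_comm]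
    have h2 := ae_eq_zero_of_forall_inner (𝕜 := ℝ) h1
    exact (Lp.eq_zero_iff_ae_eq_zero).2 h2
  rw [← inner_self_eq_zero (𝕜 := ℝ), inner_hilbertH1, hv, hg]
  simp

theorem exists_h1_of_test {φ : EuclideanSpace ℝ (Fin N) → ℝ} (hφ : IsTestFunction D φ) :
    ∃ v : hilbertH1 D, h1Incl D v =ᵐ[spaceMeasure D] φ := by
  have hgc : Continuous (gradient φ) :=
    (InnerProductSpace.toDual ℝ _).symm.continuous.comp (hφ.1.continuous_fderiv (by simp))
  have hgs : HasCompactSupport (gradient φ) :=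
    (hφ.2.1.fderiv ℝ).comp_left (g := (InnerProductSpace.toDual ℝ _).symm) (map_zero _)
  have h1 : MemLp φ 2 (spaceMeasure D) := memLp_of_hasCompactSupport hφ.1.continuous hφ.2.1
  have h2 : MemLp (gradient φ) 2 (spaceMeasure D) := memLp_of_hasCompactSupport hgc hgs
  have hgi : ∀ x e, inner ℝ (gradient φ x) e = fderiv ℝ φ x e := fun x e => by
    rw [gradient, InnerProductSpace.toDual_symm_apply]
  refine ⟨⟨WithLp.toLp 2 (h1.toLp _, h2.toLp _), (mem_hilbertH1 _).2 fun ψ hψ e => ?_⟩,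
    h1.coeFn_toLp⟩
  have e1 : ∫ x in D, h1.toLp _ x * fderiv ℝ ψ x e = ∫ x in D, φ x * fderiv ℝ ψ x e := by
    refine integral_congr_ae ?_
    filter_upwards [h1.coeFn_toLp] with x hx
    rw [hx]
  have e2 : ∫ x in D, inner ℝ (h2.toLp _ x) e * ψ x = ∫ x in D, fderiv ℝ φ x e * ψ x := by
    refine integral_congr_ae ?_
    filter_upwards [h2.coeFn_toLp] with x hx
    rw [hx, hgi]
  change ∫ x in D, h1.toLp _ x * fderiv ℝ ψ x e = - ∫ x in D, inner ℝ (h2.toLp _ x) e * ψ x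
  rw [e1, e2]
  have hψ0 : ∀ x, x ∉ D → φ x = 0 := fun x hx =>
    image_eq_zero_of_notMem_tsupport fun h => hx (hφ.2.2 h)
  have hψ1 : ∀ x, x ∉ D → ψ x = 0 := fun x hx =>
    image_eq_zero_of_notMem_tsupport fun h => hx (hψ.2.2 h)
  rw [setIntegral_eq_integral_of_forall_compl_eq_zero (fun x hx => by rw [hψ0 x hx, zero_mul]),
    setIntegral_eq_integral_of_forall_compl_eq_zero (fun x hx => by rw [hψ1 x hx, mul_zero])]
  refine integral_mul_fderiv_eq_neg_fderiv_mul_of_integrable ?_ ?_ ?_ ?_ ?_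
  · exact ((hφ.continuous_fderiv e).mul hψ.1.continuous).integrable_of_hasCompactSupport
      hψ.2.1.mul_left
  · exact (hφ.1.continuous.mul (hψ.continuous_fderiv e)).integrable_of_hasCompactSupport
      hφ.2.1.mul_right
  · exact (hφ.1.continuous.mul hψ.1.continuous).integrable_of_hasCompactSupport
      hφ.2.1.mul_right
  · exact fun x _ => (hφ.1.differentiable (by simp)).differentiableAt
  · exact fun x _ => (hψ.1.differentiable (by simp)).differentiableAt

/-- Test functions lie in H¹(D), and an L² function orthogonal to all of them is zero. -/
theorem h1Incl_denseRange (hD : IsOpen D) : DenseRange (h1Incl D) := by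
  have h : (h1Incl D).range.topologicalClosure = ⊤ := by
    rw [Submodule.topologicalClosure_eq_top_iff, Submodule.eq_bot_iff]
    intro x hx
    rw [Submodule.mem_orthogonal] at hx
    rw [Lp.eq_zero_iff_ae_eq_zero]
    refine ae_eq_zero_of_integral_test hD ((Lp.memLp x).locallyIntegrable (by norm_num))
      fun φ hφ => ?_
    obtain ⟨v, hv⟩ := exists_h1_of_test hφ
    rw [← hx _ ⟨v, rfl⟩, ContinuousLinearMap.coe_coe, L2.inner_def]
    refine integral_congr_ae ?_
    filter_upwards [hv] with y hy
    rw [hy]; simp [mul_comm]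
  have := Submodule.dense_iff_topologicalClosure_eq_top.2 h
  simpa [DenseRange, LinearMap.coe_range] using this

end HilbertH1

/-! ## Weak solutions as trajectories -/

section WeakFormulation

open ContinuousLinearMap (adjoint)

theorem integral_deriv_mul_primitive {T : ℝ} (hT : 0 ≤ T) {y z : ℝ → ℝ}
    (hz : IntervalIntegrable z volume 0 T)
    (hy : ∀ t ∈ Icc 0 T, y t = y 0 + ∫ s in (0 : ℝ)..t, z s)
    {η : ℝ → ℝ} (hη : ContDiff ℝ ∞ η) (hηs : tsupport η ⊆ Ioo 0 T) :
    ∫ t in Ioo 0 T, deriv η t * y t = - ∫ t in Ioo 0 T, η t * z t := by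
  rcases hT.eq_or_lt with rfl | hT'
  · simp
  have hη0 : η 0 = 0 := image_eq_zero_of_notMem_tsupport fun h => (lt_irrefl _ (hηs h).1)
  have hηT : η T = 0 := image_eq_zero_of_notMem_tsupport fun h => (lt_irrefl _ (hηs h).2)
  have hηac : AbsolutelyContinuousOnInterval η 0 T := by
    refine primitive_ac hT (z := deriv η)
      ((hη.continuous_deriv (by simp)).intervalIntegrable _ _) fun t _ => ?_
    rw [intervalIntegral.integral_deriv_eq_sub
      (fun x _ => (hη.differentiable (by simp)).differentiableAt)
      ((hη.continuous_deriv (by simp)).intervalIntegrable _ _)]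
    ring
  have h := hηac.integral_mul_deriv_eq_deriv_mul (primitive_ac hT hz hy)
  have h1 : ∫ t in (0:ℝ)..T, η t * deriv y t = ∫ t in (0:ℝ)..T, η t * z t := by
    refine intervalIntegral.integral_congr_ae ?_
    have h2 : ∀ᵐ t : ℝ, t ≠ T := by simp [ae_iff]
    filter_upwards [primitive_hasDerivAt hz hy, h2] with t ht htT htm
    rw [uIoc_of_le hT] at htm
    rw [(ht ⟨htm.1, lt_of_le_of_ne htm.2 htT⟩).deriv]
  rw [h1, hη0, hηT] at h
  rw [integral_timeMeasure hT, integral_timeMeasure hT, h]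
  ring

/-! ### Weak form of the operator and identification of V with the dual of H¹(D) -/

section Abstract

variable {X Y E V : Type*} [MeasurableSpace X] [MeasurableSpace Y]
  {μ : Measure X} {σ : Measure Y} [IsFiniteMeasure μ] [IsFiniteMeasure σ]
  [NormedAddCommGroup E] [InnerProductSpace ℝ E] [CompleteSpace E]
  [NormedAddCommGroup V] [InnerProductSpace ℝ V] [CompleteSpace V]
  {ι : V →L[ℝ] Lp ℝ 2 μ} {G : V →L[ℝ] Lp E 2 μ} {γ : V →L[ℝ] Lp ℝ 2 σ}
  {f g : ℝ → ℝ} {Kf Kg : ℝ≥0} (hf : LipschitzWith Kf f) (hf0 : f 0 = 0) {T : ℝ}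
  {d : CoeffData X Y E μ T} {M M' : ℝ}

/-- The weak form of `reactionOp`. -/
theorem inner_reactionOp (hV : ∀ v z : V, inner ℝ v z = inner ℝ (ι v) (ι z) + inner ℝ (G v) (G z))
    (hg : LipschitzWith Kg g) (hd : d.IsBounded M M') (t : ℝ) (v z : V) :
    inner ℝ (reactionOp ι G γ hf hf0 g d t v) z =
      -(∫ x, inner ℝ (-G v x + f (ι v x) • d.W t x) (G z x) ∂μ)
      + (∫ x, d.β (t, x) * ι v x * ι z x ∂μ)
      - (∫ x, d.α (t, x) * f (ι v x) * ι z x ∂μ)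
      + (∫ x, d.b (t, x) * γ v x * γ z x ∂σ)
      - (∫ x, d.a (t, x) * g (γ v x) * γ z x ∂σ) := by
  have h1 : ∫ x, inner ℝ (-G v x + f (ι v x) • d.W t x) (G z x) ∂μ
      = inner ℝ (-G v + fluxTerm hf hf0 (ι v) (d.W t)) (G z) := by
    rw [L2.inner_def]
    refine integral_congr_ae ?_
    filter_upwards [Lp.coeFn_add (-G v) (fluxTerm hf hf0 (ι v) (d.W t)), Lp.coeFn_neg (G v),
      coeFn_fluxTerm hf hf0 (ι v) (d.W t)] with x h1 h2 h3
    rw [h1, Pi.add_apply, h2, h3, Pi.neg_apply]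
  have h2 := inner_mulComp (hd.β_bdd.section t) LipschitzWith.id (ι v) (ι z)
  have h3 := inner_mulComp (hd.α_bdd.section t) hf (ι v) (ι z)
  have h4 := inner_mulComp (hd.b_bdd.section t) LipschitzWith.id (γ v) (γ z)
  have h5 := inner_mulComp (hd.a_bdd.section t) hg (γ v) (γ z)
  simp only [id] at h2 h4
  rw [h1, ← h2, ← h3, ← h4, ← h5, reactionOp]
  simp only [inner_add_left, inner_sub_left, inner_neg_left, ContinuousLinearMap.adjoint_inner_left,
    hV v z]
  ring


/-- The Riesz representation of functionals, for a space with an equivalent Hilbert norm. -/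
def rieszMap {W : Type*} [NormedAddCommGroup W] [NormedSpace ℝ W] (e : W ≃L[ℝ] V) :
    StrongDual ℝ W →L[ℝ] V :=
  LinearMap.mkContinuous
    { toFun := fun l : StrongDual ℝ W => (InnerProductSpace.toDual ℝ V).symm
        (l.comp e.symm.toContinuousLinearMap)
      map_add' := fun l l' => by rw [ContinuousLinearMap.add_comp, map_add]
      map_smul' := fun c l => by
        rw [ContinuousLinearMap.smul_comp, LinearIsometryEquiv.map_smulₛₗ]; simp }
    ‖e.symm.toContinuousLinearMap‖ fun l => by
      simp only [LinearMap.coe_mk, AddHom.coe_mk, LinearIsometryEquiv.norm_map]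
      rw [mul_comm]
      exact l.opNorm_comp_le _

theorem inner_rieszMap {W : Type*} [NormedAddCommGroup W] [NormedSpace ℝ W] (e : W ≃L[ℝ] V)
    (l : StrongDual ℝ W) (v : V) : inner ℝ (rieszMap e l) v = l (e.symm v) := by
  simp [rieszMap]

/-- The functional represented by an element of a Hilbert space. -/
def dualMap {W : Type*} [NormedAddCommGroup W] [NormedSpace ℝ W] (e : W ≃L[ℝ] V) :
    V →L[ℝ] StrongDual ℝ W :=
  LinearMap.mkContinuous
    { toFun := fun v : V => (InnerProductSpace.toDual ℝ V v).comp e.toContinuousLinearMap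
      map_add' := fun l l' => by rw [map_add, ContinuousLinearMap.add_comp]
      map_smul' := fun c l => by
        rw [LinearIsometryEquiv.map_smulₛₗ, ContinuousLinearMap.smul_comp]; simp }
    ‖e.toContinuousLinearMap‖ fun l => by
      refine (ContinuousLinearMap.opNorm_comp_le _ _).trans ?_
      rw [LinearIsometryEquiv.norm_map, mul_comm]

theorem dualMap_apply {W : Type*} [NormedAddCommGroup W] [NormedSpace ℝ W] (e : W ≃L[ℝ] V)
    (v : V) (φ : W) : dualMap e v φ = inner ℝ v (e φ) := by
  simp [dualMap]

/-- `rieszMap` on functions of time. -/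
def rieszLp {W : Type*} [NormedAddCommGroup W] [NormedSpace ℝ W] (e : W ≃L[ℝ] V)
    (w : Lp (StrongDual ℝ W) 2 (timeMeasure T)) : Lp V 2 (timeMeasure T) := (rieszMap e).compLp w

/-- `dualMap` on functions of time. -/
def dualLp {W : Type*} [NormedAddCommGroup W] [NormedSpace ℝ W] (e : W ≃L[ℝ] V)
    (w : Lp V 2 (timeMeasure T)) : Lp (StrongDual ℝ W) 2 (timeMeasure T) := (dualMap e).compLp w

theorem inner_rieszLp {W : Type*} [NormedAddCommGroup W] [NormedSpace ℝ W] (e : W ≃L[ℝ] V)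
    (w : Lp (StrongDual ℝ W) 2 (timeMeasure T)) :
    ∀ᵐ t ∂(timeMeasure T), ∀ φ : W, inner ℝ (rieszLp e w t) (e φ) = w t φ := by
  filter_upwards [(rieszMap e).coeFn_compLp w] with t ht φ
  rw [rieszLp, ht, inner_rieszMap, ContinuousLinearEquiv.symm_apply_apply]

theorem dualLp_apply {W : Type*} [NormedAddCommGroup W] [NormedSpace ℝ W] (e : W ≃L[ℝ] V)
    (w : Lp V 2 (timeMeasure T)) :
    ∀ᵐ t ∂(timeMeasure T), ∀ φ : W, dualLp e w t φ = inner ℝ (w t) (e φ) := by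
  filter_upwards [(dualMap e).coeFn_compLp w] with t ht φ
  rw [dualLp, ht, dualMap_apply]

/-- A continuous linear equivalence on functions of time. -/
def equivLp {W W' : Type*} [NormedAddCommGroup W] [NormedSpace ℝ W] [NormedAddCommGroup W']
    [NormedSpace ℝ W'] (e : W ≃L[ℝ] W') (u : Lp W 2 (timeMeasure T)) : Lp W' 2 (timeMeasure T) :=
  e.toContinuousLinearMap.compLp u

theorem coeFn_equivLp {W W' : Type*} [NormedAddCommGroup W] [NormedSpace ℝ W]
    [NormedAddCommGroup W'] [NormedSpace ℝ W'] (e : W ≃L[ℝ] W') (u : Lp W 2 (timeMeasure T)) :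
    ∀ᵐ t ∂(timeMeasure T), equivLp e u t = e (u t) := e.toContinuousLinearMap.coeFn_compLp u

theorem norm_sub_le_equivLp {W W' : Type*} [NormedAddCommGroup W] [NormedSpace ℝ W]
    [NormedAddCommGroup W'] [NormedSpace ℝ W'] (e : W ≃L[ℝ] W') (u v : Lp W 2 (timeMeasure T)) :
    ‖u - v‖ ≤ ‖e.symm.toContinuousLinearMap‖ * ‖equivLp e u - equivLp e v‖ := by
  refine Lp.norm_le_mul_norm_of_ae_le_mul ?_
  filter_upwards [coeFn_equivLp e u, coeFn_equivLp e v, Lp.coeFn_sub u v,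
    Lp.coeFn_sub (equivLp e u) (equivLp e v)] with t h1 h2 h3 h4
  rw [h3, h4, Pi.sub_apply, Pi.sub_apply, h1, h2, ← map_sub]
  have := e.symm.toContinuousLinearMap.le_opNorm (e (u t - v t))
  simpa using this

variable {H : Type*} [NormedAddCommGroup H] [InnerProductSpace ℝ H] [CompleteSpace H]
  {A : V →L[ℝ] H}

/-- A weak time derivative turns a continuous representative into a trajectory. -/
theorem isTrajectory_of_weak_deriv (hT : 0 < T) {u w : Lp V 2 (timeMeasure T)} {U : ℝ → H}
    (hU : ContinuousOn U (Icc 0 T)) (hUu : ∀ᵐ t ∂(timeMeasure T), U t = A (u t))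
    (h : ∀ η : ℝ → ℝ, ContDiff ℝ ∞ η → HasCompactSupport η → tsupport η ⊆ Ioo 0 T → ∀ v : V,
      ∫ t in Ioo 0 T, deriv η t * inner ℝ (A (u t)) (A v)
        = - ∫ t in Ioo 0 T, η t * inner ℝ (w t) v) :
    IsTrajectory A T u w U := by
  refine ⟨hU, hUu, fun t ht => ?_⟩
  refine ext_inner_right ℝ fun v => ?_
  set z : ℝ → ℝ := fun s => inner ℝ (w s) v
  have hwi : IntervalIntegrable w volume 0 T :=
    Lp_intervalIntegrable_time w (left_mem_Icc.2 hT.le) (right_mem_Icc.2 hT.le)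
  have hz : IntervalIntegrable z volume 0 T := by
    rw [intervalIntegrable_iff] at hwi ⊢
    exact hwi.inner_const v
  have hzc : ContinuousOn (fun t => ∫ s in (0:ℝ)..t, z s) (Icc 0 T) := by
    have := intervalIntegral.continuousOn_primitive_interval (μ := volume) (f := z) (a := 0) (b := T)
      (by rw [uIcc_of_le hT.le]; exact (intervalIntegrable_iff_integrableOn_Icc_of_le hT.le).1 hz)
    rwa [uIcc_of_le hT.le] at this
  set p : ℝ → ℝ := fun t => inner ℝ (U t) (A v)
  have hp : ContinuousOn p (Icc 0 T) := hU.inner continuousOn_const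
  -- Du Bois-Reymond: paired with a fixed v, the representative minus the primitive of w has zero
  -- weak derivative and is continuous, hence constant on [0,T].
  have key := eq_of_forall_integral_deriv_mul_eq_zero hT
    (q := fun t => p t - ∫ s in (0:ℝ)..t, z s) (hp.sub hzc) (fun η h1 h2 h3 => ?_) t ht
  · simp only [intervalIntegral.integral_same, sub_zero] at key
    rw [inner_add_left, ContinuousLinearMap.adjoint_inner_left,
      ContinuousLinearMap.adjoint_inner_left]
    have hi : inner ℝ (∫ s in (0:ℝ)..t, w s) v = ∫ s in (0:ℝ)..t, z s := by
      have hwt := Lp_intervalIntegrable_time w (left_mem_Icc.2 hT.le) ht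
      have := (innerSL ℝ v).intervalIntegral_comp_comm hwt
      simp only [innerSL_apply_apply] at this
      rw [real_inner_comm, ← this]
      exact intervalIntegral.integral_congr fun s _ => real_inner_comm _ _
    rw [hi]
    linarith
  · have hηc : Continuous (deriv η) := h1.continuous_deriv (by simp)
    have i1 : IntegrableOn (fun t => deriv η t * p t) (Ioo 0 T) :=
      ((hηc.continuousOn.mul hp).integrableOn_Icc).mono_set Ioo_subset_Icc_self
    have i2 : IntegrableOn (fun t => deriv η t * ∫ s in (0:ℝ)..t, z s) (Ioo 0 T) :=
      ((hηc.continuousOn.mul hzc).integrableOn_Icc).mono_set Ioo_subset_Icc_self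
    simp only [mul_sub]
    rw [integral_sub i1 i2, integral_deriv_mul_primitive hT.le hz
      (y := fun t => ∫ s in (0:ℝ)..t, z s) (fun t _ => by simp) h1 h3]
    have h5 : ∫ t in Ioo 0 T, deriv η t * p t
        = ∫ t in Ioo 0 T, deriv η t * inner ℝ (A (u t)) (A v) := by
      refine integral_congr_ae ?_
      filter_upwards [hUu] with t ht
      simp only [p]
      rw [ht]
    rw [h5, h η h1 h2 h3 v]
    ring

/-- The weak time derivative of a trajectory. -/
theorem IsTrajectory.weak_deriv (hT : 0 ≤ T) {u w : Lp V 2 (timeMeasure T)}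
    {U : ℝ → H} (h : IsTrajectory A T u w U) {η : ℝ → ℝ} (h1 : ContDiff ℝ ∞ η)
    (h3 : tsupport η ⊆ Ioo 0 T) (v : V) :
    ∫ t in Ioo 0 T, deriv η t * inner ℝ (A (u t)) (A v)
        = - ∫ t in Ioo 0 T, η t * inner ℝ (w t) v := by
  have hz : IntervalIntegrable (fun s => inner ℝ (w s) v) volume 0 T := by
    have hwi : IntervalIntegrable w volume 0 T :=
      Lp_intervalIntegrable_time w (left_mem_Icc.2 hT) (right_mem_Icc.2 hT)
    rw [intervalIntegrable_iff] at hwi ⊢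
    exact hwi.inner_const v
  have hy : ∀ t ∈ Icc 0 T, inner ℝ (U t) (A v) =
      inner ℝ (U 0) (A v) + ∫ s in (0:ℝ)..t, inner ℝ (w s) v := by
    intro t ht
    have h4 := congrArg (fun y => inner ℝ y v) (h.primitive t ht)
    simp only [inner_add_left, ContinuousLinearMap.adjoint_inner_left] at h4
    rw [h4]
    congr 1
    have hwt := Lp_intervalIntegrable_time w (left_mem_Icc.2 hT) ht
    have := (innerSL ℝ v).intervalIntegral_comp_comm hwt
    simp only [innerSL_apply_apply] at this
    rw [real_inner_comm, ← this]
    exact intervalIntegral.integral_congr fun s _ => real_inner_comm _ _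
  rw [← integral_deriv_mul_primitive hT hz hy h1 h3]
  refine integral_congr_ae ?_
  filter_upwards [h.ae_eq] with t h7
  rw [h7]

theorem isTrajectory_equivLp {W : Type*} [NormedAddCommGroup W] [NormedSpace ℝ W] (e : W ≃L[ℝ] V)
    (hT : 0 < T) {u : Lp W 2 (timeMeasure T)} {w : Lp (StrongDual ℝ W) 2 (timeMeasure T)}
    {U : ℝ → H} (hU : ContinuousOn U (Icc 0 T)) (hUu : ∀ᵐ t ∂(timeMeasure T), U t = A (e (u t)))
    (h : ∀ η : ℝ → ℝ, ContDiff ℝ ∞ η → HasCompactSupport η → tsupport η ⊆ Ioo 0 T → ∀ φ : W,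
      ∫ t in Ioo 0 T, deriv η t * inner ℝ (A (e (u t))) (A (e φ))
        = - ∫ t in Ioo 0 T, η t * w t φ) :
    IsTrajectory A T (equivLp e u) (rieszLp e w) U := by
  refine isTrajectory_of_weak_deriv hT hU ?_ fun η h1 h2 h3 v => ?_
  · filter_upwards [hUu, coeFn_equivLp e u] with t h1 h2
    rw [h1, h2]
  · obtain ⟨z, rfl⟩ := e.surjective v
    have h6 : ∀ᵐ t ∂(timeMeasure T), deriv η t * inner ℝ (A (e (u t))) (A (e z))
        = deriv η t * inner ℝ (A (equivLp e u t)) (A (e z)) := by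
      filter_upwards [coeFn_equivLp e u] with t ht
      rw [ht]
    have h7 : ∀ᵐ t ∂(timeMeasure T), η t * w t z = η t * inner ℝ (rieszLp e w t) (e z) := by
      filter_upwards [inner_rieszLp e w] with t ht
      rw [ht]
    rw [← integral_congr_ae h6, ← integral_congr_ae h7]
    exact h η h1 h2 h3 z

theorem IsTrajectory.weak_deriv_equivLp {W : Type*} [NormedAddCommGroup W] [NormedSpace ℝ W]
    (e : W ≃L[ℝ] V) (hT : 0 ≤ T) {u w : Lp V 2 (timeMeasure T)}
    {U : ℝ → H} (h : IsTrajectory A T u w U) {η : ℝ → ℝ} (h1 : ContDiff ℝ ∞ η)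
    (h3 : tsupport η ⊆ Ioo 0 T) (φ : W) :
    ∫ t in Ioo 0 T, deriv η t * inner ℝ (A (e (equivLp e.symm u t))) (A (e φ))
        = - ∫ t in Ioo 0 T, η t * dualLp e w t φ := by
  have h5 : ∀ᵐ t ∂(timeMeasure T), deriv η t * inner ℝ (A (u t)) (A (e φ)) =
      deriv η t * inner ℝ (A (e (equivLp e.symm u t))) (A (e φ)) := by
    filter_upwards [coeFn_equivLp e.symm u] with t h6
    rw [h6, e.apply_symm_apply]
  have h6 : ∀ᵐ t ∂(timeMeasure T), η t * inner ℝ (w t) (e φ) = η t * dualLp e w t φ := by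
    filter_upwards [dualLp_apply e w] with t ht
    rw [ht]
  rw [← integral_congr_ae h5, ← integral_congr_ae h6]
  exact h.weak_deriv hT h1 h3 (e φ)

theorem IsTrajectory.ae_eq_equivLp {W : Type*} [NormedAddCommGroup W] [NormedSpace ℝ W]
    (e : W ≃L[ℝ] V) {u w : Lp V 2 (timeMeasure T)} {U : ℝ → H} (h : IsTrajectory A T u w U) :
    ∀ᵐ t ∂(timeMeasure T), U t = A (e (equivLp e.symm u t)) := by
  filter_upwards [h.ae_eq, coeFn_equivLp e.symm u] with t h1 h2
  rw [h1, h2, e.apply_symm_apply]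

end Abstract

variable {N : ℕ} {D : Set (EuclideanSpace ℝ (Fin N))} {T : ℝ}

theorem inner_h1Incl (v z : H1 D) :
    inner ℝ (h1Incl D (toHilbert D v)) (h1Incl D (toHilbert D z))
      = ∫ x in D, sobolevFun v x * sobolevFun z x := by
  rw [L2.inner_def]
  refine integral_congr_ae (Eventually.of_forall fun x => ?_)
  rw [h1Incl_toHilbert, h1Incl_toHilbert]
  simp [mul_comm]

/-- Weak solutions of an evolution equation are trajectories. -/
theorem IsTimeDerivative.isTrajectory (hT : 0 < T) {u : SolSpace D T}
    {w : Lp (StrongDual ℝ (H1 D)) 2 (timeMeasure T)} (h : IsTimeDerivative u w)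
    {U : ℝ → Lp ℝ 2 (spaceMeasure D)} (hU : ContinuousOn U (Icc 0 T))
    (hUu : ∀ᵐ t ∂(timeMeasure T), U t = sobolevFun (u t)) :
    IsTrajectory (h1Incl D) T (equivLp (toHilbert D) u) (rieszLp (toHilbert D) w) U := by
  refine isTrajectory_equivLp (toHilbert D) hT hU hUu fun η h1 h2 h3 φ => ?_
  rw [← h η h1 h2 h3 φ]
  exact integral_congr_ae (Eventually.of_forall fun t =>
    congrArg (fun r => deriv η t * r) (inner_h1Incl (u t) φ))

theorem IsTrajectory.isTimeDerivative (hT : 0 ≤ T) {u w : Lp (hilbertH1 D) 2 (timeMeasure T)}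
    {U : ℝ → Lp ℝ 2 (spaceMeasure D)} (h : IsTrajectory (h1Incl D) T u w U) :
    IsTimeDerivative (equivLp (toHilbert D).symm u) (dualLp (toHilbert D) w) := by
  intro η h1 h2 h3 φ
  rw [← h.weak_deriv_equivLp (toHilbert D) hT h1 h3 φ]
  exact integral_congr_ae (Eventually.of_forall fun t =>
    congrArg (fun r => deriv η t * r) (inner_h1Incl _ φ).symm)

theorem IsTrajectory.hasInitialValue {u w : Lp (hilbertH1 D) 2 (timeMeasure T)}
    {U : ℝ → Lp ℝ 2 (spaceMeasure D)} (h : IsTrajectory (h1Incl D) T u w U) :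
    HasInitialValue (equivLp (toHilbert D).symm u) (U 0) :=
  ⟨U, h.cont, h.ae_eq_equivLp (toHilbert D), rfl⟩

instance : SecondCountableTopology (hilbertH1 D) :=
  haveI : IsSeparable (spaceMeasure D) := inferInstance
  TopologicalSpace.Subtype.secondCountableTopology _

end WeakFormulation

/-! ## Well-posedness of the weak formulation -/

section WellPosedness

section Abstract

variable {X Y E V W : Type*} [MeasurableSpace X] [MeasurableSpace Y]
  {μ : Measure X} {σ : Measure Y} [IsFiniteMeasure μ] [IsFiniteMeasure σ]
  [NormedAddCommGroup E] [InnerProductSpace ℝ E] [CompleteSpace E]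
  [NormedAddCommGroup V] [InnerProductSpace ℝ V] [CompleteSpace V]
  [NormedAddCommGroup W] [NormedSpace ℝ W] (e : W ≃L[ℝ] V)
  {ι : V →L[ℝ] Lp ℝ 2 μ} {G : V →L[ℝ] Lp E 2 μ} {γ : W →L[ℝ] Lp ℝ 2 σ}
  {f g : ℝ → ℝ} {Kf Kg : ℝ≥0} (hf : LipschitzWith Kf f) (hf0 : f 0 = 0) {T : ℝ}
  {d : CoeffData X Y E μ T} {M M' : ℝ}

/-- The residual of the equation, tested with `φ`. -/
def weakResidual (ι : V →L[ℝ] Lp ℝ 2 μ) (G : V →L[ℝ] Lp E 2 μ) (γ : W →L[ℝ] Lp ℝ 2 σ)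
    (f g : ℝ → ℝ) (d : CoeffData X Y E μ T) (t : ℝ) (l : StrongDual ℝ W) (v φ : W) : ℝ :=
  l φ - (∫ x, inner ℝ (-G (e v) x + f (ι (e v) x) • d.W t x) (G (e φ) x) ∂μ)
      + (∫ x, d.β (t, x) * ι (e v) x * ι (e φ) x ∂μ)
      - (∫ x, d.α (t, x) * f (ι (e v) x) * ι (e φ) x ∂μ)
      + (∫ x, d.b (t, x) * γ v x * γ φ x ∂σ)
      - (∫ x, d.a (t, x) * g (γ v x) * γ φ x ∂σ)

theorem inner_add_reactionOp
    (hV : ∀ v z : V, inner ℝ v z = inner ℝ (ι v) (ι z) + inner ℝ (G v) (G z))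
    (hg : LipschitzWith Kg g) (hd : d.IsBounded M M') (t : ℝ) (y : V) (l : StrongDual ℝ W)
    (v φ : W) (hl : inner ℝ y (e φ) = l φ) :
    inner ℝ (y + reactionOp ι G (γ.comp e.symm.toContinuousLinearMap) hf hf0 g d t (e v)) (e φ)
      = weakResidual e ι G γ f g d t l v φ := by
  rw [inner_add_left, inner_reactionOp hf hf0 hV hg hd, hl, weakResidual]
  have h (v : W) : (γ.comp e.symm.toContinuousLinearMap) (e v) = γ v := by simp
  rw [h, h]
  ring

/-- The exceptional null set of the weak equation may depend on φ; separability of V gives a single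
null set, and with it an identity in V. -/
theorem reactionOp_equation_of_weak [SecondCountableTopology V]
    (hV : ∀ v z : V, inner ℝ v z = inner ℝ (ι v) (ι z) + inner ℝ (G v) (G z))
    (hg : LipschitzWith Kg g) (hd : d.IsBounded M M') {u : Lp W 2 (timeMeasure T)}
    {w : Lp (StrongDual ℝ W) 2 (timeMeasure T)}
    (h : ∀ φ : W, ∀ᵐ t ∂(timeMeasure T), weakResidual e ι G γ f g d t (w t) (u t) φ = 0) :
    ∀ᵐ t ∂(timeMeasure T), rieszLp e w t +
      reactionOp ι G (γ.comp e.symm.toContinuousLinearMap) hf hf0 g d t (equivLp e u t) = 0 := by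
  refine ae_eq_zero_of_forall_inner (𝕜 := ℝ) fun c => ?_
  obtain ⟨φ, rfl⟩ := e.surjective c
  filter_upwards [h φ, inner_rieszLp e w, coeFn_equivLp e u] with t h1 h2 h3
  rw [real_inner_comm, h3, inner_add_reactionOp e hf hf0 hV hg hd t _ (w t) (u t) φ (h2 φ)]
  exact h1

theorem weak_of_reactionOp_equation
    (hV : ∀ v z : V, inner ℝ v z = inner ℝ (ι v) (ι z) + inner ℝ (G v) (G z))
    (hg : LipschitzWith Kg g) (hd : d.IsBounded M M') {u w : Lp V 2 (timeMeasure T)}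
    (h : ∀ᵐ t ∂(timeMeasure T), w t +
      reactionOp ι G (γ.comp e.symm.toContinuousLinearMap) hf hf0 g d t (u t) = 0) (φ : W) :
    ∀ᵐ t ∂(timeMeasure T),
      weakResidual e ι G γ f g d t (dualLp e w t) (equivLp e.symm u t) φ = 0 := by
  filter_upwards [h, dualLp_apply e w, coeFn_equivLp e.symm u] with t h1 h2 h3
  have h4 : u t = e (equivLp e.symm u t) := by rw [h3, e.apply_symm_apply]
  rw [← inner_add_reactionOp e hf hf0 hV hg hd t (w t) _ _ φ (h2 φ).symm, ← h4, h1,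
    inner_zero_left]

omit [CompleteSpace V] in
theorem exists_norm_sub_le_equivLp (T : ℝ) : ∃ K, 0 < K ∧ ∀ u v : Lp W 2 (timeMeasure T),
    ‖u - v‖ ≤ K * ‖equivLp e u - equivLp e v‖ := by
  refine ⟨‖e.symm.toContinuousLinearMap‖ + 1, by positivity, fun u v =>
    (norm_sub_le_equivLp e u v).trans (mul_le_mul_of_nonneg_right ?_ (norm_nonneg _))⟩
  simp

end Abstract

variable {N : ℕ} {D : Set (EuclideanSpace ℝ (Fin N))} {T : ℝ} {Y : Type*} [MeasurableSpace Y]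
  {σ : Measure Y}

/-- Weak solutions of the reaction-diffusion equation with interior and boundary terms. -/
def IsReactionSolution (γ : H1 D →L[ℝ] Lp ℝ 2 σ) (f g : ℝ → ℝ)
    (d : CoeffData (EuclideanSpace ℝ (Fin N)) Y (EuclideanSpace ℝ (Fin N)) (spaceMeasure D) T)
    (u₀ : Lp ℝ 2 (spaceMeasure D)) (u : SolSpace D T) : Prop :=
  ∃ w : Lp (StrongDual ℝ (H1 D)) 2 (timeMeasure T), IsTimeDerivative u w ∧
    HasInitialValue u u₀ ∧ ∀ φ : H1 D, ∀ᵐ t ∂(timeMeasure T),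
      weakResidual (toHilbert D) (h1Incl D) (h1Grad D) γ f g d t (w t) (u t) φ = 0

variable [IsFiniteMeasure σ] [IsSeparable σ] [IsFiniteMeasure (spaceMeasure D)]
  {f g : ℝ → ℝ} {Kf Kg : ℝ≥0} {Bf Bg M M' R : ℝ}

theorem exists_isReactionSolution (hD : IsOpen D) (γ : H1 D →L[ℝ] Lp ℝ 2 σ)
    (hf : LipschitzWith Kf f) (hf0 : f 0 = 0) (hT : 0 < T) (hBf : ∀ s, |f s| ≤ Bf)
    (hg : LipschitzWith Kg g) (hBg : ∀ s, |g s| ≤ Bg) (hga : Antitone g) (hM : 0 ≤ M)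
    {d : CoeffData (EuclideanSpace ℝ (Fin N)) Y (EuclideanSpace ℝ (Fin N)) (spaceMeasure D) T}
    (hd : d.IsBounded M M') (u₀ : Lp ℝ 2 (spaceMeasure D)) :
    ∃ u : SolSpace D T, IsReactionSolution γ f g d u₀ u := by
  obtain ⟨u, w, U, hU, hw, rfl⟩ := reaction_existence (ι := h1Incl D) (G := h1Grad D)
    (γ := γ.comp (toHilbert D).symm.toContinuousLinearMap) hf hf0 (h1Incl_injective hD)
    (h1Incl_denseRange hD) hT norm_h1Incl_le norm_h1Grad_le hBf hg hBg hga hM hd u₀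
  exact ⟨_, _, hU.isTimeDerivative hT.le, hU.hasInitialValue,
    weak_of_reactionOp_equation (toHilbert D) hf hf0 inner_hilbertH1 hg hd hw⟩

theorem isReactionSolution_stability (hD : IsOpen D) (γ : H1 D →L[ℝ] Lp ℝ 2 σ)
    (hf : LipschitzWith Kf f) (hf0 : f 0 = 0) (hT : 0 < T) (hBf : ∀ s, |f s| ≤ Bf)
    (hg : LipschitzWith Kg g) (hBg : ∀ s, |g s| ≤ Bg) (hga : Antitone g) (hM : 0 ≤ M)
    (hM' : 0 ≤ M') (hR : 0 ≤ R) :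
    ∃ C, 0 < C ∧ ∀ d d' : CoeffData (EuclideanSpace ℝ (Fin N)) Y (EuclideanSpace ℝ (Fin N))
        (spaceMeasure D) T, d.IsBounded M M' → d'.IsBounded M M' →
      ∀ (u₀ u₀' : Lp ℝ 2 (spaceMeasure D)) (u u' : SolSpace D T),
      IsReactionSolution γ f g d u₀ u → IsReactionSolution γ f g d' u₀' u' → ‖u₀'‖ ≤ R →
      ∀ δ : ℝ, 0 ≤ δ →
      (∀ᵐ t ∂(timeMeasure T), (∀ᵐ x ∂(spaceMeasure D), |d.β (t, x) - d'.β (t, x)| ≤ δ) ∧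
        (∀ᵐ x ∂(spaceMeasure D), |d.α (t, x) - d'.α (t, x)| ≤ δ) ∧
        (∀ᵐ x ∂σ, |d.b (t, x) - d'.b (t, x)| ≤ δ) ∧
        (∀ᵐ x ∂σ, |d.a (t, x) - d'.a (t, x)| ≤ δ)) →
      ‖u - u'‖ ≤ C * (‖u₀ - u₀'‖ + ‖d.W - d'.W‖ + δ) := by
  obtain ⟨C, hC, h⟩ := reaction_stability (ι := h1Incl D) (G := h1Grad D) (T := T)
    (γ := γ.comp (toHilbert D).symm.toContinuousLinearMap) hf hf0 (h1Incl_injective hD)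
    (h1Incl_denseRange hD) hT norm_h1Incl_le norm_h1Grad_le hBf hg hBg hga hM hM' hR
  obtain ⟨K, hK, hE⟩ := exists_norm_sub_le_equivLp (toHilbert D) T
  refine ⟨K * C, by positivity, ?_⟩
  rintro d d' hd hd' u₀ u₀' u u' ⟨w, hw, ⟨U, hUc, hUu, rfl⟩, he⟩ ⟨w', hw', ⟨U', hUc', hUu', rfl⟩, he'⟩
    h0 δ hδ hdd
  have h1 := h d d' hd hd' _ _ _ _ _ _ (hw.isTrajectory hT hUc hUu) (hw'.isTrajectory hT hUc' hUu')
    (reactionOp_equation_of_weak (toHilbert D) hf hf0 inner_hilbertH1 hg hd he)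
    (reactionOp_equation_of_weak (toHilbert D) hf hf0 inner_hilbertH1 hg hd' he') h0 δ hδ hdd
  calc ‖u - u'‖ ≤ K * ‖equivLp (toHilbert D) u - equivLp (toHilbert D) u'‖ := hE u u'
    _ ≤ K * (C * (‖U 0 - U' 0‖ + ‖d.W - d'.W‖ + δ)) := mul_le_mul_of_nonneg_left h1 hK.le
    _ = _ := by ring

end WellPosedness

/-! ## The solution operators -/

section SolutionOperators

variable {N : ℕ} {D : Set (EuclideanSpace ℝ (Fin N))} {T : ℝ}

/-- Truncation of a real number to `[0, C]`. -/
def clampTo (C r : ℝ) : ℝ := max 0 (min r C)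

theorem clampTo_nonneg (C r : ℝ) : 0 ≤ clampTo C r := le_max_left _ _

theorem clampTo_eq {C r : ℝ} (h0 : 0 ≤ r) (h1 : r ≤ C) : clampTo C r = r := by
  rw [clampTo, min_eq_left h1, max_eq_right h0]

theorem measurable_clampTo (C : ℝ) : Measurable (clampTo C) :=
  (continuous_const.max (continuous_id.min continuous_const)).measurable

theorem abs_clampTo_le {C : ℝ} (hC : 0 ≤ C) (r : ℝ) : |clampTo C r| ≤ C := by
  rw [abs_of_nonneg (clampTo_nonneg C r)]
  exact max_le hC (min_le_right _ _)

theorem abs_clampTo_sub_le (C r s : ℝ) : |clampTo C r - clampTo C s| ≤ |r - s| := by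
  refine (abs_max_sub_max_le_max _ _ _ _).trans (max_le (by simp) ?_)
  exact (abs_min_sub_min_le_max _ _ _ _).trans (max_le le_rfl (by simp))

theorem Lp_ae_norm_le_norm {X F : Type*} [MeasurableSpace X] {μ : Measure X}
    [NormedAddCommGroup F] (a : Lp F ∞ μ) : ∀ᵐ x ∂μ, ‖a x‖ ≤ ‖a‖ := by
  have h := Lp.eLpNorm_ne_top a
  filter_upwards [ae_le_eLpNormEssSup (f := a) (μ := μ)] with x hx
  rw [Lp.norm_def, ← toReal_enorm]
  rw [← eLpNorm_exponent_top] at hx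
  exact ENNReal.toReal_mono h hx

theorem Lp_ae_section {X Y : Type*} [MeasurableSpace X] [MeasurableSpace Y] {μ : Measure X}
    {ν : Measure Y} [SFinite ν] (a a' : Lp ℝ ∞ (μ.prod ν)) :
    ∀ᵐ t ∂μ, ∀ᵐ x ∂ν, |a (t, x) - a' (t, x)| ≤ ‖a - a'‖ := by
  refine Measure.ae_ae_of_ae_prod (p := fun z => |a z - a' z| ≤ ‖a - a'‖) ?_
  filter_upwards [Lp_ae_norm_le_norm (a - a'), Lp.coeFn_sub a a'] with z h1 h2
  rwa [h2] at h1

/-- The weak gradient on `W^{1,∞}(D)`. -/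
def gradInf (D : Set (EuclideanSpace ℝ (Fin N))) :
    W1inf D →L[ℝ] Lp (EuclideanSpace ℝ (Fin N)) ∞ (spaceMeasure D) :=
  ((ContinuousLinearMap.snd ℝ (Lp ℝ ∞ (spaceMeasure D))
    (Lp (EuclideanSpace ℝ (Fin N)) ∞ (spaceMeasure D))).comp
    (WithLp.prodContinuousLinearEquiv 1 ℝ (Lp ℝ ∞ (spaceMeasure D))
    (Lp (EuclideanSpace ℝ (Fin N)) ∞ (spaceMeasure D))).toContinuousLinearMap).comp
    (sobolev D ∞).subtypeL

theorem norm_gradInf_le (v : W1inf D) : ‖gradInf D v‖ ≤ ‖v‖ :=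
  WithLp.norm_snd_le _ (v : WithLp 1 (Lp ℝ ∞ (spaceMeasure D) ×
    Lp (EuclideanSpace ℝ (Fin N)) ∞ (spaceMeasure D)))

/-- The gradient of a time-dependent potential. -/
def gradLp (V : Lp (W1inf D) 2 (timeMeasure T)) :
    Lp (Lp (EuclideanSpace ℝ (Fin N)) ∞ (spaceMeasure D)) 2 (timeMeasure T) :=
  (gradInf D).compLp V

theorem coeFn_gradLp (V : Lp (W1inf D) 2 (timeMeasure T)) :
    ∀ᵐ t ∂(timeMeasure T), gradLp V t = sobolevGrad (V t) := (gradInf D).coeFn_compLp V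

theorem norm_gradLp_sub_le (V V' : Lp (W1inf D) 2 (timeMeasure T)) :
    ‖gradLp V - gradLp V'‖ ≤ ‖V - V'‖ := by
  refine Lp.norm_le_norm_of_ae_le ?_
  filter_upwards [coeFn_gradLp V, coeFn_gradLp V', Lp.coeFn_sub (gradLp V) (gradLp V'),
    Lp.coeFn_sub V V'] with t h1 h2 h3 h4
  rw [h3, h4, Pi.sub_apply, Pi.sub_apply, h1, h2]
  exact norm_gradInf_le (V t - V' t)

theorem norm_gradLp_le (V : Lp (W1inf D) 2 (timeMeasure T)) : ‖gradLp V‖ ≤ ‖V‖ := by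
  refine Lp.norm_le_norm_of_ae_le ?_
  filter_upwards [coeFn_gradLp V] with t h1
  rw [h1]
  exact norm_gradInf_le (V t)

/-- A bounded function of time is square-integrable. -/
def timeL2 {F : Type*} [NormedAddCommGroup F] (V : Lp F ∞ (timeMeasure T)) :
    Lp F 2 (timeMeasure T) := ((Lp.memLp V).mono_exponent le_top).toLp V

theorem coeFn_timeL2 {F : Type*} [NormedAddCommGroup F] (V : Lp F ∞ (timeMeasure T)) :
    timeL2 V =ᵐ[timeMeasure T] V := MemLp.coeFn_toLp _

theorem norm_timeL2_le {F : Type*} [NormedAddCommGroup F] (V : Lp F ∞ (timeMeasure T)) :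
    ‖timeL2 V‖ ≤ √((timeMeasure T).real univ) * ‖V‖ := by
  refine norm_le_of_ae_bound_sqrt (norm_nonneg _) ?_
  filter_upwards [coeFn_timeL2 V, Lp_ae_norm_le_norm V] with t h1 h2
  rwa [h1]

theorem timeL2_sub {F : Type*} [NormedAddCommGroup F] (V V' : Lp F ∞ (timeMeasure T)) :
    timeL2 V - timeL2 V' = timeL2 (V - V') := by
  refine Lp.ext ?_
  filter_upwards [coeFn_timeL2 V, coeFn_timeL2 V', coeFn_timeL2 (V - V'),
    Lp.coeFn_sub (timeL2 V) (timeL2 V'), Lp.coeFn_sub V V'] with t h1 h2 h3 h4 h5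
  rw [h4, h3, h5, Pi.sub_apply, Pi.sub_apply, h1, h2]

theorem norm_le_of_mem_unit [IsFiniteMeasure (spaceMeasure D)] {u₀ : Lp ℝ 2 (spaceMeasure D)}
    (h : ∀ᵐ x ∂(spaceMeasure D), 0 ≤ u₀ x ∧ u₀ x ≤ 1) :
    ‖u₀‖ ≤ √((spaceMeasure D).real univ) := by
  have := norm_le_of_ae_bound_sqrt (w := u₀) zero_le_one (by
    filter_upwards [h] with x hx
    rw [Real.norm_eq_abs, abs_of_nonneg hx.1]
    exact hx.2)
  rwa [mul_one] at this

theorem weakResidual_toHilbert {Y : Type*} [MeasurableSpace Y] {σ : Measure Y}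
    (γ : H1 D →L[ℝ] Lp ℝ 2 σ) (f g : ℝ → ℝ)
    (d : CoeffData (EuclideanSpace ℝ (Fin N)) Y (EuclideanSpace ℝ (Fin N)) (spaceMeasure D) T)
    (t : ℝ) (l : StrongDual ℝ (H1 D)) (v φ : H1 D) :
    weakResidual (toHilbert D) (h1Incl D) (h1Grad D) γ f g d t l v φ =
      l φ - (∫ x in D, inner ℝ (-sobolevGrad v x + f (sobolevFun v x) • d.W t x)
          (sobolevGrad φ x))
        + (∫ x in D, d.β (t, x) * sobolevFun v x * sobolevFun φ x)
        - (∫ x in D, d.α (t, x) * f (sobolevFun v x) * sobolevFun φ x)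
        + (∫ x, d.b (t, x) * γ v x * γ φ x ∂σ)
        - (∫ x, d.a (t, x) * g (γ v x) * γ φ x ∂σ) := rfl

/-! ### Solution operator of the first problem -/

namespace Data1

/-- The coefficients of the equation of the first problem. -/
def coeff (M : ℝ) (ξ : Data1 D T) :
    CoeffData (EuclideanSpace ℝ (Fin N)) Unit (EuclideanSpace ℝ (Fin N)) (spaceMeasure D) T where
  β z := clampTo M (ξ.β z)
  α z := clampTo M (ξ.α z)
  b _ := 0
  a _ := 0
  W := gradLp (timeL2 ξ.V)

theorem Admissible.nonneg {M : ℝ} {ξ : Data1 D T} (h : ξ.Admissible M) : 0 ≤ M :=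
  (norm_nonneg _).trans h.α_le

theorem coeff_isBounded {M : ℝ} {ξ : Data1 D T} (h : ξ.Admissible M) :
    (ξ.coeff M).IsBounded M (√((timeMeasure T).real univ) * M) where
  β_bdd := ⟨(measurable_clampTo M).comp (Lp.stronglyMeasurable ξ.β).measurable,
    fun _ => abs_clampTo_le h.nonneg _⟩
  α_bdd := ⟨(measurable_clampTo M).comp (Lp.stronglyMeasurable ξ.α).measurable,
    fun _ => abs_clampTo_le h.nonneg _⟩
  b_bdd := ⟨measurable_const, fun _ => by simpa [coeff] using h.nonneg⟩
  a_bdd := ⟨measurable_const, fun _ => by simpa [coeff] using h.nonneg⟩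
  β_nonneg _ := clampTo_nonneg _ _
  b_nonneg _ := le_rfl
  a_nonneg _ := le_rfl
  W_le := (norm_gradLp_le _).trans ((norm_timeL2_le _).trans
    (mul_le_mul_of_nonneg_left h.V_le (Real.sqrt_nonneg _)))

/-- For admissible data the truncation changes the coefficients only on a null set, and Fubini
passes this to almost every time. The boundary terms disappear because the boundary is a point with
zero measure. -/
theorem isWeakSolution_iff {f : ℝ → ℝ} {M : ℝ} {ξ : Data1 D T} (h : ξ.Admissible M)
    (u : SolSpace D T) : ξ.IsWeakSolution f u ↔
      IsReactionSolution (σ := (0 : Measure Unit)) 0 f (fun _ => 0) (ξ.coeff M) ξ.u₀ u := by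
  have hβ : ∀ᵐ t ∂(timeMeasure T), ∀ᵐ x ∂(spaceMeasure D),
      (ξ.coeff M).β (t, x) = ξ.β (t, x) := by
    obtain ⟨β₀, h0, h1⟩ := h.β_pos
    refine Measure.ae_ae_of_ae_prod (p := fun z => (ξ.coeff M).β z = ξ.β z) ?_
    filter_upwards [h1, Lp_ae_norm_le_norm ξ.β] with z h2 h3
    exact clampTo_eq (h0.le.trans h2) ((le_abs_self _).trans (h3.trans h.β_le))
  have hα : ∀ᵐ t ∂(timeMeasure T), ∀ᵐ x ∂(spaceMeasure D),
      (ξ.coeff M).α (t, x) = ξ.α (t, x) := by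
    obtain ⟨α₀, h0, h1⟩ := h.α_pos
    refine Measure.ae_ae_of_ae_prod (p := fun z => (ξ.coeff M).α z = ξ.α z) ?_
    filter_upwards [h1, Lp_ae_norm_le_norm ξ.α] with z h2 h3
    exact clampTo_eq (h0.le.trans h2) ((le_abs_self _).trans (h3.trans h.α_le))
  have hW : ∀ᵐ t ∂(timeMeasure T), (ξ.coeff M).W t = sobolevGrad (ξ.V t) := by
    filter_upwards [coeFn_gradLp (timeL2 ξ.V), coeFn_timeL2 ξ.V] with t h1 h2
    rw [← h2]
    exact h1
  have key : ∀ᵐ t ∂(timeMeasure T), ∀ (l : StrongDual ℝ (H1 D)) (v φ : H1 D),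
      weakResidual (σ := (0 : Measure Unit)) (toHilbert D) (h1Incl D) (h1Grad D) 0 f (fun _ => 0)
        (ξ.coeff M) t l v φ =
      l φ - (∫ x in D, inner ℝ (-sobolevGrad v x + f (sobolevFun v x) •
            sobolevGrad (ξ.V t) x) (sobolevGrad φ x))
        + (∫ x in D, ξ.β (t, x) * sobolevFun v x * sobolevFun φ x)
        - (∫ x in D, ξ.α (t, x) * f (sobolevFun v x) * sobolevFun φ x) := by
    filter_upwards [hβ, hα, hW] with t h1 h2 h3 l v φ
    have e1 : ∫ x in D, (ξ.coeff M).β (t, x) * sobolevFun v x * sobolevFun φ x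
        = ∫ x in D, ξ.β (t, x) * sobolevFun v x * sobolevFun φ x :=
      integral_congr_ae (by filter_upwards [h1] with x hx; rw [hx])
    have e2 : ∫ x in D, (ξ.coeff M).α (t, x) * f (sobolevFun v x) * sobolevFun φ x
        = ∫ x in D, ξ.α (t, x) * f (sobolevFun v x) * sobolevFun φ x :=
      integral_congr_ae (by filter_upwards [h2] with x hx; rw [hx])
    rw [weakResidual_toHilbert, e1, e2, h3, integral_zero_measure, integral_zero_measure, add_zero,
      sub_zero]
  constructor
  · rintro ⟨w, hw, hi, he⟩
    refine ⟨w, hw, hi, fun φ => ?_⟩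
    filter_upwards [key, he φ] with t h1 h2
    rw [h1]
    exact h2
  · rintro ⟨w, hw, hi, he⟩
    refine ⟨w, hw, hi, fun φ => ?_⟩
    filter_upwards [key, he φ] with t h1 h2
    rw [h1] at h2
    exact h2

variable [IsFiniteMeasure (spaceMeasure D)]

theorem exists_isWeakSolution (hD : IsOpen D) (hT : 0 < T) {f : ℝ → ℝ} (hf : IsFluxFunction f)
    {M : ℝ} {ξ : Data1 D T} (h : ξ.Admissible M) : ∃ u, ξ.IsWeakSolution f u := by
  obtain ⟨Bf, hBf⟩ := hf.bounded
  obtain ⟨Kf, hKf⟩ := hf.lipschitz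
  obtain ⟨u, hu⟩ := exists_isReactionSolution (σ := (0 : Measure Unit)) hD 0 hKf hf.zero hT hBf
    (LipschitzWith.const 0) (Bg := 0) (fun _ => by simp) antitone_const h.nonneg
    (coeff_isBounded h) ξ.u₀
  exact ⟨u, (isWeakSolution_iff h u).2 hu⟩

theorem solution_spec (hD : IsOpen D) (hT : 0 < T) {f : ℝ → ℝ} (hf : IsFluxFunction f)
    {M : ℝ} {ξ : Data1 D T} (h : ξ.Admissible M) : ξ.IsWeakSolution f (ξ.solution f) := by
  have := exists_isWeakSolution hD hT hf h
  rw [solution, dif_pos this]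
  exact this.choose_spec

/-- The stability estimate holds for arbitrary weak solutions, so it does not matter which one the
solution operator has chosen. The factor s is the norm of the passage from L∞ to L² in time for the
potential, and δ bounds the changes of α and β together. -/
theorem solution_lipschitz (hD : IsOpen D) (hT : 0 < T) {f : ℝ → ℝ} (hf : IsFluxFunction f)
    (M : ℝ) : ∃ C, 0 < C ∧ ∀ ξ η : Data1 D T, ξ.Admissible M → η.Admissible M →
      ‖ξ.solution f - η.solution f‖ ≤ C * ξ.distance η := by
  rcases lt_or_ge M 0 with hM | hM
  -- A negative M admits no data.
  · exact ⟨1, one_pos, fun ξ η hξ _ => absurd hξ.nonneg hM.not_ge⟩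
  obtain ⟨Bf, hBf⟩ := hf.bounded
  obtain ⟨Kf, hKf⟩ := hf.lipschitz
  set s := √((timeMeasure T).real univ)
  have hs : 0 ≤ s := Real.sqrt_nonneg _
  obtain ⟨C, hC, hstab⟩ := isReactionSolution_stability (σ := (0 : Measure Unit)) hD 0 hKf hf.zero
    hT hBf (LipschitzWith.const 0) (Bg := 0) (fun _ => by simp) antitone_const hM
    (mul_nonneg hs hM) (R := √((spaceMeasure D).real univ)) (Real.sqrt_nonneg _)
  refine ⟨C * (1 + s), by positivity, fun ξ η hξ hη => ?_⟩
  have h1 := hstab _ _ (coeff_isBounded hξ) (coeff_isBounded hη) _ _ _ _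
    ((isWeakSolution_iff hξ _).1 (solution_spec hD hT hf hξ))
    ((isWeakSolution_iff hη _).1 (solution_spec hD hT hf hη)) (norm_le_of_mem_unit hη.u₀_mem)
    (‖ξ.α - η.α‖ + ‖ξ.β - η.β‖) (by positivity) (by
      filter_upwards [Lp_ae_section ξ.α η.α, Lp_ae_section ξ.β η.β] with t h2 h3
      refine ⟨?_, ?_, ?_, ?_⟩
      · filter_upwards [h3] with x hx
        exact (abs_clampTo_sub_le _ _ _).trans (hx.trans (by simp))
      · filter_upwards [h2] with x hx
        exact (abs_clampTo_sub_le _ _ _).trans (hx.trans (by simp))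
      · simp
      · simp)
  have h2 : ‖(ξ.coeff M).W - (η.coeff M).W‖ ≤ s * ‖ξ.V - η.V‖ := by
    refine (norm_gradLp_sub_le _ _).trans ?_
    rw [timeL2_sub]
    exact norm_timeL2_le _
  refine h1.trans ?_
  rw [mul_assoc]
  refine mul_le_mul_of_nonneg_left ?_ hC.le
  rw [distance]
  have a1 := norm_nonneg (ξ.α - η.α)
  have a2 := norm_nonneg (ξ.β - η.β)
  have a3 := norm_nonneg (ξ.V - η.V)
  have a4 := norm_nonneg (ξ.u₀ - η.u₀)
  nlinarith [mul_nonneg hs a1, mul_nonneg hs a2, mul_nonneg hs a4]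

end Data1

end SolutionOperators

/-! ### Solution operator of the second problem -/

section BoundarySolutionOperator

variable {N : ℕ} {D Γin Γout : Set (EuclideanSpace ℝ (Fin N))} {T : ℝ}

/-- A coefficient on `Γ`, truncated to `[0, 1]` and extended by zero. -/
def extendCoeff {Y : Type*} (Γ : Set Y) (c : ℝ × Y → ℝ) : ℝ × Y → ℝ :=
  (univ ×ˢ Γ).indicator fun z => clampTo 1 (c z)

theorem extendCoeff_of_mem {Y : Type*} {Γ : Set Y} (c : ℝ × Y → ℝ) (t : ℝ) {x : Y} (hx : x ∈ Γ) :
    extendCoeff Γ c (t, x) = clampTo 1 (c (t, x)) :=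
  indicator_of_mem (by simpa using hx) _

theorem extendCoeff_of_notMem {Y : Type*} {Γ : Set Y} (c : ℝ × Y → ℝ) (t : ℝ) {x : Y}
    (hx : x ∉ Γ) : extendCoeff Γ c (t, x) = 0 :=
  indicator_of_notMem (by simpa using hx) _

theorem extendCoeff_nonneg {Y : Type*} (Γ : Set Y) (c : ℝ × Y → ℝ) (z : ℝ × Y) :
    0 ≤ extendCoeff Γ c z := indicator_nonneg (fun _ _ => clampTo_nonneg _ _) _

theorem isBddCoeff_extendCoeff {Y : Type*} [MeasurableSpace Y] {Γ : Set Y} (hΓ : MeasurableSet Γ)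
    {c : ℝ × Y → ℝ} (hc : Measurable c) : IsBddCoeff (extendCoeff Γ c) 1 where
  meas := ((measurable_clampTo 1).comp hc).indicator (MeasurableSet.univ.prod hΓ)
  le z := by
    by_cases hz : z ∈ (univ ×ˢ Γ : Set (ℝ × Y))
    · rw [extendCoeff, indicator_of_mem hz]
      exact abs_clampTo_le zero_le_one _
    · rw [extendCoeff, indicator_of_notMem hz]
      simp

theorem ae_extendCoeff_sub_le {Y : Type*} [MeasurableSpace Y] {m : Measure Y} {Γ Γ' : Set Y}
    (hΓ : MeasurableSet Γ) {c c' : ℝ × Y → ℝ} {t δ : ℝ} (hδ : 0 ≤ δ)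
    (h : ∀ᵐ x ∂(m.restrict Γ), |c (t, x) - c' (t, x)| ≤ δ) :
    ∀ᵐ x ∂(m.restrict Γ'), |extendCoeff Γ c (t, x) - extendCoeff Γ c' (t, x)| ≤ δ := by
  refine ae_restrict_of_ae ?_
  filter_upwards [(ae_restrict_iff' hΓ).1 h] with x hx
  by_cases hxΓ : x ∈ Γ
  · rw [extendCoeff_of_mem _ _ hxΓ, extendCoeff_of_mem _ _ hxΓ]
    exact (abs_clampTo_sub_le _ _ _).trans (hx hxΓ)
  · rw [extendCoeff_of_notMem _ _ hxΓ, extendCoeff_of_notMem _ _ hxΓ]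
    simpa using hδ

/-- Extending the coefficients by zero turns integrals over parts of the boundary into integrals
over all of it, so that a single trace operator into L²(∂D) serves both terms. -/
theorem integral_extendCoeff {Y : Type*} [MeasurableSpace Y] {m : Measure Y} {Γ Γ' : Set Y}
    (hΓ : MeasurableSet Γ) (hΓΓ' : Γ ⊆ Γ') {c : ℝ × Y → ℝ} {t : ℝ}
    (h : ∀ᵐ x ∂(m.restrict Γ), 0 ≤ c (t, x) ∧ c (t, x) ≤ 1) (p q : Y → ℝ) :
    ∫ x, extendCoeff Γ c (t, x) * p x * q x ∂(m.restrict Γ')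
      = ∫ x, c (t, x) * p x * q x ∂(m.restrict Γ) := by
  have h1 : m.restrict Γ = (m.restrict Γ').restrict Γ := by
    rw [Measure.restrict_restrict hΓ, inter_eq_self_of_subset_left hΓΓ']
  rw [h1, ← integral_indicator hΓ]
  rw [h1, ae_restrict_iff' hΓ] at h
  refine integral_congr_ae ?_
  filter_upwards [h] with x hx
  by_cases hxΓ : x ∈ Γ
  · rw [extendCoeff_of_mem _ _ hxΓ, indicator_of_mem hxΓ, clampTo_eq (hx hxΓ).1 (hx hxΓ).2]
  · rw [extendCoeff_of_notMem _ _ hxΓ, indicator_of_notMem hxΓ]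
    ring

namespace Data2

/-- The coefficients of the equation of the second problem. -/
def coeff (ξ : Data2 D Γin Γout T) :
    CoeffData (EuclideanSpace ℝ (Fin N)) (EuclideanSpace ℝ (Fin N)) (EuclideanSpace ℝ (Fin N))
      (spaceMeasure D) T where
  β _ := 0
  α _ := 0
  b := extendCoeff Γout ξ.b
  a := extendCoeff Γin ξ.a
  W := gradLp ξ.V

theorem coeff_isBounded (hΓin : MeasurableSet Γin) (hΓout : MeasurableSet Γout) {M : ℝ}
    {ξ : Data2 D Γin Γout T} (h : ξ.Admissible M) : ξ.coeff.IsBounded 1 M where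
  β_bdd := ⟨measurable_const, fun _ => by simp [coeff]⟩
  α_bdd := ⟨measurable_const, fun _ => by simp [coeff]⟩
  b_bdd := isBddCoeff_extendCoeff hΓout (Lp.stronglyMeasurable ξ.b).measurable
  a_bdd := isBddCoeff_extendCoeff hΓin (Lp.stronglyMeasurable ξ.a).measurable
  β_nonneg _ := le_rfl
  b_nonneg := extendCoeff_nonneg _ _
  a_nonneg := extendCoeff_nonneg _ _
  W_le := (norm_gradLp_le _).trans h.V_le

variable [IsFiniteMeasure (surfaceMeasure (frontier D))]

theorem isWeakSolution_iff (hΓin : MeasurableSet Γin) (hΓout : MeasurableSet Γout)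
    (hi : Γin ⊆ frontier D) (ho : Γout ⊆ frontier D) {f g : ℝ → ℝ} {M : ℝ}
    {ξ : Data2 D Γin Γout T} (h : ξ.Admissible M) (u : SolSpace D T) :
    ξ.IsWeakSolution f g u ↔ IsReactionSolution (trace D) f g ξ.coeff ξ.u₀ u := by
  have : IsFiniteMeasure (surfaceMeasure Γin) :=
    isFiniteMeasure_of_le (surfaceMeasure (frontier D)) (Measure.restrict_mono hi le_rfl)
  have : IsFiniteMeasure (surfaceMeasure Γout) :=
    isFiniteMeasure_of_le (surfaceMeasure (frontier D)) (Measure.restrict_mono ho le_rfl)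
  have hb : ∀ᵐ t ∂(timeMeasure T), ∀ᵐ x ∂(surfaceMeasure Γout),
      0 ≤ ξ.b (t, x) ∧ ξ.b (t, x) ≤ 1 := by
    obtain ⟨b₀, h0, h1⟩ := h.b_mem
    refine Measure.ae_ae_of_ae_prod (p := fun z => 0 ≤ ξ.b z ∧ ξ.b z ≤ 1) ?_
    filter_upwards [h1] with z h2 using ⟨h0.le.trans h2.1, h2.2⟩
  have ha : ∀ᵐ t ∂(timeMeasure T), ∀ᵐ x ∂(surfaceMeasure Γin),
      0 ≤ ξ.a (t, x) ∧ ξ.a (t, x) ≤ 1 := by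
    obtain ⟨a₀, h0, h1⟩ := h.a_mem
    refine Measure.ae_ae_of_ae_prod (p := fun z => 0 ≤ ξ.a z ∧ ξ.a z ≤ 1) ?_
    filter_upwards [h1] with z h2 using ⟨h0.le.trans h2.1, h2.2⟩
  have key : ∀ᵐ t ∂(timeMeasure T), ∀ (l : StrongDual ℝ (H1 D)) (v φ : H1 D),
      weakResidual (toHilbert D) (h1Incl D) (h1Grad D) (trace D) f g ξ.coeff t l v φ =
      l φ - (∫ x in D, inner ℝ (-sobolevGrad v x + f (sobolevFun v x) •
            sobolevGrad (ξ.V t) x) (sobolevGrad φ x))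
        + (∫ x, ξ.b (t, x) * trace D v x * trace D φ x ∂(surfaceMeasure Γout))
        - ∫ x, ξ.a (t, x) * g (trace D v x) * trace D φ x ∂(surfaceMeasure Γin) := by
    filter_upwards [hb, ha, coeFn_gradLp ξ.V] with t h1 h2 h3 l v φ
    have h3' : ξ.coeff.W t = sobolevGrad (ξ.V t) := h3
    have e1 : ∫ x, ξ.coeff.b (t, x) * trace D v x * trace D φ x ∂(surfaceMeasure (frontier D))
        = ∫ x, ξ.b (t, x) * trace D v x * trace D φ x ∂(surfaceMeasure Γout) :=
      integral_extendCoeff hΓout ho h1 _ _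
    have e2 : ∫ x, ξ.coeff.a (t, x) * g (trace D v x) * trace D φ x
          ∂(surfaceMeasure (frontier D))
        = ∫ x, ξ.a (t, x) * g (trace D v x) * trace D φ x ∂(surfaceMeasure Γin) :=
      integral_extendCoeff hΓin hi h2 (fun x => g (trace D v x)) _
    have e3 : ∫ x in D, ξ.coeff.β (t, x) * sobolevFun v x * sobolevFun φ x = 0 := by
      simp [coeff]
    have e4 : ∫ x in D, ξ.coeff.α (t, x) * f (sobolevFun v x) * sobolevFun φ x = 0 := by
      simp [coeff]
    rw [weakResidual_toHilbert, e1, e2, e3, e4, h3', add_zero, sub_zero]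
  constructor
  · rintro ⟨w, hw, hi, he⟩
    refine ⟨w, hw, hi, fun φ => ?_⟩
    filter_upwards [key, he φ] with t h1 h2
    rw [h1, sub_eq_zero]
    exact h2
  · rintro ⟨w, hw, hi, he⟩
    refine ⟨w, hw, hi, fun φ => ?_⟩
    filter_upwards [key, he φ] with t h1 h2
    rw [h1, sub_eq_zero] at h2
    exact h2

variable [IsFiniteMeasure (spaceMeasure D)]

theorem solution_spec (hD : IsOpen D) (hT : 0 < T) (hΓin : MeasurableSet Γin)
    (hΓout : MeasurableSet Γout) (hi : Γin ⊆ frontier D) (ho : Γout ⊆ frontier D) {f g : ℝ → ℝ}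
    (hf : IsFluxFunction f) (hg : IsInflowFunction g) {M : ℝ} {ξ : Data2 D Γin Γout T}
    (h : ξ.Admissible M) : ξ.IsWeakSolution f g (ξ.solution f g) := by
  obtain ⟨Bf, hBf⟩ := hf.bounded
  obtain ⟨Kf, hKf⟩ := hf.lipschitz
  obtain ⟨Bg, hBg⟩ := hg.bounded
  obtain ⟨Kg, hKg⟩ := hg.lipschitz
  obtain ⟨u, hu⟩ := exists_isReactionSolution hD (trace D) hKf hf.zero hT hBf
    hKg hBg hg.antitone zero_le_one (coeff_isBounded hΓin hΓout h) ξ.u₀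
  have hex : ∃ u, ξ.IsWeakSolution f g u := ⟨u, (isWeakSolution_iff hΓin hΓout hi ho h u).2 hu⟩
  rw [solution, dif_pos hex]
  exact hex.choose_spec

theorem solution_lipschitz (hD : IsOpen D) (hT : 0 < T) (hΓin : MeasurableSet Γin)
    (hΓout : MeasurableSet Γout) (hi : Γin ⊆ frontier D) (ho : Γout ⊆ frontier D) {f g : ℝ → ℝ}
    (hf : IsFluxFunction f) (hg : IsInflowFunction g) (M : ℝ) :
    ∃ C, 0 < C ∧ ∀ ξ η : Data2 D Γin Γout T, ξ.Admissible M → η.Admissible M →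
      ‖ξ.solution f g - η.solution f g‖ ≤ C * ξ.distance η := by
  rcases lt_or_ge M 0 with hM | hM
  · exact ⟨1, one_pos, fun ξ η hξ _ => absurd ((norm_nonneg ξ.V).trans hξ.V_le) hM.not_ge⟩
  have : IsFiniteMeasure (surfaceMeasure Γin) :=
    isFiniteMeasure_of_le (surfaceMeasure (frontier D)) (Measure.restrict_mono hi le_rfl)
  have : IsFiniteMeasure (surfaceMeasure Γout) :=
    isFiniteMeasure_of_le (surfaceMeasure (frontier D)) (Measure.restrict_mono ho le_rfl)
  obtain ⟨Bf, hBf⟩ := hf.bounded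
  obtain ⟨Kf, hKf⟩ := hf.lipschitz
  obtain ⟨Bg, hBg⟩ := hg.bounded
  obtain ⟨Kg, hKg⟩ := hg.lipschitz
  obtain ⟨C, hC, hstab⟩ := isReactionSolution_stability hD (trace D) hKf hf.zero
    hT hBf hKg hBg hg.antitone zero_le_one hM (R := √((spaceMeasure D).real univ))
    (Real.sqrt_nonneg _)
  refine ⟨C, hC, fun ξ η hξ hη => ?_⟩
  have h1 := hstab _ _ (coeff_isBounded hΓin hΓout hξ) (coeff_isBounded hΓin hΓout hη) _ _ _ _
    ((isWeakSolution_iff hΓin hΓout hi ho hξ _).1 (solution_spec hD hT hΓin hΓout hi ho hf hg hξ))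
    ((isWeakSolution_iff hΓin hΓout hi ho hη _).1 (solution_spec hD hT hΓin hΓout hi ho hf hg hη))
    (norm_le_of_mem_unit hη.u₀_mem) (‖ξ.a - η.a‖ + ‖ξ.b - η.b‖) (by positivity) (by
      filter_upwards [Lp_ae_section ξ.a η.a, Lp_ae_section ξ.b η.b] with t h2 h3
      refine ⟨?_, ?_, ?_, ?_⟩
      · exact Eventually.of_forall fun x => by simp only [coeff, sub_self, abs_zero]; positivity
      · exact Eventually.of_forall fun x => by simp only [coeff, sub_self, abs_zero]; positivity
      · exact ae_extendCoeff_sub_le hΓout (by positivity) (h3.mono fun x hx => hx.trans (by simp))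
      · exact ae_extendCoeff_sub_le hΓin (by positivity) (h2.mono fun x hx => hx.trans (by simp)))
  have h2 : ‖ξ.coeff.W - η.coeff.W‖ ≤ ‖ξ.V - η.V‖ := norm_gradLp_sub_le _ _
  refine h1.trans (mul_le_mul_of_nonneg_left ?_ hC.le)
  rw [distance]
  linarith

end Data2

end BoundarySolutionOperator

/-! ## Finite surface measure of a Lipschitz boundary -/

section Surface

variable {N : ℕ} {D : Set (EuclideanSpace ℝ (Fin N))}

/-- Where φ > 0 the point is interior to D, and where φ < 0 it is interior to the complement. -/
theorem eq_zero_of_mem_frontier_of_eventually {X : Type*} [TopologicalSpace X] {D : Set X}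
    {φ : X → ℝ} (hφ : Continuous φ) {x : X} (hx : x ∈ frontier D)
    (h : ∀ᶠ y in 𝓝 x, (y ∈ D ↔ 0 < φ y)) : φ x = 0 := by
  rcases lt_trichotomy (φ x) 0 with h1 | h1 | h1
  · have h2 : ∀ᶠ y in 𝓝 x, φ y < 0 := hφ.continuousAt.eventually_lt continuousAt_const h1
    have h3 : ∀ᶠ y in 𝓝 x, y ∈ Dᶜ := by
      filter_upwards [h, h2] with y h4 h5 h6
      exact absurd (h4.1 h6) h5.not_gt
    exact absurd (frontier_subset_closure hx)
      (by rw [← mem_compl_iff, ← interior_compl]; exact mem_interior_iff_mem_nhds.2 h3)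
  · exact h1
  · have h2 : ∀ᶠ y in 𝓝 x, 0 < φ y := continuousAt_const.eventually_lt hφ.continuousAt h1
    have h3 : ∀ᶠ y in 𝓝 x, y ∈ D := by
      filter_upwards [h, h2] with y h4 h5 using h4.2 h5
    exact absurd (mem_interior_iff_mem_nhds.2 h3) hx.2

/-- The set lies in the image of a ball of the hyperplane e^⊥, of dimension N - 1, under the
Lipschitz map y ↦ y + ζ(y)e, and Lipschitz maps enlarge Hausdorff measure by a finite factor. -/
theorem hausdorffMeasure_graph_lt_top (hN : 1 ≤ N) {e : EuclideanSpace ℝ (Fin N)} (he : ‖e‖ = 1)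
    {ζ : EuclideanSpace ℝ (Fin N) → ℝ} {K : ℝ≥0} (hζ : LipschitzWith K ζ)
    {s : Set (EuclideanSpace ℝ (Fin N))} (hs : Bornology.IsBounded s)
    (hsg : ∀ x ∈ s, ζ (x - inner ℝ e x • e) = inner ℝ e x) :
    μH[(N - 1 : ℕ)] s < ⊤ := by
  have hdim : Module.finrank ℝ (ℝ ∙ e)ᗮ = N - 1 := by
    have : Fact (Module.finrank ℝ (EuclideanSpace ℝ (Fin N)) = (N - 1) + 1) :=
      ⟨by rw [finrank_euclideanSpace_fin]; omega⟩
    exact Submodule.finrank_orthogonal_span_singleton (by rintro rfl; simp at he)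
  obtain ⟨R, hR⟩ := hs.exists_norm_le
  set F : (ℝ ∙ e)ᗮ → EuclideanSpace ℝ (Fin N) := fun y => y + ζ y • e
  have hF : LipschitzWith (1 + K) F := by
    refine LipschitzWith.subtype_val _ |>.add ?_
    refine LipschitzWith.of_dist_le_mul fun y y' => ?_
    rw [dist_eq_norm, ← sub_smul, norm_smul, he, mul_one]
    exact hζ.dist_le_mul y y'
  -- If ‖x‖ ≤ R, then x - ⟨e,x⟩e has norm at most R + R.
  have hsub : s ⊆ F '' Metric.closedBall 0 (R + R) := by
    intro x hx
    have hmem : x - inner ℝ e x • e ∈ (ℝ ∙ e)ᗮ := by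
      rw [Submodule.mem_orthogonal_singleton_iff_inner_right, inner_sub_right, inner_smul_right,
        real_inner_self_eq_norm_sq, he]
      ring
    refine ⟨⟨_, hmem⟩, ?_, ?_⟩
    · rw [mem_closedBall_zero_iff]
      change ‖x - inner ℝ e x • e‖ ≤ R + R
      refine (norm_sub_le _ _).trans (add_le_add (hR x hx) ?_)
      rw [norm_smul, he, mul_one]
      refine (norm_inner_le_norm _ _).trans ?_
      rw [he, one_mul]
      exact hR x hx
    · simp only [F]
      rw [hsg x hx]
      simp
  have hfin : μH[(N - 1 : ℕ)] (Metric.closedBall (0 : (ℝ ∙ e)ᗮ) (R + R)) < ⊤ := by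
    rw [← hdim]
    exact (isCompact_closedBall _ _).measure_lt_top
  refine (measure_mono hsub).trans_lt ((hF.hausdorffMeasure_image_le (Nat.cast_nonneg _) _).trans_lt
    (ENNReal.mul_lt_top ?_ hfin))
  exact ENNReal.rpow_lt_top_of_nonneg (Nat.cast_nonneg _) ENNReal.coe_ne_top

/-- A Lipschitz boundary has finite surface measure. -/
theorem isFiniteMeasure_surfaceMeasure (hN : 1 ≤ N) (hDb : Bornology.IsBounded D)
    (hDL : HasLipschitzBoundary D) : IsFiniteMeasure (surfaceMeasure (frontier D)) := by
  have hc : IsCompact (frontier D) :=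
    hDb.isCompact_closure.of_isClosed_subset isClosed_frontier frontier_subset_closure
  refine ⟨?_⟩
  rw [Measure.restrict_apply_univ]
  refine hc.measure_lt_top_of_nhdsWithin fun x₀ hx₀ => ?_
  obtain ⟨e, ζ, K, he, hζ, hloc⟩ := hDL x₀ hx₀
  obtain ⟨U, hU, hUo, hxU⟩ := eventually_nhds_iff.1 hloc
  refine ⟨frontier D ∩ (U ∩ Metric.ball x₀ 1), inter_mem_nhdsWithin _
    ((hUo.inter Metric.isOpen_ball).mem_nhds ⟨hxU, Metric.mem_ball_self one_pos⟩), ?_⟩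
  have h1 : μH[(N - 1 : ℕ)] (frontier D ∩ (U ∩ Metric.ball x₀ 1)) < ⊤ := by
    refine hausdorffMeasure_graph_lt_top hN he hζ
      (Metric.isBounded_ball.subset (inter_subset_right.trans inter_subset_right)) fun x hx => ?_
    have hφ : Continuous fun x => inner ℝ e x - ζ (x - inner ℝ e x • e) := by
      have := hζ.continuous
      fun_prop
    have := eq_zero_of_mem_frontier_of_eventually hφ hx.1 (by
      filter_upwards [hUo.mem_nhds hx.2.1] with y hy
      rw [hU y hy, sub_pos])
    linarith
  -- The surface measure is a finite multiple of the Hausdorff measure.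
  rw [Measure.euclideanHausdorffMeasure_def, Measure.smul_apply]
  exact ENNReal.mul_lt_top (by simp) h1

end Surface

/-! ## Conditional expectations and the nested distance -/

section NestedDistance

/-- A measurable null set B containing the exceptions satisfies ∫ κ_ξ(B) P(dξ) = P(B) = 0. Hence the
conditional laws of admissible data charge only admissible data. -/
theorem IsRegularCondProb.ae_ae {X : Type*} {m m₀ : MeasurableSpace X} {P : Measure X}
    {κ : X → Measure X} (h : IsRegularCondProb P κ m) (hm : m ≤ m₀) {p : X → Prop}
    (hp : ∀ᵐ ξ ∂P, p ξ) : ∀ᵐ ξ ∂P, ∀ᵐ η ∂(κ ξ), p η := by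
  obtain ⟨B, hB, hBm, hB0⟩ := exists_measurable_superset_of_null (ae_iff.1 hp)
  have h1 := h.setLIntegral_eq B hBm univ MeasurableSet.univ
  rw [Measure.restrict_univ, inter_univ, hB0,
    lintegral_eq_zero_iff ((h.meas B hBm).mono hm le_rfl)] at h1
  filter_upwards [h1] with ξ hξ
  exact ae_iff.2 (measure_mono_null hB hξ)

variable {X : Type*} [MeasurableSpace X]

/-- Expectations of a Lipschitz function under the marginals of a coupling. -/
theorem abs_integral_sub_le_of_coupling {d : X → X → ℝ} {H : X → ℝ} (hH : Measurable H) {K : ℝ}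
    (hK : 0 ≤ K) (hHd : ∀ ξ η, |H ξ - H η| ≤ K * d ξ η) {μ ν : Measure X}
    [IsProbabilityMeasure μ] (hμ : Integrable H μ) (hν : Integrable H ν)
    {π : Measure (X × X)} (h1 : ∀ A, MeasurableSet A → π (A ×ˢ univ) = μ A)
    (h2 : ∀ B, MeasurableSet B → π (univ ×ˢ B) = ν B) :
    ENNReal.ofReal |∫ ξ, H ξ ∂μ - ∫ ξ, H ξ ∂ν| ≤
      ENNReal.ofReal K * (∫⁻ z, ENNReal.ofReal (d z.1 z.2) ^ (2 : ℝ) ∂π) ^ (1 / 2 : ℝ) := by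
  have e1 : π.map Prod.fst = μ := by
    ext A hA
    rw [Measure.map_apply measurable_fst hA, ← h1 A hA, prod_univ]
  have e2 : π.map Prod.snd = ν := by
    ext A hA
    rw [Measure.map_apply measurable_snd hA, ← h2 A hA, univ_prod]
  have hπ : IsProbabilityMeasure π := ⟨by
    rw [← univ_prod_univ, h1 _ MeasurableSet.univ, measure_univ]⟩
  have i1 : Integrable (fun z : X × X => H z.1) π := by
    rw [← e1] at hμ
    exact hμ.comp_measurable measurable_fst
  have i2 : Integrable (fun z : X × X => H z.2) π := by
    rw [← e2] at hν
    exact hν.comp_measurable measurable_snd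
  have e3 : ∫ ξ, H ξ ∂μ - ∫ ξ, H ξ ∂ν = ∫ z, (H z.1 - H z.2) ∂π := by
    rw [integral_sub i1 i2, ← e1, ← e2,
      integral_map measurable_fst.aemeasurable hH.aestronglyMeasurable,
      integral_map measurable_snd.aemeasurable hH.aestronglyMeasurable]
  have hm : AEStronglyMeasurable (fun z : X × X => H z.1 - H z.2) π := i1.1.sub i2.1
  rw [e3, ← Real.norm_eq_abs, ofReal_norm]
  calc ‖∫ z, (H z.1 - H z.2) ∂π‖ₑ ≤ ∫⁻ z, ‖H z.1 - H z.2‖ₑ ∂π := enorm_integral_le_lintegral_enorm _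
    _ = eLpNorm (fun z : X × X => H z.1 - H z.2) 1 π := eLpNorm_one_eq_lintegral_enorm.symm
    _ ≤ eLpNorm (fun z : X × X => H z.1 - H z.2) 2 π :=
        eLpNorm_le_eLpNorm_of_exponent_le (by norm_num) hm
    _ = (∫⁻ z, ‖H z.1 - H z.2‖ₑ ^ (2 : ℝ) ∂π) ^ (1 / 2 : ℝ) := by
        rw [eLpNorm_eq_lintegral_rpow_enorm_toReal (by norm_num) (by norm_num)]
        simp
    _ ≤ (∫⁻ z, ENNReal.ofReal K ^ (2 : ℝ) * ENNReal.ofReal (d z.1 z.2) ^ (2 : ℝ) ∂π)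
          ^ (1 / 2 : ℝ) := by
        refine ENNReal.rpow_le_rpow (lintegral_mono fun z => ?_) (by norm_num)
        rw [← ENNReal.mul_rpow_of_nonneg _ _ (by norm_num), ← ENNReal.ofReal_mul hK]
        refine ENNReal.rpow_le_rpow ?_ (by norm_num)
        rw [← ofReal_norm]
        exact ENNReal.ofReal_le_ofReal (hHd _ _)
    _ = ENNReal.ofReal K * (∫⁻ z, ENNReal.ofReal (d z.1 z.2) ^ (2 : ℝ) ∂π) ^ (1 / 2 : ℝ) := by
        rw [lintegral_const_mul' _ _ (ENNReal.rpow_ne_top_of_nonneg (by norm_num) ENNReal.ofReal_ne_top),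
          ENNReal.mul_rpow_of_nonneg _ _ (by norm_num), ← ENNReal.rpow_mul]
        norm_num

/-- The bound holds for every coupling of the marginals, in particular for nested ones, and so for
their infimum; if there are none, the distance is infinite. -/
theorem abs_integral_sub_le_nestedDist {d : X → X → ℝ} {H : X → ℝ} (hH : Measurable H) {K : ℝ}
    (hK : 0 ≤ K) (hHd : ∀ ξ η, |H ξ - H η| ≤ K * d ξ η) {μ ν : Measure X}
    [IsProbabilityMeasure μ] [IsProbabilityMeasure ν] (hμ : Integrable H μ) (hν : Integrable H ν)
    (T : ℝ) (F G : ℝ → MeasurableSpace X) :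
    ENNReal.ofReal |∫ ξ, H ξ ∂μ - ∫ ξ, H ξ ∂ν| ≤
      ENNReal.ofReal K * nestedDist T F G (fun ξ η => ENNReal.ofReal (d ξ η)) 2 μ ν := by
  -- For K = 0 the right side is zero even if the distance is infinite, so the two expectations must
  -- coincide; the product measure is a coupling that shows it.
  rcases hK.eq_or_lt with rfl | hK'
  · refine (abs_integral_sub_le_of_coupling hH le_rfl hHd hμ hν (π := μ.prod ν)
      (fun A _ => by simp) (fun B _ => by simp)).trans ?_
    simp
  have hK0 : ENNReal.ofReal K ≠ 0 := by simpa using hK'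
  rw [mul_comm, ← ENNReal.div_le_iff hK0 ENNReal.ofReal_ne_top, nestedDist, one_div,
    ENNReal.le_rpow_inv_iff (by norm_num)]
  refine le_iInf₂ fun π hπ => ?_
  rw [← ENNReal.le_rpow_inv_iff (by norm_num), ENNReal.div_le_iff hK0 ENNReal.ofReal_ne_top,
    mul_comm, ← one_div]
  exact abs_integral_sub_le_of_coupling hH hK hHd hμ hν hπ.marginal_fst hπ.marginal_snd

/-- Conditional expectations of a function that is Lipschitz on a bounded set of full measure. -/
theorem condExp_sub_le_nestedDist {B : Type*} [NormedAddCommGroup B] {p : X → B}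
    (hp : Measurable[_, borel B] p) (hpi : Function.Injective p) {d : X → X → ℝ}
    (hpd : ∀ ξ η, ‖p ξ - p η‖ ≤ d ξ η) {A : Set X} {R : ℝ} (hR : ∀ ξ ∈ A, ‖p ξ‖ ≤ R)
    {h : X → ℝ} {K : ℝ} (hK : 0 ≤ K) (hh : ∀ ξ ∈ A, ∀ η ∈ A, |h ξ - h η| ≤ K * ‖p ξ - p η‖)
    (T : ℝ) {F : ℝ → MeasurableSpace X} (hF : ∀ t, F t ≤ ‹MeasurableSpace X›)
    {P Q : Measure X} (hP : ∀ᵐ ξ ∂P, ξ ∈ A) (hQ : ∀ᵐ ξ ∂Q, ξ ∈ A) {κ κ' : X → Measure X} {t : ℝ}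
    (hκ : IsRegularCondProb P κ (F t)) (hκ' : IsRegularCondProb Q κ' (F t)) :
    ∀ᶠ z in ae P ×ˢ ae Q, Integrable h (κ z.1) ∧ Integrable h (κ' z.2) ∧
      ENNReal.ofReal |∫ ξ, h ξ ∂(κ z.1) - ∫ ξ, h ξ ∂(κ' z.2)| ≤
        ENNReal.ofReal K *
          nestedDist T F F (fun ξ η => ENNReal.ofReal (d ξ η)) 2 (κ z.1) (κ' z.2) := by
  -- McShane extension from the image of A in the Banach space. It replaces h, which is not known to
  -- be measurable, by a Borel function that equals h on A; boundedness of A makes it integrable.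
  have hl : LipschitzOnWith (Real.toNNReal K) (Function.extend p h 0) (p '' A) := by
    refine LipschitzOnWith.of_dist_le_mul ?_
    rintro _ ⟨ξ, hξ, rfl⟩ _ ⟨η, hη, rfl⟩
    rw [hpi.extend_apply, hpi.extend_apply, Real.dist_eq, dist_eq_norm, Real.coe_toNNReal K hK]
    exact hh ξ hξ η hη
  obtain ⟨k, hk, hkh⟩ := hl.extend_real
  set H : X → ℝ := fun ξ => k (p ξ)
  have hHh : ∀ ξ ∈ A, H ξ = h ξ := fun ξ hξ => by
    have h1 : Function.extend p h 0 (p ξ) = k (p ξ) := hkh (mem_image_of_mem p hξ)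
    rw [hpi.extend_apply] at h1
    exact h1.symm
  have hHm : Measurable H := by
    let _ : MeasurableSpace B := borel B
    have : BorelSpace B := ⟨rfl⟩
    exact hk.continuous.measurable.comp hp
  have hHd : ∀ ξ η, |H ξ - H η| ≤ K * d ξ η := fun ξ η => by
    have h1 := hk.dist_le_mul (p ξ) (p η)
    rw [Real.dist_eq, dist_eq_norm, Real.coe_toNNReal K hK] at h1
    exact h1.trans (mul_le_mul_of_nonneg_left (hpd ξ η) hK)
  have hHb : ∀ ξ ∈ A, ‖H ξ‖ ≤ |k 0| + K * R := fun ξ hξ => by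
    have h1 := hk.dist_le_mul (p ξ) 0
    rw [Real.dist_eq, dist_zero_right, Real.coe_toNNReal K hK] at h1
    have h2 := abs_sub_abs_le_abs_sub (k (p ξ)) (k 0)
    have h3 := mul_le_mul_of_nonneg_left (hR ξ hξ) hK
    rw [Real.norm_eq_abs]
    simp only [H]
    linarith
  have key : ∀ μ : Measure X, IsProbabilityMeasure μ → (∀ᵐ ξ ∂μ, ξ ∈ A) → Integrable H μ :=
    fun μ _ hμ => Integrable.of_bound hHm.aestronglyMeasurable _ (hμ.mono hHb)
  -- The product filter provides independent sets of full measure for the two conditions ξ and η.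
  refine ((hκ.ae_ae (hF t) hP).prod_mk (hκ'.ae_ae (hF t) hQ)).mono ?_
  rintro ⟨ξ, η⟩ ⟨h1, h2⟩
  have p1 := hκ.isProb ξ
  have p2 := hκ'.isProb η
  have i1 := key _ p1 h1
  have i2 := key _ p2 h2
  have e1 : H =ᵐ[κ ξ] h := h1.mono hHh
  have e2 : H =ᵐ[κ' η] h := h2.mono hHh
  refine ⟨i1.congr e1, i2.congr e2, ?_⟩
  rw [← integral_congr_ae e1, ← integral_congr_ae e2]
  exact abs_integral_sub_le_nestedDist hHm hK hHd i1 i2 T F F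

end NestedDistance

/-! ## Observable events are Borel -/

section Filtration

/-- Integration of a linear functional over a set, as a functional on `Lᵖ` of a finite measure. -/
def setIntegralFunctional {X E : Type*} [MeasurableSpace X] [NormedAddCommGroup E]
    [NormedSpace ℝ E] (μ : Measure X) [IsFiniteMeasure μ] (p : ℝ≥0∞) [hp : Fact (1 ≤ p)]
    (l : StrongDual ℝ E) (S : Set X) : Lp E p μ →L[ℝ] ℝ :=
  have hi (a : Lp E p μ) : Integrable (fun x => l (a x)) (μ.restrict S) :=
    l.integrable_comp ((memLp_one_iff_integrable.1 ((Lp.memLp a).mono_exponent hp.out)).restrict)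
  LinearMap.mkContinuous
    { toFun := fun a => ∫ x in S, l (a x) ∂μ
      map_add' := fun a a' => by
        rw [← integral_add (hi a) (hi a')]
        refine integral_congr_ae (ae_restrict_of_ae ?_)
        filter_upwards [Lp.coeFn_add a a'] with x hx
        rw [hx, Pi.add_apply, map_add]
      map_smul' := fun c a => by
        rw [RingHom.id_apply, smul_eq_mul, ← integral_const_mul]
        refine integral_congr_ae (ae_restrict_of_ae ?_)
        filter_upwards [Lp.coeFn_smul c a] with x hx
        rw [hx, Pi.smul_apply, map_smul, smul_eq_mul] }
    (‖l‖ * (μ univ ^ (1 / (1 : ℝ≥0∞).toReal - 1 / p.toReal)).toReal) fun a => by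
      have h1 : ‖∫ x in S, l (a x) ∂μ‖ ≤ ∫ x, ‖l‖ * ‖a x‖ ∂μ := by
        have hi' : Integrable (fun x => ‖l‖ * ‖a x‖) μ :=
          (memLp_one_iff_integrable.1 ((Lp.memLp a).mono_exponent hp.out)).norm.const_mul _
        refine (norm_integral_le_of_norm_le hi'.restrict
          (Eventually.of_forall fun x => l.le_opNorm _)).trans ?_
        exact setIntegral_le_integral hi' (Eventually.of_forall fun x => by positivity)
      refine h1.trans ?_
      rw [integral_const_mul, mul_assoc]
      refine mul_le_mul_of_nonneg_left ?_ (norm_nonneg l)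
      rw [integral_norm_eq_lintegral_enorm (Lp.aestronglyMeasurable a),
        ← eLpNorm_one_eq_lintegral_enorm, mul_comm, Lp.norm_def, ← ENNReal.toReal_mul]
      refine ENNReal.toReal_mono ?_
        (eLpNorm_le_eLpNorm_mul_rpow_measure_univ hp.out (Lp.aestronglyMeasurable a))
      refine ENNReal.mul_ne_top (Lp.eLpNorm_ne_top a) (ENNReal.rpow_ne_top_of_nonneg ?_
        (measure_ne_top μ univ))
      have : 1 / p.toReal ≤ 1 := by
        rcases eq_or_ne p ⊤ with rfl | hpt
        · simp
        · have : 1 ≤ p.toReal := by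
            rw [← ENNReal.toReal_one]
            exact ENNReal.toReal_mono hpt hp.out
          exact div_le_one_of_le₀ this (by positivity)
      simpa using this

variable {N : ℕ} {D Γin Γout : Set (EuclideanSpace ℝ (Fin N))} {T : ℝ}

/-- The integral of a function in `W^{1,∞}(D)` over `A`. -/
def potentialFunctional [IsFiniteMeasure (spaceMeasure D)] (A : Set (EuclideanSpace ℝ (Fin N))) :
    StrongDual ℝ (W1inf D) :=
  (setIntegralFunctional (spaceMeasure D) ∞ (ContinuousLinearMap.id ℝ ℝ) A).comp
    (((ContinuousLinearMap.fst ℝ (Lp ℝ ∞ (spaceMeasure D))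
    (Lp (EuclideanSpace ℝ (Fin N)) ∞ (spaceMeasure D))).comp
    (WithLp.prodContinuousLinearEquiv 1 ℝ (Lp ℝ ∞ (spaceMeasure D))
    (Lp (EuclideanSpace ℝ (Fin N)) ∞ (spaceMeasure D))).toContinuousLinearMap).comp
    (sobolev D ∞).subtypeL)

theorem comap_le_comap_borel {X B : Type*} [TopologicalSpace B] (p : X → B) {ψ : B → ℝ}
    (hψ : Continuous ψ) :
    MeasurableSpace.comap (fun ξ => ψ (p ξ)) (borel ℝ) ≤ MeasurableSpace.comap p (borel B) := by
  have : Measurable[borel B, borel ℝ] ψ := hψ.borel_measurable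
  change MeasurableSpace.comap (ψ ∘ p) (borel ℝ) ≤ _
  rw [← MeasurableSpace.comap_comp]
  exact MeasurableSpace.comap_mono this.comap_le

/-- Each generator is a continuous linear functional of the data, as integration over a set is
continuous on Lᵖ of a finite measure. -/
theorem Data1.filtration_le [IsFiniteMeasure (spaceMeasure D)] (t : ℝ) :
    Data1.filtration t ≤ (inferInstance : MeasurableSpace (Data1 D T)) := by
  refine iSup₂_le fun s _ => iSup₂_le fun A _ => sup_le (sup_le ?_ ?_) ?_
  · exact comap_le_comap_borel Data1.toProd ((setIntegralFunctional
      ((timeMeasure T).prod (spaceMeasure D)) ∞ (ContinuousLinearMap.id ℝ ℝ)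
      (Ioo 0 s ×ˢ A)).continuous.comp continuous_fst)
  · exact comap_le_comap_borel Data1.toProd ((setIntegralFunctional
      ((timeMeasure T).prod (spaceMeasure D)) ∞ (ContinuousLinearMap.id ℝ ℝ)
      (Ioo 0 s ×ˢ A)).continuous.comp (continuous_fst.comp continuous_snd))
  · exact comap_le_comap_borel Data1.toProd ((setIntegralFunctional
      (timeMeasure T) ∞ (potentialFunctional A) (Ioo 0 s)).continuous.comp
      (continuous_fst.comp (continuous_snd.comp continuous_snd)))

theorem Data2.filtration_le [IsFiniteMeasure (spaceMeasure D)]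
    [IsFiniteMeasure (surfaceMeasure Γin)] [IsFiniteMeasure (surfaceMeasure Γout)] (t : ℝ) :
    Data2.filtration t ≤ (inferInstance : MeasurableSpace (Data2 D Γin Γout T)) := by
  refine iSup₂_le fun s _ => iSup₂_le fun A _ => sup_le (sup_le ?_ ?_) ?_
  · exact comap_le_comap_borel Data2.toProd ((setIntegralFunctional
      ((timeMeasure T).prod (surfaceMeasure Γin)) ∞ (ContinuousLinearMap.id ℝ ℝ)
      (Ioo 0 s ×ˢ A)).continuous.comp continuous_fst)
  · exact comap_le_comap_borel Data2.toProd ((setIntegralFunctional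
      ((timeMeasure T).prod (surfaceMeasure Γout)) ∞ (ContinuousLinearMap.id ℝ ℝ)
      (Ioo 0 s ×ˢ A)).continuous.comp (continuous_fst.comp continuous_snd))
  · exact comap_le_comap_borel Data2.toProd ((setIntegralFunctional
      (timeMeasure T) 2 (potentialFunctional A) (Ioo 0 s)).continuous.comp
      (continuous_fst.comp (continuous_snd.comp continuous_snd)))

end Filtration

/-! ## The main result -/

section Main

theorem norm_le_sum_four {A B C D : Type*} [NormedAddCommGroup A] [NormedAddCommGroup B]
    [NormedAddCommGroup C] [NormedAddCommGroup D] (x : A × B × C × D) :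
    ‖x‖ ≤ ‖x.1‖ + ‖x.2.1‖ + ‖x.2.2.1‖ + ‖x.2.2.2‖ := by
  have h1 := norm_nonneg x.1
  have h2 := norm_nonneg x.2.1
  have h3 := norm_nonneg x.2.2.1
  have h4 := norm_nonneg x.2.2.2
  simp only [Prod.norm_def]
  refine max_le (by linarith) (max_le (by linarith) (max_le (by linarith) (by linarith)))

theorem sum_four_le_norm {A B C D : Type*} [NormedAddCommGroup A] [NormedAddCommGroup B]
    [NormedAddCommGroup C] [NormedAddCommGroup D] (x : A × B × C × D) :
    ‖x.1‖ + ‖x.2.1‖ + ‖x.2.2.1‖ + ‖x.2.2.2‖ ≤ 4 * ‖x‖ := by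
  have h1 := norm_fst_le x
  have h2 := norm_snd_le x
  have h3 := norm_fst_le x.2
  have h4 := norm_snd_le x.2
  have h5 := norm_fst_le x.2.2
  have h6 := norm_snd_le x.2.2
  linarith

/-- A solution operator that is Lipschitz on a bounded set of admissible data is stable, and so
are the conditional expectations of Lipschitz functions of the solution. -/
theorem exists_stability_constants {X : Type*} [MeasurableSpace X] {B₁ B₂ B₃ B₄ S : Type*}
    [NormedAddCommGroup B₁] [NormedAddCommGroup B₂] [NormedAddCommGroup B₃] [NormedAddCommGroup B₄]
    [NormedAddCommGroup S] {p : X → B₁ × B₂ × B₃ × B₄} (hp : Measurable[_, borel _] p)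
    (hpi : Function.Injective p) {d : X → X → ℝ}
    (hd : ∀ ξ η, d ξ η = ‖(p ξ).1 - (p η).1‖ + ‖(p ξ).2.1 - (p η).2.1‖
      + ‖(p ξ).2.2.1 - (p η).2.2.1‖ + ‖(p ξ).2.2.2 - (p η).2.2.2‖) {A : X → Prop} {R : ℝ}
    (hR : ∀ ξ, A ξ → ‖(p ξ).1‖ + ‖(p ξ).2.1‖ + ‖(p ξ).2.2.1‖ + ‖(p ξ).2.2.2‖ ≤ R)
    {sol : X → S}
    (hsol : ∃ C, 0 < C ∧ ∀ ξ η, A ξ → A η → ‖sol ξ - sol η‖ ≤ C * d ξ η) {T : ℝ} (hT : 0 < T)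
    {F : ℝ → MeasurableSpace X} (hF : ∀ t, F t ≤ ‹MeasurableSpace X›) (dt : ℝ → X → X → ℝ≥0∞) :
    ∃ C C' : ℝ, 0 < C ∧ 0 < C' ∧
      (∀ ξ η, A ξ → A η → ‖sol ξ - sol η‖ ≤ C * Real.exp (C' * T / 2) * d ξ η) ∧
      ∀ (L : ℝ≥0) (Φ : S → ℝ), LipschitzWith L Φ →
      ∀ P Q : Measure X, IsProbabilityMeasure P → IsProbabilityMeasure Q →
      (∀ᵐ ξ ∂P, A ξ) → (∀ᵐ ξ ∂Q, A ξ) →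
      ∀ κ κ' : ℝ → X → Measure X,
      (∀ t ∈ Icc 0 T, IsRegularCondProb P (κ t) (F t)) →
      (∀ t ∈ Icc 0 T, IsRegularCondProb Q (κ' t) (F t)) →
      ∀ r CH : ℝ, 1 ≤ r → 0 < CH →
      ConditionalHolder T F dt r CH P Q κ κ' →
      ∀ t ∈ Icc 0 T, ∀ᶠ z in ae P ×ˢ ae Q,
        Integrable (fun ξ => Φ (sol ξ)) (κ t z.1) ∧
        Integrable (fun ξ => Φ (sol ξ)) (κ' t z.2) ∧
        ENNReal.ofReal |(∫ ξ, Φ (sol ξ) ∂(κ t z.1)) - ∫ ξ, Φ (sol ξ) ∂(κ' t z.2)|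
          ≤ ENNReal.ofReal
              (L * C * max 1 (Real.sqrt (CH * (T - t))) * Real.exp (C' * (T - t) / 2))
            * nestedDist T F F (fun ξ η => ENNReal.ofReal (d ξ η)) 2 (κ t z.1) (κ' t z.2) := by
  obtain ⟨C, hC, hSC⟩ := hsol
  have hpd (ξ η) : ‖p ξ - p η‖ ≤ d ξ η := (norm_le_sum_four _).trans_eq (hd ξ η).symm
  have hdp (ξ η) : d ξ η ≤ 4 * ‖p ξ - p η‖ := (hd ξ η).trans_le (sum_four_le_norm (p ξ - p η))
  -- The Lipschitz extension is made in the maximum norm of the product, and a sum of four norms is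
  -- at most four times their maximum. The exponent 1 is arbitrary: any positive choice makes the
  -- exponential at least one.
  refine ⟨4 * C, 1, by positivity, one_pos, fun ξ η hξ hη => ?_, ?_⟩
  · refine (hSC ξ η hξ hη).trans (mul_le_mul_of_nonneg_right ?_ ((norm_nonneg _).trans (hpd ξ η)))
    have := Real.one_le_exp (x := 1 * T / 2) (by positivity)
    nlinarith
  intro L Φ hΦ P Q _ _ hP hQ κ κ' hκ hκ' r CH _ _ _ t ht
  have h := condExp_sub_le_nestedDist (A := {ξ | A ξ}) (h := fun ξ => Φ (sol ξ)) (K := L * (4 * C))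
    hp hpi hpd (fun ξ hξ => (norm_le_sum_four _).trans (hR ξ hξ)) (by positivity) (fun ξ hξ η hη => ?_) T hF hP hQ (hκ t ht) (hκ' t ht)
  · refine h.mono fun z hz => ⟨hz.1, hz.2.1, hz.2.2.trans ?_⟩
    refine mul_le_mul_left (ENNReal.ofReal_le_ofReal ?_) _
    have h1 : 1 ≤ max 1 (Real.sqrt (CH * (T - t))) := le_max_left _ _
    have h2 : 1 ≤ Real.exp (1 * (T - t) / 2) := Real.one_le_exp (by linarith [ht.2])
    have h3 : 0 ≤ (L : ℝ) * (4 * C) := by positivity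
    rw [mul_assoc (L * (4 * C) : ℝ)]
    exact le_mul_of_one_le_right h3 (one_le_mul_of_one_le_of_one_le h1 h2)
  · have h1 := hΦ.dist_le_mul (sol ξ) (sol η)
    rw [Real.dist_eq, dist_eq_norm] at h1
    refine h1.trans ?_
    rw [mul_assoc]
    refine mul_le_mul_of_nonneg_left ((hSC ξ η hξ hη).trans ?_) L.2
    calc C * d ξ η ≤ C * (4 * ‖p ξ - p η‖) := mul_le_mul_of_nonneg_left (hdp ξ η) hC.le
      _ = _ := by ring

variable {N : ℕ} {D Γin Γout : Set (EuclideanSpace ℝ (Fin N))} {T : ℝ}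

theorem Data1.toProd_injective : Function.Injective (Data1.toProd (D := D) (T := T)) := by
  intro ξ η h
  simp only [Data1.toProd, Prod.mk.injEq] at h
  exact Data1.ext h.1 h.2.1 h.2.2.1 h.2.2.2

theorem Data2.toProd_injective :
    Function.Injective (Data2.toProd (D := D) (Γin := Γin) (Γout := Γout) (T := T)) := by
  intro ξ η h
  simp only [Data2.toProd, Prod.mk.injEq] at h
  exact Data2.ext h.1 h.2.1 h.2.2.1 h.2.2.2

theorem Data1.sum_norm_le [IsFiniteMeasure (spaceMeasure D)] {M : ℝ} {ξ : Data1 D T}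
    (h : ξ.Admissible M) : ‖ξ.α‖ + ‖ξ.β‖ + ‖ξ.V‖ + ‖ξ.u₀‖ ≤ M + M + M + √((spaceMeasure D).real univ) :=
  add_le_add (add_le_add (add_le_add h.α_le h.β_le) h.V_le) (norm_le_of_mem_unit h.u₀_mem)

theorem Lp_norm_le_one {Y : Type*} [MeasurableSpace Y] {m : Measure Y} [IsFiniteMeasure m]
    {a : Lp ℝ ∞ m} (h : ∃ a₀ > 0, ∀ᵐ z ∂m, a₀ ≤ a z ∧ a z ≤ 1) : ‖a‖ ≤ 1 := by
  obtain ⟨a₀, h0, h1⟩ := h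
  have := Lp.norm_le_of_ae_bound (f := a) zero_le_one (by
    filter_upwards [h1] with z hz
    rw [Real.norm_eq_abs, abs_of_nonneg (h0.le.trans hz.1)]
    exact hz.2)
  simpa using this

theorem Data2.sum_norm_le [IsFiniteMeasure (spaceMeasure D)]
    [IsFiniteMeasure (surfaceMeasure Γin)] [IsFiniteMeasure (surfaceMeasure Γout)] {M : ℝ}
    {ξ : Data2 D Γin Γout T} (h : ξ.Admissible M) :
    ‖ξ.a‖ + ‖ξ.b‖ + ‖ξ.V‖ + ‖ξ.u₀‖ ≤ 1 + 1 + M + √((spaceMeasure D).real univ) :=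
  add_le_add (add_le_add (add_le_add (Lp_norm_le_one h.a_mem) (Lp_norm_le_one h.b_mem)) h.V_le)
    (norm_le_of_mem_unit h.u₀_mem)

end Main

end

theorem corollary4p6 (N : ℕ) (hN1 : 1 ≤ N) (hN3 : N ≤ 3)
    (D : Set (EuclideanSpace ℝ (Fin N))) (hDo : IsOpen D) (hDb : Bornology.IsBounded D)
    (hDL : HasLipschitzBoundary D) (T : ℝ) (hT : 0 < T) (M : ℝ)
    (f : ℝ → ℝ) (hf : IsFluxFunction f) :
    -- first problem
    (∃ C C' : ℝ, 0 < C ∧ 0 < C' ∧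
      (∀ ξ η : Data1 D T, ξ.Admissible M → η.Admissible M →
        ‖ξ.solution f - η.solution f‖ ≤ C * Real.exp (C' * T / 2) * ξ.distance η) ∧
      ∀ (L : ℝ≥0) (Φ : SolSpace D T → ℝ), LipschitzWith L Φ →
      ∀ P Q : Measure (Data1 D T), IsProbabilityMeasure P → IsProbabilityMeasure Q →
      (∀ᵐ ξ ∂P, ξ.Admissible M) → (∀ᵐ ξ ∂Q, ξ.Admissible M) →
      ∀ κ κ' : ℝ → Data1 D T → Measure (Data1 D T),
      (∀ t ∈ Icc 0 T, IsRegularCondProb P (κ t) (Data1.filtration t)) →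
      (∀ t ∈ Icc 0 T, IsRegularCondProb Q (κ' t) (Data1.filtration t)) →
      ∀ r CH : ℝ, 1 ≤ r → 0 < CH →
      ConditionalHolder T Data1.filtration Data1.distanceUpTo r CH P Q κ κ' →
      ∀ t ∈ Icc 0 T, ∀ᶠ z in ae P ×ˢ ae Q,
        Integrable (fun ξ => Φ (ξ.solution f)) (κ t z.1) ∧
        Integrable (fun ξ => Φ (ξ.solution f)) (κ' t z.2) ∧
        ENNReal.ofReal
            |(∫ ξ, Φ (ξ.solution f) ∂(κ t z.1)) - ∫ ξ, Φ (ξ.solution f) ∂(κ' t z.2)|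
          ≤ ENNReal.ofReal
              (L * C * max 1 (Real.sqrt (CH * (T - t))) * Real.exp (C' * (T - t) / 2))
            * nestedDist T Data1.filtration Data1.filtration
                (fun ξ η => ENNReal.ofReal (ξ.distance η)) 2 (κ t z.1) (κ' t z.2)) ∧
    -- second problem
    (∀ Γin Γout : Set (EuclideanSpace ℝ (Fin N)),
      (∃ U, IsOpen U ∧ Γin = U ∩ frontier D) → (∃ U, IsOpen U ∧ Γout = U ∩ frontier D) →
      Disjoint Γin Γout → Γout.Nonempty →
      ∀ g : ℝ → ℝ, IsInflowFunction g →
      ∃ C C' : ℝ, 0 < C ∧ 0 < C' ∧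
      (∀ ξ η : Data2 D Γin Γout T, ξ.Admissible M → η.Admissible M →
        ‖ξ.solution f g - η.solution f g‖ ≤ C * Real.exp (C' * T / 2) * ξ.distance η) ∧
      ∀ (L : ℝ≥0) (Φ : SolSpace D T → ℝ), LipschitzWith L Φ →
      ∀ P Q : Measure (Data2 D Γin Γout T), IsProbabilityMeasure P → IsProbabilityMeasure Q →
      (∀ᵐ ξ ∂P, ξ.Admissible M) → (∀ᵐ ξ ∂Q, ξ.Admissible M) →
      ∀ κ κ' : ℝ → Data2 D Γin Γout T → Measure (Data2 D Γin Γout T),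
      (∀ t ∈ Icc 0 T, IsRegularCondProb P (κ t) (Data2.filtration t)) →
      (∀ t ∈ Icc 0 T, IsRegularCondProb Q (κ' t) (Data2.filtration t)) →
      ∀ r CH : ℝ, 1 ≤ r → 0 < CH →
      ConditionalHolder T Data2.filtration Data2.distanceUpTo r CH P Q κ κ' →
      ∀ t ∈ Icc 0 T, ∀ᶠ z in ae P ×ˢ ae Q,
        Integrable (fun ξ => Φ (ξ.solution f g)) (κ t z.1) ∧
        Integrable (fun ξ => Φ (ξ.solution f g)) (κ' t z.2) ∧
        ENNReal.ofReal
            |(∫ ξ, Φ (ξ.solution f g) ∂(κ t z.1)) - ∫ ξ, Φ (ξ.solution f g) ∂(κ' t z.2)|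
          ≤ ENNReal.ofReal
              (L * C * max 1 (Real.sqrt (CH * (T - t))) * Real.exp (C' * (T - t) / 2))
            * nestedDist T Data2.filtration Data2.filtration
                (fun ξ η => ENNReal.ofReal (ξ.distance η)) 2 (κ t z.1) (κ' t z.2)) := by
  have hfin : IsFiniteMeasure (spaceMeasure D) :=
    ⟨by rw [Measure.restrict_apply_univ]; exact hDb.measure_lt_top⟩
  -- Bounded coefficients and bounded nonlinearities on the boundary are square integrable because
  -- the boundary has finite surface measure.
  have hsurf := isFiniteMeasure_surfaceMeasure hN1 hDb hDL
  refine ⟨?_, ?_⟩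
  · exact exists_stability_constants (S := SolSpace D T) (p := Data1.toProd (D := D) (T := T))
      (d := Data1.distance) (A := Data1.Admissible M) (sol := Data1.solution f) (comap_measurable _)
      (Data1.toProd_injective (D := D) (T := T)) (fun ξ η => rfl) (fun ξ hξ => Data1.sum_norm_le hξ)
      (Data1.solution_lipschitz hDo hT hf M) hT Data1.filtration_le _
  · rintro Γin Γout ⟨U, hU, hΓin⟩ ⟨U', hU', hΓout⟩ _ _ g hg
    have hi : Γin ⊆ frontier D := hΓin ▸ inter_subset_right
    have ho : Γout ⊆ frontier D := hΓout ▸ inter_subset_right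
    have hmi : MeasurableSet Γin :=
      hΓin ▸ hU.measurableSet.inter isClosed_frontier.measurableSet
    have hmo : MeasurableSet Γout :=
      hΓout ▸ hU'.measurableSet.inter isClosed_frontier.measurableSet
    have : IsFiniteMeasure (surfaceMeasure Γin) :=
      isFiniteMeasure_of_le (surfaceMeasure (frontier D)) (Measure.restrict_mono hi le_rfl)
    have : IsFiniteMeasure (surfaceMeasure Γout) :=
      isFiniteMeasure_of_le (surfaceMeasure (frontier D)) (Measure.restrict_mono ho le_rfl)
    exact exists_stability_constants (S := SolSpace D T)
      (p := Data2.toProd (D := D) (Γin := Γin) (Γout := Γout) (T := T)) (d := Data2.distance)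
      (A := Data2.Admissible M) (sol := Data2.solution f g) (comap_measurable _)
      Data2.toProd_injective (fun ξ η => rfl) (fun ξ hξ => Data2.sum_norm_le hξ)
      (Data2.solution_lipschitz hDo hT hmi hmo hi ho hf hg M) hT Data2.filtration_le _
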